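/- Conventions. All languages are computable (they may contain relation, function and constant symbols) and all structures are countable. For an $L$-structure $\mathcal S$ with domain a subset of $\mathbb N$, $D(\mathcal S)\subseteq\mathbb N$ denotes its atomic diagram, i.e. the set of Gödel numbers of the atomic sentences and negations of atomic sentences of $L\cup\operatorname{dom}(\mathcal S)$ that are true in $\mathcal S$. A structure is computably presentable if it is isomorphic to a structure with domain contained in $\mathbb N$ whose atomic diagram is computable. For infinite $L$-structures $\mathcal A,\mathcal B$, the class $\{\mathcal A,\mathcal B\}$ is identified with the class of all structures with domain contained in $\mathbb N$ that are isomorphic to $\mathcal A$ or to $\mathcal B$. For classes $\mathcal K_0$ of $L_0$-structures and $\mathcal K_1$ of $L_1$-structures (with domains contained in $\mathbb N$), $\mathcal K_0\le_{tc}\mathcal K_1$ means that there is a Turing operator $\Phi=\varphi_e$ such that for each $\mathcal S\in\mathcal K_0$ the function $\varphi_e^{D(\mathcal S)}$ is the characteristic function of the atomic diagram of a structure $\Phi(\mathcal S)\in\mathcal K_1$, and for all $\mathcal S,\mathcal T\in\mathcal K_0$ we have $\mathcal S\cong\mathcal T$ if and only if $\Phi(\mathcal S)\cong\Phi(\mathcal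 T)$. We write $\mathcal K_0\equiv_{tc}\mathcal K_1$ if $\mathcal K_0\le_{tc}\mathcal K_1$ and $\mathcal K_1\le_{tc}\mathcal K_0$. We write $\mathcal A\equiv_1\mathcal B$ if $\mathcal A$ and $\mathcal B$ satisfy the same finitary $\exists$-sentences. A $\Pi^c_1$ formula is a c.e. conjunction of formulas $\forall\bar y\,\theta(\bar x,\bar y)$ with $\theta$ finitary and quantifier-free; a $\Sigma^c_2$ sentence is a c.e. disjunction of sentences $\exists\bar x\,\psi(\bar x)$, where the $\psi$ are $\Pi^c_1$ formulas (given by their indices); $\Sigma^c_2\text{-}Th(\mathcal S)$ is the set of all $\Sigma^c_2$ sentences true in $\mathcal S$. Finally, $\omega$ and $\omega^\star$ denote the linear order of the natural numbers and its reverse. Theorem. Let $L$ be a computable language and let $\mathcal A$ and $\mathcal B$ be countably infinite $L$-structures such that $\mathcal A\not\cong\mathcal B$. Then the following conditions are equivalent: (i) $\{\mathcal A,\mathcal B\}\equiv_{tc}\{\omega,\omega^\star\}$. (ii) Both $\mathcal A$ and $\mathcal B$ are computably presentable, $\mathcal A\equiv_1\mathcal B$, $\Sigma^c_2\text{-}Th(\mathcal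 A)\smallsetminus\Sigma^c_2\text{-}Th(\mathcal B)\ne\emptyset$, and $\Sigma^c_2\text{-}Th(\mathcal B)\smallsetminus\Sigma^c_2\text{-}Th(\mathcal A)\ne\emptyset$. -/

import Mathlib

universe u v u' v' w w'

namespace TC

open FirstOrder FirstOrder.Language

/-- A computable language: the symbols carry injective codes in `ℕ` such that one can decide
whether a number codes a symbol and, if so, compute the arity of that symbol. -/
class ComputableLanguage (L : FirstOrder.Language.{u, v}) where
  /-- The code of a function symbol (constants are function symbols of arity `0`). -/
  funCode : (Σ n, L.Functions n) → ℕ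
  /-- The code of a relation symbol. -/
  relCode : (Σ n, L.Relations n) → ℕ
  funCode_injective : Function.Injective funCode
  relCode_injective : Function.Injective relCode
  funArity_computable : ∃ g : ℕ → Option ℕ, Computable g ∧
    ∀ c n, g c = some n ↔ ∃ f : L.Functions n, funCode ⟨n, f⟩ = c
  relArity_computable : ∃ g : ℕ → Option ℕ, Computable g ∧
    ∀ c n, g c = some n ↔ ∃ R : L.Relations n, relCode ⟨n, R⟩ = c

/-- The language with one binary relation symbol is computable. -/
instance : ComputableLanguage FirstOrder.Language.order where
  funCode := fun _ => 0
  relCode := fun _ => 0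
  funCode_injective := fun f => Empty.elim f.2
  relCode_injective := fun _ _ _ => Subsingleton.elim _ _
  funArity_computable := ⟨fun _ => none, Computable.const none, fun c n =>
    ⟨fun h => (Option.noConfusion rfl (heq_of_eq h)), fun h => Empty.elim h.choose⟩⟩
  relArity_computable := ⟨fun c => if c = 0 then some 2 else none,
    (Primrec.ite (Primrec.eq.comp Primrec.id (Primrec.const 0)) (Primrec.const (some 2))
      (Primrec.const none)).to_comp, fun c n => by
        constructor
        · intro h
          have hc : c = 0 := by
            by_contra hc
            simp [hc] at h
          simp only [hc, if_true] at h
          obtain rfl : 2 = n := Option.some.inj h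
          exact ⟨.le, hc.symm⟩
        · rintro ⟨R, rfl⟩
          cases R
          rfl⟩

section Coding

variable {L : FirstOrder.Language.{u, v}} [ComputableLanguage L]

/-- Gödel number of a term, given numbers for its variables. -/
def termCode {α : Type u'} (c : α → ℕ) : L.Term α → ℕ
  | .var a => Nat.pair 0 (c a)
  | .func (l := l) f ts =>
      Nat.pair 1 (Nat.pair (ComputableLanguage.funCode ⟨l, f⟩)
        (Encodable.encode (List.ofFn fun i => termCode c (ts i))))

/-- Numbers for the variables of a `BoundedFormula`, given numbers for its free variables. -/
def varCode {α : Type u'} (c : α → ℕ) (n : ℕ) : α ⊕ Fin n → ℕ :=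
  Sum.elim (fun a => 2 * c a) (fun i => 2 * (i : ℕ) + 1)

/-- Gödel number of a finitary first-order formula, given numbers for its free variables. -/
def formulaCode {α : Type u'} (c : α → ℕ) : ∀ {n : ℕ}, L.BoundedFormula α n → ℕ
  | _, .falsum => Nat.pair 0 0
  | n, .equal t s => Nat.pair 1 (Nat.pair (termCode (varCode c n) t) (termCode (varCode c n) s))
  | n, .rel (l := l) R ts =>
      Nat.pair 2 (Nat.pair (ComputableLanguage.relCode ⟨l, R⟩)
        (Encodable.encode (List.ofFn fun i => termCode (varCode c n) (ts i))))
  | _, .imp φ ψ => Nat.pair 3 (Nat.pair (formulaCode c φ) (formulaCode c ψ))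
  | _, .all φ => Nat.pair 4 (formulaCode c φ)

end Coding

/-- A structure whose domain is a set of natural numbers. -/
structure NatStructure (L : FirstOrder.Language.{u, v}) where
  /-- The domain. -/
  dom : Set ℕ
  /-- The interpretation of the symbols. -/
  str : L.Structure dom

instance {L : FirstOrder.Language.{u, v}} (S : NatStructure L) : L.Structure S.dom := S.str

/-- Basic formulas: atomic formulas and negations of atomic formulas. -/
def IsBasic {L : FirstOrder.Language.{u, v}} {α : Type u'} (φ : L.Formula α) : Prop :=
  BoundedFormula.IsAtomic φ ∨ ∃ ψ : L.Formula α, BoundedFormula.IsAtomic ψ ∧ φ = ψ.not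

/-- The atomic diagram `D(S)`, as a set of Gödel numbers: the basic sentences in the language with
a name for every element of `S` that are true in `S`. The name of an element is the variable
indexed by that element, which is interpreted as the element itself and coded by it. -/
def NatStructure.diagram {L : FirstOrder.Language.{u, v}} [ComputableLanguage L] (S : NatStructure L) :
    Set ℕ :=
  {n | ∃ φ : L.Formula S.dom, IsBasic φ ∧ φ.Realize (id : S.dom → S.dom) ∧
    formulaCode (Subtype.val : S.dom → ℕ) φ = n}

/-- Two structures are isomorphic. -/
def Iso (L : FirstOrder.Language.{u, v}) (M : Type w) (N : Type w') [L.Structure M] [L.Structure N] : Prop :=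
  Nonempty (M ≃[L] N)

/-- `M` has a computable copy: an isomorphic structure with domain contained in `ℕ`
whose atomic diagram is computable. -/
def ComputablyPresentable (L : FirstOrder.Language.{u, v}) [ComputableLanguage L] (M : Type w)
    [L.Structure M] : Prop :=
  ∃ S : NatStructure L, Iso L S.dom M ∧ ComputablePred fun n => n ∈ S.diagram

open Classical in
/-- The first `n` values of the characteristic function of `X`. -/
noncomputable def initialSegment (X : Set ℕ) (n : ℕ) : List Bool :=
  (List.range n).map fun i => decide (i ∈ X)

/-- A Turing operator, given by its computations from finite initial segments of the oracle:
`y ∈ onString σ x` says that on input `x` the operator halts with output `y` on every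
oracle that extends `σ`. -/
structure TuringOperator where
  /-- The value computed from the oracle information `σ` on a given input. -/
  onString : List Bool → ℕ →. ℕ
  partrec : Partrec₂ onString
  consistent : ∀ (σ τ : List Bool) (x y z : ℕ),
    σ <+: τ → y ∈ onString σ x → z ∈ onString τ x → y = z

/-- `Φ^X(x) = y`. -/
def TuringOperator.Computes (Φ : TuringOperator) (X : Set ℕ) (x y : ℕ) : Prop :=
  ∃ n, y ∈ Φ.onString (initialSegment X n) x

open Classical in
/-- `Φ^X` is the characteristic function of `Y`. -/
def TuringOperator.Maps (Φ : TuringOperator) (X Y : Set ℕ) : Prop :=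
  ∀ x, Φ.Computes X x (if x ∈ Y then 1 else 0)

/-- `Φ` is a Turing computable embedding of the class `K₀` into the class `K₁`;
`F S` is the structure `Φ(S)`. -/
def TuringOperator.IsEmbedding (Φ : TuringOperator)
    {L₀ : FirstOrder.Language.{u, v}} {L₁ : FirstOrder.Language.{u', v'}} [ComputableLanguage L₀] [ComputableLanguage L₁]
    (K₀ : Set (NatStructure L₀)) (K₁ : Set (NatStructure L₁)) : Prop :=
  ∃ F : NatStructure L₀ → NatStructure L₁,
    (∀ S ∈ K₀, F S ∈ K₁ ∧ Φ.Maps S.diagram (F S).diagram) ∧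
    ∀ S ∈ K₀, ∀ T ∈ K₀, Iso L₀ S.dom T.dom ↔ Iso L₁ (F S).dom (F T).dom

/-- `K₀ ≤_tc K₁`. -/
def TCReducible {L₀ : FirstOrder.Language.{u, v}} {L₁ : FirstOrder.Language.{u', v'}} [ComputableLanguage L₀]
    [ComputableLanguage L₁] (K₀ : Set (NatStructure L₀)) (K₁ : Set (NatStructure L₁)) : Prop :=
  ∃ Φ : TuringOperator, Φ.IsEmbedding K₀ K₁

/-- `K₀ ≡_tc K₁`. -/
def TCEquivalent {L₀ : FirstOrder.Language.{u, v}} {L₁ : FirstOrder.Language.{u', v'}} [ComputableLanguage L₀]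
    [ComputableLanguage L₁] (K₀ : Set (NatStructure L₀)) (K₁ : Set (NatStructure L₁)) : Prop :=
  TCReducible K₀ K₁ ∧ TCReducible K₁ K₀

/-- The class `{M, N}`: all copies of `M` and of `N` with domain contained in `ℕ`. -/
def pairClass (L : FirstOrder.Language.{u, v}) (M : Type w) (N : Type w') [L.Structure M] [L.Structure N] :
    Set (NatStructure L) :=
  {S | Iso L S.dom M ∨ Iso L S.dom N}

/-- The class `{ω, ω*}` of linear orders. -/
def omegaPair : Set (NatStructure FirstOrder.Language.order) :=
  letI : FirstOrder.Language.order.Structure ℕ := FirstOrder.Language.orderStructure _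
  letI : FirstOrder.Language.order.Structure ℕᵒᵈ := FirstOrder.Language.orderStructure _
  pairClass FirstOrder.Language.order ℕ ℕᵒᵈ

/-- `M ≡₁ N`: the two structures satisfy the same `∃`-sentences (finitary). -/
def SameExistential (L : FirstOrder.Language.{u, v}) (M : Type w) (N : Type w') [L.Structure M]
    [L.Structure N] : Prop :=
  ∀ φ : L.Sentence, BoundedFormula.IsExistential φ → (M ⊨ φ ↔ N ⊨ φ)

/-- The `e`-th computably enumerable set. -/
def W (e : ℕ) : Set ℕ :=
  {n | ((Denumerable.ofNat Nat.Partrec.Code e).eval n).Dom}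

/-- Satisfaction of the computable `Π₁` formula in `m` free variables with index `e`: the
conjunction, over all `⟨k, θ⟩ ∈ W e` with `θ(x₁, …, x_m, y₁, …, y_k)` quantifier-free and finitary,
of `∀ y₁ … y_k, θ`. -/
def RealizePi1 (L : FirstOrder.Language.{u, v}) [ComputableLanguage L] (M : Type w) [L.Structure M] {m : ℕ}
    (e : ℕ) (x : Fin m → M) : Prop :=
  ∀ (k : ℕ) (θ : L.Formula (Fin (m + k))), BoundedFormula.IsQF θ →
    Nat.pair k (formulaCode Fin.val θ) ∈ W e → ∀ y : Fin k → M, θ.Realize (Fin.append x y)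

/-- Satisfaction of the computable `Σ₂` sentence with index `e`: the disjunction, over all
`⟨m, i⟩ ∈ W e`, of `∃ x₁ … x_m, ψ`, where `ψ` is the computable `Π₁` formula in
`m` free variables with index `i`. -/
def RealizeSigma2 (L : FirstOrder.Language.{u, v}) [ComputableLanguage L] (M : Type w) [L.Structure M]
    (e : ℕ) : Prop :=
  ∃ m i : ℕ, Nat.pair m i ∈ W e ∧ ∃ x : Fin m → M, RealizePi1 L M i x

/-- `Σᶜ₂-Th(M)`: the set of (indices of) computable `Σ₂` sentences that are true in `M`. -/
def sigma2Th (L : FirstOrder.Language.{u, v}) [ComputableLanguage L] (M : Type w) [L.Structure M] : Set ℕ :=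
  {e | RealizeSigma2 L M e}

end TC

/-!
The pair `{ω, ω*}` is characterised by being computable, having the same finite substructures on
both sides, and being separated by computable `Σ₂` sentences in both directions ("there is a least
element", "there is a greatest element"). Both implications transfer these features along Turing
operators.

Notation. `bdiag L c g` is the set of codes of the basic formulas true under the assignment `g`,
so that a copy of `M` given by `f : ℕ ≃ M` has the diagram `bdiag L id f`. The bits `bits L a` of
a tuple `a` are the first `a.length` values of the characteristic function of the diagram of any
enumeration starting with `a`; they depend on `a` only, because a formula mentions only variables
with numbers up to its code. `LocallyEmbeds L M N` says that every injective tuple of `M` is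
mirrored by one of `N` with the same bits.

*From (ii) to (i).* Suppose a sentence `e₀` holds in `A` and not in `B`, and `e₁` holds in `B` and
not in `A`. Given a copy `S`, guess at every stage that `S ≅ A` if some candidate witness for `e₀`
looks good so far and all earlier candidates for `e₁` do not. As the sentences are `Σ₂`, each wrong
candidate is refuted at some stage, so the guesses converge (`exists_computable_guess`). The
output structure is built along the guesses from two decidable target structures `P true` and
`P false`: while the guess is `b`, add elements of `P b` to the finite part built so far; when the
guess changes, replace that part by one of the other structure with the same bits, so that nothing
already announced is withdrawn (`tcReducible_of_guesses`). This is possible if the targets locally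
embed in each other. For `ω` and `ω*` this is plain (`locallyEmbeds_omega`), and for `A` and `B`
it follows from `A ≡₁ B`, since an existential sentence can describe the bits of a tuple
(`SameExistential.locallyEmbeds`). Both reductions arise in this way.

*From (i) to (ii).* Applying an operator to the decidable copies of `ω` and `ω*` yields computable
copies of `A` and `B`. If an existential sentence is true in `A`, this is due to finitely many
basic facts about the copy of `A` produced from, say, `ω`, and hence to a finite part of the
oracle; that part is also part of a copy of `ω*`, so the sentence is true in `B` as well
(`TuringOperator.MapsCopies.realize_of_isExistential`). Finally, suppose an operator `Φ` maps
copies of `M` to copies of `ω` and copies of `N` to copies of `ω*`. The sentence "there are a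
tuple `a` and an `x` such that `Φ`, given the bits of `a`, announces that `x` is in the output,
and given the bits of an extension of `a`, it never announces that `x ≰ y` for some `y`" is
computable `Σ₂`. It is true in `M`: otherwise, by extending tuples again and again, one finds an
enumeration of `M` for which the output has no least element. It is false in `N`: extend `a` to an
enumeration of `N`; as the output has no least element, `x ≰ y` is announced at some point
(`exists_mem_sigma2Th_diff`). To write this sentence down computably, one has to decide which
numbers are codes of basic formulas; a computable copy of `M` does that
(`ComputablyPresentable.exists_computable_isBasicCode`).
-/

/-! ### Codes of formulas and renaming of variables -/

namespace TC

open FirstOrder FirstOrder.Language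

theorem lt_encode_of_mem {l : List ℕ} {a : ℕ} (h : a ∈ l) : a < Encodable.encode l := by
  induction l with
  | nil => simp at h
  | cons b l ih =>
    rw [Encodable.encode_list_cons]
    rcases List.mem_cons.1 h with rfl | h
    · exact Nat.lt_succ_of_le (Nat.left_le_pair _ _)
    · exact ((ih h).trans_le (Nat.right_le_pair _ _)).trans (Nat.lt_succ_self _)

theorem le_encode_ofFn {k : ℕ} (f : Fin k → ℕ) (i : Fin k) :
    f i ≤ Encodable.encode (List.ofFn f) :=
  (lt_encode_of_mem (List.mem_ofFn.2 ⟨i, rfl⟩)).le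

/-- The code of the negation of the formula with code `n`. -/
def negCode (n : ℕ) : ℕ := Nat.pair 3 (Nat.pair n 0)

theorem negCode_injective : Function.Injective negCode := fun a b h => by
  simpa [negCode] using h

section

variable {L : FirstOrder.Language.{u, v}} {α β : Type} {n : ℕ}

/-- Renaming of the free variables along `p`, without touching the bound ones. Unlike
`BoundedFormula.relabel` it keeps the number of bound variables, hence also Gödel numbers. -/
def ren (p : α → β) (φ : L.BoundedFormula α n) : L.BoundedFormula β n :=
  φ.mapTermRel (fun _ t => t.relabel (Sum.map p id)) (fun _ => id) fun _ => id

theorem isAtomic_ren (p : α → β) {φ : L.BoundedFormula α n} (h : φ.IsAtomic) :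
    (ren p φ).IsAtomic := by
  cases h
  · exact .equal _ _
  · exact .rel _ _

theorem realize_ren {M : Type w} [L.Structure M] (p : α → β) (φ : L.Formula α) (g : β → M) :
    Formula.Realize (ren p φ) g ↔ φ.Realize (g ∘ p) := by
  refine BoundedFormula.realize_mapTermRel_id (fun n t xs => ?_) fun n R x => by rfl
  simp only [Term.realize_relabel]
  congr 1
  funext x; rcases x with a | i <;> rfl

end

section

variable {L : FirstOrder.Language.{u, v}} [ComputableLanguage L] {α β : Type} {n : ℕ}

theorem formulaCode_not (c : α → ℕ) (φ : L.BoundedFormula α n) :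
    formulaCode c φ.not = negCode (formulaCode c φ) := by
  simp [formulaCode, negCode, Nat.pair]

theorem termCode_injective {c : α → ℕ} (hc : Function.Injective c) :
    Function.Injective (termCode (L := L) c) := by
  intro t
  induction t with
  | var a =>
    intro s h
    cases s with
    | var b => simp only [termCode, Nat.pair_eq_pair, true_and] at h; rw [hc h]
    | func f ts => simp [termCode] at h
  | @func l f ts ih =>
    intro s h
    cases s with
    | var b => simp [termCode] at h
    | @func l' f' ts' =>
      simp only [termCode, Nat.pair_eq_pair, true_and] at h
      obtain ⟨hf, hl⟩ := h
      have := ComputableLanguage.funCode_injective hf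
      obtain ⟨rfl, hf⟩ := Sigma.mk.inj_iff.1 this
      obtain rfl := eq_of_heq hf
      have := List.ofFn_injective (Encodable.encode_injective hl)
      congr 1
      funext i
      exact ih i (congrFun this i)

theorem varCode_injective {c : α → ℕ} (hc : Function.Injective c) (n : ℕ) :
    Function.Injective (varCode c n) := by
  rintro (a | i) (b | j) h <;> simp only [varCode, Sum.elim_inl, Sum.elim_inr] at h
  · rw [hc (by omega : c a = c b)]
  · omega
  · omega
  · rw [Fin.ext (by omega : (i : ℕ) = j)]

theorem formulaCode_injective {c : α → ℕ} (hc : Function.Injective c) :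
    Function.Injective (formulaCode (L := L) (n := n) c) := by
  intro φ
  induction φ with
  | falsum => intro ψ h; cases ψ <;> simp_all [formulaCode]
  | @equal n t s =>
    intro ψ h
    cases ψ <;> simp only [formulaCode, Nat.pair_eq_pair, true_and] at h <;> try omega
    rw [termCode_injective (varCode_injective hc n) h.1,
      termCode_injective (varCode_injective hc n) h.2]
  | @rel n l R ts =>
    intro ψ h
    cases ψ <;> simp only [formulaCode, Nat.pair_eq_pair, true_and] at h <;> try omega
    rename_i l' R' ts'
    have := ComputableLanguage.relCode_injective h.1
    obtain ⟨rfl, hf⟩ := Sigma.mk.inj_iff.1 this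
    obtain rfl := eq_of_heq hf
    have := List.ofFn_injective (Encodable.encode_injective h.2)
    congr 1
    funext i
    exact termCode_injective (varCode_injective hc n) (congrFun this i)
  | imp φ₁ φ₂ ih₁ ih₂ =>
    intro ψ h
    cases ψ <;> simp only [formulaCode, Nat.pair_eq_pair, true_and] at h <;> try omega
    rw [ih₁ h.1, ih₂ h.2]
  | all φ ih =>
    intro ψ h
    cases ψ <;> simp only [formulaCode, Nat.pair_eq_pair, true_and] at h <;> try omega
    rw [ih h]

theorem termCode_relabel {γ : Type*} {δ : Type*} (p : γ → δ) (c : δ → ℕ) (t : L.Term γ) :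
    termCode c (t.relabel p) = termCode (c ∘ p) t := by
  induction t with
  | var a => rfl
  | func f ts ih => simp only [Term.relabel, termCode, ih]

theorem varCode_comp_map (p : α → β) (c : β → ℕ) (n : ℕ) :
    varCode c n ∘ Sum.map p id = varCode (c ∘ p) n := by
  funext x; rcases x with a | i <;> rfl

theorem formulaCode_ren (p : α → β) (c : β → ℕ) (φ : L.BoundedFormula α n) :
    formulaCode c (ren p φ) = formulaCode (c ∘ p) φ := by
  unfold ren
  induction φ with
  | falsum => rfl
  | equal t s => simp [BoundedFormula.mapTermRel, formulaCode, termCode_relabel, varCode_comp_map]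
  | rel R ts => simp [BoundedFormula.mapTermRel, formulaCode, termCode_relabel, varCode_comp_map]
  | imp φ₁ φ₂ ih₁ ih₂ => simp [BoundedFormula.mapTermRel, formulaCode, ih₁, ih₂]
  | all φ ih => simp [BoundedFormula.mapTermRel, formulaCode, ih]

theorem le_termCode {γ : Type*} (c : γ → ℕ) {l : ℕ} (f : L.Functions l) (ts : Fin l → L.Term γ)
    (i : Fin l) : termCode c (ts i) ≤ termCode c (Term.func f ts) := by
  rw [termCode]
  refine le_trans ?_ (Nat.right_le_pair _ _)
  refine le_trans ?_ (Nat.right_le_pair _ _)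
  exact le_encode_ofFn (fun i => termCode c (ts i)) i

theorem exists_term_relabel {p : α → β} {c : β → ℕ} (t : L.Term (β ⊕ Fin n))
    (h : ∀ b, c b ≤ termCode (varCode c n) t → b ∈ Set.range p) :
    ∃ t' : L.Term (α ⊕ Fin n), t'.relabel (Sum.map p id) = t := by
  induction t with
  | var x =>
    rcases x with b | i
    · obtain ⟨a, rfl⟩ := h b (by
        simp only [termCode, varCode, Sum.elim_inl]
        exact (by omega : c b ≤ 2 * c b).trans (Nat.right_le_pair _ _))
      exact ⟨.var (.inl a), rfl⟩
    · exact ⟨.var (.inr i), rfl⟩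
  | func f ts ih =>
    choose ts' hts using fun i => ih i fun b hb => h b (hb.trans (le_termCode _ f ts i))
    exact ⟨.func f ts', by simp [Term.relabel, hts]⟩

theorem exists_isAtomic_ren {p : α → β} {c : β → ℕ} {φ : L.BoundedFormula β n} (hφ : φ.IsAtomic)
    (h : ∀ b, c b ≤ formulaCode c φ → b ∈ Set.range p) :
    ∃ φ' : L.BoundedFormula α n, φ'.IsAtomic ∧ ren p φ' = φ := by
  cases hφ with
  | equal t s =>
    have e : formulaCode c (t.bdEqual s) =
      Nat.pair 1 (Nat.pair (termCode (varCode c n) t) (termCode (varCode c n) s)) := rfl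
    obtain ⟨t', rfl⟩ := exists_term_relabel t fun b hb => h b <| hb.trans <| by
      rw [e]; exact (Nat.left_le_pair _ _).trans (Nat.right_le_pair _ _)
    obtain ⟨s', rfl⟩ := exists_term_relabel s fun b hb => h b <| hb.trans <| by
      rw [e]; exact (Nat.right_le_pair _ _).trans (Nat.right_le_pair _ _)
    exact ⟨_, .equal t' s', rfl⟩
  | @rel l R ts =>
    have e : formulaCode c (R.boundedFormula ts) =
      Nat.pair 2 (Nat.pair (ComputableLanguage.relCode ⟨l, R⟩)
        (Encodable.encode (List.ofFn fun i => termCode (varCode c n) (ts i)))) := rfl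
    choose ts' hts using fun i =>
      exists_term_relabel (p := p) (ts i) fun b hb => h b <| hb.trans <| by
      rw [e]
      refine le_trans ?_ (Nat.right_le_pair _ _)
      refine le_trans ?_ (Nat.right_le_pair _ _)
      exact le_encode_ofFn (fun i => termCode (varCode c n) (ts i)) i
    refine ⟨_, .rel R ts', ?_⟩
    rw [← funext hts]
    rfl

end

/-! ### The basic type of a tuple -/

section

variable (L : FirstOrder.Language.{u, v}) [ComputableLanguage L] {α β : Type}
  {M : Type w} [L.Structure M] {N : Type w'} [L.Structure N]

/-- The set of codes of the basic formulas satisfied by the assignment `g`, the variables being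
coded by `c`. The atomic diagram of a structure `S` is `bdiag L Subtype.val id`. -/
def bdiag (c : α → ℕ) (g : α → M) : Set ℕ :=
  {n | ∃ φ : L.Formula α, IsBasic φ ∧ φ.Realize g ∧ formulaCode c φ = n}

variable {L}

theorem mem_bdiag_iff {c : α → ℕ} {g : α → M} {n : ℕ} : n ∈ bdiag L c g ↔
    ∃ ψ : L.Formula α, BoundedFormula.IsAtomic ψ ∧ ((ψ.Realize g ∧ formulaCode c ψ = n) ∨
      (¬ ψ.Realize g ∧ negCode (formulaCode c ψ) = n)) := by
  constructor
  · rintro ⟨φ, h | ⟨ψ, h, rfl⟩, hr, hn⟩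
    · exact ⟨φ, h, .inl ⟨hr, hn⟩⟩
    · exact ⟨ψ, h, .inr ⟨hr, by rw [← hn, formulaCode_not]⟩⟩
  · rintro ⟨ψ, h, ⟨hr, hn⟩ | ⟨hr, hn⟩⟩
    · exact ⟨ψ, .inl h, hr, hn⟩
    · exact ⟨ψ.not, .inr ⟨ψ, h, rfl⟩, hr, by rw [← hn, formulaCode_not]⟩

theorem mem_bdiag_of_comp {c : β → ℕ} {g : β → M} (p : α → β) {n : ℕ}
    (h : n ∈ bdiag L (c ∘ p) (g ∘ p)) : n ∈ bdiag L c g := by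
  rw [mem_bdiag_iff] at h ⊢
  obtain ⟨ψ, h, h'⟩ := h
  exact ⟨ren p ψ, isAtomic_ren p h, by rwa [formulaCode_ren, realize_ren]⟩

theorem le_negCode (n : ℕ) : n ≤ negCode n :=
  (Nat.left_le_pair _ _).trans (Nat.right_le_pair _ _)

/-- A formula mentions only variables whose codes are at most its own code. -/
theorem mem_bdiag_comp_iff {c : β → ℕ} {g : β → M} (p : α → β) {n : ℕ}
    (h : ∀ b, c b ≤ n → b ∈ Set.range p) :
    n ∈ bdiag L (c ∘ p) (g ∘ p) ↔ n ∈ bdiag L c g := by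
  refine ⟨mem_bdiag_of_comp p, fun hn => ?_⟩
  rw [mem_bdiag_iff] at hn ⊢
  obtain ⟨ψ, hψ, h'⟩ := hn
  have hle : formulaCode c ψ ≤ n := by
    rcases h' with ⟨-, rfl⟩ | ⟨-, rfl⟩
    · exact le_rfl
    · exact le_negCode _
  obtain ⟨φ, hφ, rfl⟩ := exists_isAtomic_ren (p := p) hψ fun b hb => h b (hb.trans hle)
  exact ⟨φ, hφ, by rwa [formulaCode_ren, realize_ren] at h'⟩

theorem bdiag_equiv (e : M ≃[L] N) (c : α → ℕ) (g : α → M) :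
    bdiag L c (e ∘ g) = bdiag L c g := by
  ext n
  simp only [bdiag, Set.mem_ofPred_eq, StrongHomClass.realize_formula e]

/-- Formulas with the same code are the same formula up to the names of their variables, so they
hold simultaneously under assignments that depend on the codes of the variables only. -/
theorem realize_comp_of_mem_bdiag {c : α → ℕ} {d : β → ℕ} (k : ℕ → M) {φ : L.Formula α}
    (hm : formulaCode c φ ∈ bdiag L d (k ∘ d)) : φ.Realize (k ∘ c) := by
  obtain ⟨ψ, -, hr, hc⟩ := hm
  have : ren c φ = ren d ψ := formulaCode_injective Function.injective_id <| by
    rw [formulaCode_ren, formulaCode_ren]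
    exact hc.symm
  rw [← realize_ren, this, realize_ren]
  exact hr

end

end TC

/-! ### Initial segments and finite approximations of a copy -/

namespace TC

open FirstOrder FirstOrder.Language

theorem length_initialSegment (X : Set ℕ) (n : ℕ) : (initialSegment X n).length = n := by
  simp [initialSegment]

theorem getElem?_initialSegment_eq_some {X : Set ℕ} {n i : ℕ} {b : Bool} :
    (initialSegment X n)[i]? = some b ↔ i < n ∧ (i ∈ X ↔ b = true) := by
  classical
  simp only [initialSegment, List.getElem?_map]
  by_cases h : i < n
  · cases b <;> simp [h]
  · simp [h]

theorem initialSegment_eq_iff {X Y : Set ℕ} {n : ℕ} :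
    initialSegment X n = initialSegment Y n ↔ ∀ i < n, (i ∈ X ↔ i ∈ Y) := by
  classical
  simp [initialSegment]

theorem take_initialSegment {X : Set ℕ} {m n : ℕ} (h : m ≤ n) :
    (initialSegment X n).take m = initialSegment X m := by
  simp [initialSegment, ← List.map_take, List.take_range, h]

theorem initialSegment_prefix {X : Set ℕ} {m n : ℕ} (h : m ≤ n) :
    initialSegment X m <+: initialSegment X n :=
  take_initialSegment (X := X) h ▸ List.take_prefix _ _

theorem exists_extends_mem {M : Type w} {a : List M} (ha : a ≠ []) :
    ∃ f : ℕ → M, (∀ i, f i ∈ a) ∧ ∀ i (hi : i < a.length), f i = a[i] := by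
  refine ⟨fun i => a[i]?.getD (a.head ha), fun i => ?_, fun i hi => by simp [hi]⟩
  rcases lt_or_ge i a.length with h | h <;> simp [h]

theorem exists_extends {M : Type w} {a : List M} (ha : a ≠ []) :
    ∃ f : ℕ → M, ∀ i (hi : i < a.length), f i = a[i] :=
  (exists_extends_mem ha).imp fun _ h => h.2

section

variable (L : FirstOrder.Language.{u, v}) [ComputableLanguage L]
  {M : Type w} [L.Structure M] {N : Type w'} [L.Structure N]

/-- The first `k` bits of the atomic diagram of any copy of `M` in which `0, …, k - 1` name the
entries of a list `a` of length `k`. They are determined by `a`, because a formula with code `n`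
mentions no variable beyond `n`. -/
noncomputable def bits (a : List M) : List Bool :=
  initialSegment (bdiag L (Fin.val : Fin a.length → ℕ) a.get) a.length

/-- Every injective tuple of `M` is mirrored by an injective tuple of `N` of the same length with
the same bits. -/
def LocallyEmbeds (M : Type w) [L.Structure M] (N : Type w') [L.Structure N] : Prop :=
  ∀ a : List M, a.Nodup → ∃ b : List N, b.Nodup ∧ bits L b = bits L a

variable {L}

theorem length_bits (a : List M) : (bits L a).length = a.length := length_initialSegment _ _

theorem mem_bdiag_fin_iff {k : ℕ} {a : Fin k → M} {f : ℕ → M} (h : ∀ i : Fin k, f i = a i)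
    {n : ℕ}
    (hn : n < k) : n ∈ bdiag L (Fin.val : Fin k → ℕ) a ↔ n ∈ bdiag L id f := by
  rw [← mem_bdiag_comp_iff (c := id) (g := f) (Fin.val : Fin k → ℕ)
    fun b hb => ⟨⟨b, lt_of_le_of_lt hb hn⟩, rfl⟩]
  have : f ∘ (Fin.val : Fin k → ℕ) = a := funext h
  rw [this]
  rfl

theorem bits_eq_initialSegment {a : List M} {f : ℕ → M}
    (h : ∀ i (hi : i < a.length), f i = a[i]) :
    bits L a = initialSegment (bdiag L id f) a.length :=
  initialSegment_eq_iff.2 fun _ => mem_bdiag_fin_iff fun i => h i i.2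

theorem bits_ofFn {k : ℕ} (a : Fin k → M) :
    bits L (List.ofFn a) = initialSegment (bdiag L Fin.val a) k := by
  rcases eq_or_ne (List.ofFn a) [] with h | h
  · obtain rfl : k = 0 := by simpa using h
    simp [bits, initialSegment]
  · obtain ⟨f, hf⟩ := exists_extends h
    rw [bits_eq_initialSegment hf, List.length_ofFn]
    exact initialSegment_eq_iff.2 fun n hn => (mem_bdiag_fin_iff (fun i => by
      rw [hf i (by simp), List.getElem_ofFn]) hn).symm

theorem bits_prefix {a b : List M} (h : a <+: b) : bits L a <+: bits L b := by
  rcases eq_or_ne b [] with rfl | hb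
  · rw [List.prefix_nil.1 h]
  · obtain ⟨f, hf⟩ := exists_extends hb
    rw [bits_eq_initialSegment hf, bits_eq_initialSegment (f := f) fun i hi => by
      rw [hf i (hi.trans_le h.length_le), h.getElem hi] ]
    exact initialSegment_prefix h.length_le

theorem bits_map (e : M ≃[L] N) (a : List M) : bits L (a.map e) = bits L a := by
  rcases eq_or_ne a [] with rfl | ha
  · rfl
  · obtain ⟨f, hf⟩ := exists_extends ha
    rw [bits_eq_initialSegment hf, bits_eq_initialSegment (f := e ∘ f) fun i hi => by
      simp [hf i (by simpa using hi)], bdiag_equiv, List.length_map]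

theorem LocallyEmbeds.congr {M' : Type u'} {N' : Type v'} [L.Structure M'] [L.Structure N']
    (h : LocallyEmbeds L M N) (e : M ≃[L] M') (e' : N ≃[L] N') : LocallyEmbeds L M' N' := by
  intro a ha
  obtain ⟨b, hb, h'⟩ := h (a.map e.symm) (ha.map e.symm.injective)
  exact ⟨b.map e', hb.map e'.injective, by rw [bits_map, h', bits_map]⟩

/-- An increasing sequence of lists without repetitions that exhausts `M` enumerates `M`. -/
theorem exists_equiv_of_chain {M : Type w} [Infinite M] (l : ℕ → List M)
    (hl : ∀ s, l s <+: l (s + 1)) (hn : ∀ s, (l s).Nodup) (hM : ∀ x, ∃ s, x ∈ l s) :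
    ∃ f : ℕ ≃ M, (∀ s i (hi : i < (l s).length), f i = (l s)[i]) ∧ ∀ n, ∃ s, n ≤ (l s).length := by
  classical
  have hmono : ∀ {s t}, s ≤ t → l s <+: l t := fun h => by
    induction h with
    | refl => exact List.prefix_rfl
    | step _ ih => exact ih.trans (hl _)
  have hlen : ∀ n, ∃ s, n ≤ (l s).length := by
    intro n
    choose s hs using hM
    obtain ⟨T, hT⟩ := Infinite.exists_subset_card_eq M n
    refine ⟨T.sup s, ?_⟩
    rw [← hT, ← List.toFinset_card_of_nodup (hn _)]
    refine Finset.card_le_card fun x hx => List.mem_toFinset.2 ?_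
    exact (hmono (Finset.le_sup hx)).subset (hs x)
  choose t ht using fun n => hlen (n + 1)
  have key : ∀ s i (hi : i < (l s).length), (l (t i))[i]'(ht i) = (l s)[i] := by
    intro s i hi
    rcases le_total s (t i) with h | h
    · exact ((hmono h).getElem hi).symm
    · exact (hmono h).getElem (ht i)
  refine ⟨Equiv.ofBijective (fun i => (l (t i))[i]'(ht i)) ⟨fun i j hij => ?_, fun x => ?_⟩,
    key, hlen⟩
  · have hi : i < (l (max (t i) (t j))).length :=
      lt_of_lt_of_le (ht i) (hmono (le_max_left _ _)).length_le
    have hj : j < (l (max (t i) (t j))).length :=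
      lt_of_lt_of_le (ht j) (hmono (le_max_right _ _)).length_le
    simp only [key _ _ hi, key _ _ hj] at hij
    exact (hn _).getElem_inj_iff.1 hij
  · obtain ⟨s, hs⟩ := hM x
    obtain ⟨i, hi, rfl⟩ := List.getElem_of_mem hs
    exact ⟨i, key s i hi⟩

/-- A generic enumeration of `M`: it starts with a given list and, at stage `s`, extends the list
built so far in the way prescribed by `ext s`. -/
theorem exists_equiv_of_steps {M : Type w} [Countable M] [Infinite M] (a : List M) (ha : a.Nodup)
    (ext : ℕ → List M → List M) (hext : ∀ s l, l.Nodup → l <+: ext s l ∧ (ext s l).Nodup) :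
    ∃ (f : ℕ ≃ M) (l : ℕ → List M), (∀ i (hi : i < a.length), f i = a[i]) ∧
      (∀ s i (hi : i < (l s).length), f i = (l s)[i]) ∧ (∀ s, l s <+: l (s + 1)) ∧
      (∀ s, ext s (l s) <+: l (s + 1)) ∧ (∀ s, (l s).Nodup) ∧ ∀ n, ∃ s, n ≤ (l s).length := by
  classical
  obtain ⟨e, he⟩ := exists_surjective_nat M
  let l : ℕ → List M := fun s => Nat.rec a (fun s l => if e s ∈ ext s l then ext s l
    else ext s l ++ [e s]) s
  have hs : ∀ s, l (s + 1) = if e s ∈ ext s (l s) then ext s (l s) else ext s (l s) ++ [e s] :=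
    fun s => rfl
  have hn : ∀ s, (l s).Nodup := fun s => by
    induction s with
    | zero => exact ha
    | succ s ih =>
      rw [hs]
      split_ifs with h
      · exact (hext s _ ih).2
      · exact List.nodup_append.2 ⟨(hext s _ ih).2, by simp, by
          intro x hx y hy; rw [List.mem_singleton.1 hy]; rintro rfl; exact h hx⟩
  have hp : ∀ s, ext s (l s) <+: l (s + 1) := fun s => by
    rw [hs]
    split_ifs
    · exact List.prefix_rfl
    · exact List.prefix_append _ _
  have hl : ∀ s, l s <+: l (s + 1) := fun s => (hext s _ (hn s)).1.trans (hp s)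
  obtain ⟨f, hf, hlen⟩ := exists_equiv_of_chain l hl hn fun x => by
    obtain ⟨s, rfl⟩ := he x
    refine ⟨s + 1, ?_⟩
    rw [hs]
    split_ifs with h
    · exact h
    · simp
  exact ⟨f, l, hf 0, hf, hl, hp, hn, hlen⟩

/-- Every list without repetitions is an initial segment of an enumeration of `M`. -/
theorem exists_equiv_extends {M : Type w} [Countable M] [Infinite M] (a : List M) (ha : a.Nodup) :
    ∃ f : ℕ ≃ M, ∀ i (hi : i < a.length), f i = a[i] := by
  obtain ⟨f, -, h, -⟩ := exists_equiv_of_steps a ha (fun _ l => l) fun _ l h => ⟨List.prefix_rfl, h⟩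
  exact ⟨f, h⟩

end

end TC

/-! ### Substitution of numbers for variables, on the level of codes -/

namespace TC

open FirstOrder FirstOrder.Language Encodable Denumerable

section

variable {σ : Type*}

/-- The first `n` values of the function defined by course-of-values recursion from `g`. -/
def courseOfValues (g : List σ → σ) : ℕ → List σ
  | 0 => []
  | n + 1 => courseOfValues g n ++ [g (courseOfValues g n)]

/-- The function defined by course-of-values recursion: its value at `n` is computed by `g` from the
list of its first `n` values. -/
def recVal (g : List σ → σ) (n : ℕ) : σ := g (courseOfValues g n)

theorem courseOfValues_eq (g : List σ → σ) (n : ℕ) :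
    courseOfValues g n = (List.range n).map (recVal g) := by
  induction n with
  | zero => rfl
  | succ n ih => rw [List.range_succ, List.map_append, ← ih]; rfl

theorem length_courseOfValues (g : List σ → σ) (n : ℕ) : (courseOfValues g n).length = n := by
  simp [courseOfValues_eq]

theorem getD_courseOfValues (g : List σ → σ) {n i : ℕ} (h : i < n) (d : σ) :
    (courseOfValues g n).getD i d = recVal g i := by
  simp [courseOfValues_eq, h]

theorem primrec_recVal {α : Type*} [Primcodable α] [Primcodable σ] {g : α → List σ → σ}
    (hg : Primrec₂ g) : Primrec₂ fun a n => recVal (g a) n :=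
  Primrec.nat_strong_rec _ (g := fun a l => some (g a l)) (Primrec.option_some.comp₂ hg)
    fun a n => by rw [← courseOfValues_eq]; rfl

end

theorem pair_ne_zero {t : ℕ} (ht : t ≠ 0) (r : ℕ) : Nat.pair t r ≠ 0 := fun h =>
  ht (Nat.le_zero.1 (h ▸ Nat.left_le_pair t r))

/-- The recursion step of `tsub`. -/
def tsubStep (l prev : List ℕ) : ℕ :=
  if prev.length.unpair.1 = 0 then
    if prev.length.unpair.2 % 2 = 0 then
      (l[prev.length.unpair.2 / 2]?.map fun w => Nat.pair 0 (2 * w)).getD (Nat.pair 2 0)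
    else Nat.pair 2 0
  else if prev.length.unpair.1 = 1 then
    Nat.pair 1 (Nat.pair prev.length.unpair.2.unpair.1
      (encode ((ofNat (List ℕ) prev.length.unpair.2.unpair.2).map fun i => prev.getD i 0)))
  else Nat.pair 2 0

/-- Substitution, in (the code of) a term, of the entries of `l` for the free variables numbered
`0, 1, …`. Whatever is not the code of a term with these variables only is sent to a number that
does not code a term. -/
def tsub (l : List ℕ) (n : ℕ) : ℕ := recVal (tsubStep l) n

theorem primrec_tsub : Primrec₂ tsub := by
  refine primrec_recVal ?_
  have hn : Primrec fun p : List ℕ × List ℕ => p.2.length := Primrec.list_length.comp Primrec.snd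
  have h1 := Primrec.fst.comp (Primrec.unpair.comp hn)
  have h2 := Primrec.snd.comp (Primrec.unpair.comp hn)
  refine Primrec.ite (Primrec.eq.comp h1 (.const 0)) (Primrec.ite
    (Primrec.eq.comp (Primrec.nat_mod.comp h2 (.const 2)) (.const 0)) ?_ (.const _))
    (Primrec.ite (Primrec.eq.comp h1 (.const 1)) ?_ (.const _))
  · refine Primrec.option_getD.comp (Primrec.option_map (Primrec.list_getElem?.comp .fst
      (Primrec.nat_div.comp h2 (.const 2))) ?_) (.const _)
    exact Primrec₂.natPair.comp (.const 0) (Primrec.nat_double.comp .snd)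
  · refine Primrec₂.natPair.comp (.const 1) (Primrec₂.natPair.comp
      (Primrec.fst.comp (Primrec.unpair.comp h2)) (Primrec.encode.comp (Primrec.list_map
      ((Primrec.ofNat (List ℕ)).comp (Primrec.snd.comp (Primrec.unpair.comp h2))) ?_)))
    exact (Primrec.list_getD 0).comp (Primrec.snd.comp .fst) .snd

theorem tsub_var (l : List ℕ) (r : ℕ) : tsub l (Nat.pair 0 r) =
    if r % 2 = 0 then (l[r / 2]?.map fun w => Nat.pair 0 (2 * w)).getD (Nat.pair 2 0)
    else Nat.pair 2 0 := by
  simp [tsub, recVal, tsubStep, length_courseOfValues]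

theorem tsub_func (l : List ℕ) (f : ℕ) (xs : List ℕ) :
    tsub l (Nat.pair 1 (Nat.pair f (encode xs))) =
    Nat.pair 1 (Nat.pair f (encode (xs.map (tsub l)))) := by
  simp only [tsub, recVal, tsubStep, length_courseOfValues, Nat.unpair_pair, one_ne_zero, if_false,
    if_true, ofNat_encode, Nat.pair_eq_pair, true_and]
  congr 1
  refine List.map_congr_left fun i hi => ?_
  rw [getD_courseOfValues _ (((lt_encode_of_mem hi).trans_le (Nat.right_le_pair _ _)).trans_le
    (Nat.right_le_pair _ _))]
  rfl

theorem tsub_of_two_le (l : List ℕ) {t : ℕ} (ht : 2 ≤ t) (r : ℕ) :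
    tsub l (Nat.pair t r) = Nat.pair 2 0 := by
  simp [tsub, recVal, tsubStep, length_courseOfValues, show t ≠ 0 by omega, show t ≠ 1 by omega]

theorem tsub_eq_pair_zero {l : List ℕ} {n m : ℕ} (h : tsub l n = Nat.pair 0 m) :
    ∃ i w, n = Nat.pair 0 (2 * i) ∧ l[i]? = some w ∧ m = 2 * w := by
  obtain ⟨t, r, rfl⟩ : ∃ t r, n = Nat.pair t r := ⟨_, _, (Nat.pair_unpair n).symm⟩
  rcases t with _ | _ | t
  · rw [tsub_var] at h
    split_ifs at h with h2
    · rcases hw : l[r / 2]? with _ | w <;> rw [hw] at h <;> simp at h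
      exact ⟨r / 2, w, by rw [Nat.mul_div_cancel' (Nat.dvd_of_mod_eq_zero h2)], hw, h.symm⟩
    · simp at h
  · obtain ⟨f, x, rfl⟩ : ∃ t x, r = Nat.pair t x := ⟨_, _, (Nat.pair_unpair r).symm⟩
    rw [← encode_ofNat (α := List ℕ) x, zero_add, tsub_func] at h
    simp at h
  · rw [tsub_of_two_le _ (by omega)] at h
    simp at h

theorem tsub_eq_pair_one {l : List ℕ} {n f : ℕ} {ys : List ℕ}
    (h : tsub l n = Nat.pair 1 (Nat.pair f (encode ys))) :
    ∃ xs : List ℕ, n = Nat.pair 1 (Nat.pair f (encode xs)) ∧ xs.map (tsub l) = ys := by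
  obtain ⟨t, r, rfl⟩ : ∃ t r, n = Nat.pair t r := ⟨_, _, (Nat.pair_unpair n).symm⟩
  rcases t with _ | _ | t
  · rw [tsub_var] at h
    split_ifs at h with h2
    · rcases hw : l[r / 2]? with _ | w <;> rw [hw] at h <;> simp at h
    · simp at h
  · obtain ⟨f', x, rfl⟩ : ∃ t x, r = Nat.pair t x := ⟨_, _, (Nat.pair_unpair r).symm⟩
    rw [← encode_ofNat (α := List ℕ) x, zero_add, tsub_func] at h
    simp only [Nat.pair_eq_pair, true_and] at h
    refine ⟨ofNat (List ℕ) x, by rw [encode_ofNat, h.1], encode_injective h.2⟩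
  · rw [tsub_of_two_le _ (by omega)] at h
    simp at h

/-- Substitution in (the code of) an atomic formula; what is not one is not sent to one. -/
def asub (l : List ℕ) (n : ℕ) : ℕ :=
  if n.unpair.1 = 1 then
    Nat.pair 1 (Nat.pair (tsub l n.unpair.2.unpair.1) (tsub l n.unpair.2.unpair.2))
  else if n.unpair.1 = 2 then
    Nat.pair 2 (Nat.pair n.unpair.2.unpair.1
      (encode ((ofNat (List ℕ) n.unpair.2.unpair.2).map (tsub l))))
  else 0

/-- Substitution in (the code of) a basic formula; what is not one is not sent to one. -/
def fsub (l : List ℕ) (n : ℕ) : ℕ :=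
  if n.unpair.1 = 3 then Nat.pair 3 (Nat.pair (asub l n.unpair.2.unpair.1) n.unpair.2.unpair.2)
  else asub l n

theorem primrec_asub : Primrec₂ asub := by
  have h1 : Primrec fun p : List ℕ × ℕ => p.2.unpair.1 :=
    Primrec.fst.comp (Primrec.unpair.comp .snd)
  have h2 : Primrec fun p : List ℕ × ℕ => p.2.unpair.2.unpair :=
    Primrec.unpair.comp (Primrec.snd.comp (Primrec.unpair.comp .snd))
  have h3 := Primrec.fst.comp h2
  have h4 := Primrec.snd.comp h2
  refine Primrec.ite (Primrec.eq.comp h1 (.const 1)) ?_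
    (Primrec.ite (Primrec.eq.comp h1 (.const 2)) ?_ (.const _))
  · exact Primrec₂.natPair.comp (.const 1) (Primrec₂.natPair.comp
      (primrec_tsub.comp .fst h3) (primrec_tsub.comp .fst h4))
  · refine Primrec₂.natPair.comp (.const 2) (Primrec₂.natPair.comp h3 (Primrec.encode.comp
      (Primrec.list_map ((Primrec.ofNat (List ℕ)).comp h4) ?_)))
    exact primrec_tsub.comp (Primrec.fst.comp .fst) .snd

theorem primrec_fsub : Primrec₂ fsub := by
  have h1 : Primrec fun p : List ℕ × ℕ => p.2.unpair.1 :=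
    Primrec.fst.comp (Primrec.unpair.comp .snd)
  have h2 : Primrec fun p : List ℕ × ℕ => p.2.unpair.2.unpair :=
    Primrec.unpair.comp (Primrec.snd.comp (Primrec.unpair.comp .snd))
  exact Primrec.ite (Primrec.eq.comp h1 (.const 3)) (Primrec₂.natPair.comp (.const 3)
    (Primrec₂.natPair.comp (primrec_asub.comp .fst (Primrec.fst.comp h2)) (Primrec.snd.comp h2)))
    primrec_asub

theorem asub_equal (l : List ℕ) (t s : ℕ) : asub l (Nat.pair 1 (Nat.pair t s)) =
    Nat.pair 1 (Nat.pair (tsub l t) (tsub l s)) := by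
  simp [asub]

theorem asub_rel (l : List ℕ) (R : ℕ) (xs : List ℕ) : asub l (Nat.pair 2 (Nat.pair R (encode xs))) =
    Nat.pair 2 (Nat.pair R (encode (xs.map (tsub l)))) := by
  simp [asub]

theorem fsub_negCode (l : List ℕ) (n : ℕ) : fsub l (negCode n) = negCode (asub l n) := by
  simp [fsub, negCode]

section

variable {L : FirstOrder.Language.{u, v}} [ComputableLanguage L] {γ : Type} {k : ℕ}
  {c : γ → ℕ} {a : Fin k → γ} {l : List ℕ}

theorem tsub_termCode (hl : l = List.ofFn fun i => c (a i)) (t : L.Term (Fin k ⊕ Fin 0)) :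
    tsub l (termCode (varCode Fin.val 0) t) =
      termCode (varCode c 0) (t.relabel (Sum.map a id)) := by
  induction t with
  | var x =>
    rcases x with i | i
    · simp [termCode, varCode, tsub_var, hl, Term.relabel]
    · exact i.elim0
  | func f ts ih =>
    simp only [termCode, tsub_func, Term.relabel, List.map_ofFn]
    simp only [Function.comp_def, ih]

theorem exists_of_tsub_eq (hc : Function.Injective c) (hl : l = List.ofFn fun i => c (a i))
    (t' : L.Term (γ ⊕ Fin 0)) {n : ℕ} (h : tsub l n = termCode (varCode c 0) t') :
    ∃ t : L.Term (Fin k ⊕ Fin 0), termCode (varCode Fin.val 0) t = n ∧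
      t.relabel (Sum.map a id) = t' := by
  induction t' generalizing n with
  | var x =>
    rcases x with b | i
    · obtain ⟨i, w, rfl, hi, hw⟩ := tsub_eq_pair_zero h
      simp only [varCode, Sum.elim_inl, mul_eq_mul_left_iff, OfNat.ofNat_ne_zero, or_false] at hw
      simp only [hl, List.getElem?_ofFn] at hi
      split_ifs at hi with hik
      refine ⟨.var (.inl ⟨i, hik⟩), rfl, ?_⟩
      simp only [Option.some.injEq] at hi
      rw [Term.relabel, Sum.map_inl, hc (hi.trans hw.symm)]
    · exact i.elim0
  | @func m f ts ih =>
    obtain ⟨xs, rfl, hxs⟩ := tsub_eq_pair_one h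
    obtain ⟨ys, rfl⟩ : ∃ ys : Fin m → ℕ, xs = List.ofFn ys := by
      have : xs.length = m := by simpa using congrArg List.length hxs
      subst this
      exact ⟨_, (List.ofFn_get xs).symm⟩
    rw [List.map_ofFn] at hxs
    have hxs := fun i => congrFun (List.ofFn_injective hxs) i
    choose ts' h1 h2 using fun i => ih i (hxs i)
    exact ⟨.func f ts', by simp [termCode, h1], by simp [Term.relabel, h2]⟩

theorem asub_formulaCode (hl : l = List.ofFn fun i => c (a i)) {ψ : L.Formula (Fin k)}
    (hψ : BoundedFormula.IsAtomic ψ) :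
    asub l (formulaCode Fin.val ψ) = formulaCode c (ren a ψ) := by
  cases hψ with
  | equal t s =>
    simp only [Term.bdEqual, formulaCode, asub_equal, tsub_termCode hl]
    rfl
  | rel R ts =>
    simp only [Relations.boundedFormula, formulaCode, asub_rel, List.map_ofFn]
    simp only [Function.comp_def, tsub_termCode hl]
    rfl

theorem exists_of_asub_eq (hc : Function.Injective c) (hl : l = List.ofFn fun i => c (a i))
    {ψ' : L.Formula γ} (hψ : BoundedFormula.IsAtomic ψ') {n : ℕ}
    (h : asub l n = formulaCode c ψ') : ∃ ψ : L.Formula (Fin k), BoundedFormula.IsAtomic ψ ∧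
      formulaCode Fin.val ψ = n ∧ ren a ψ = ψ' := by
  obtain ⟨t, r, rfl⟩ : ∃ t r, n = Nat.pair t r := ⟨_, _, (Nat.pair_unpair n).symm⟩
  cases hψ with
  | equal t' s' =>
    simp only [Term.bdEqual, formulaCode, asub, Nat.unpair_pair] at h
    split_ifs at h with h1 h2
    · subst h1
      simp only [Nat.pair_eq_pair, true_and] at h
      obtain ⟨t, ht, rfl⟩ := exists_of_tsub_eq hc hl _ h.1
      obtain ⟨s, hs, rfl⟩ := exists_of_tsub_eq hc hl _ h.2
      refine ⟨_, .equal t s, ?_, rfl⟩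
      simp [Term.bdEqual, formulaCode, ht, hs]
    · simp at h
    · exact absurd h.symm (pair_ne_zero (by omega) _)
  | @rel m R ts =>
    simp only [Relations.boundedFormula, formulaCode, asub, Nat.unpair_pair] at h
    split_ifs at h with h1 h2
    · simp at h
    · subst h2
      simp only [Nat.pair_eq_pair, true_and] at h
      have h2 := encode_injective h.2
      obtain ⟨ys, hys⟩ : ∃ ys : Fin m → ℕ, ofNat (List ℕ) r.unpair.2 = List.ofFn ys := by
        have : (ofNat (List ℕ) r.unpair.2).length = m := by simpa using congrArg List.length h2
        subst this
        exact ⟨_, (List.ofFn_get _).symm⟩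
      rw [hys, List.map_ofFn] at h2
      have hxs := fun i => congrFun (List.ofFn_injective h2) i
      choose ts' e1 e2 using fun i => exists_of_tsub_eq hc hl _ (hxs i)
      refine ⟨_, .rel R ts', ?_, ?_⟩
      · simp only [Relations.boundedFormula, formulaCode, e1, ← hys, ← h.1, encode_ofNat,
          Nat.pair_unpair]
      · rw [← funext e2]; rfl
    · exact absurd h.symm (pair_ne_zero (by omega) _)

theorem formulaCode_ne_negCode {α : Type} (c : α → ℕ) {ψ : L.Formula α}
    (hψ : BoundedFormula.IsAtomic ψ) (n : ℕ) : formulaCode c ψ ≠ negCode n := by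
  cases hψ <;> simp [Term.bdEqual, Relations.boundedFormula, formulaCode, negCode]

theorem fsub_formulaCode {α : Type} (c : α → ℕ) {ψ : L.Formula α}
    (hψ : BoundedFormula.IsAtomic ψ) : fsub l (formulaCode c ψ) = asub l (formulaCode c ψ) := by
  cases hψ <;> simp [Term.bdEqual, Relations.boundedFormula, formulaCode, fsub]

theorem fsub_mem_bdiag_iff {M : Type w} [L.Structure M] (hc : Function.Injective c)
    (hl : l = List.ofFn fun i => c (a i)) {g : γ → M} {n : ℕ} :
    fsub l n ∈ bdiag L c g ↔ n ∈ bdiag L Fin.val (g ∘ a) := by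
  rw [mem_bdiag_iff, mem_bdiag_iff]
  constructor
  · rintro ⟨ψ', hψ', h⟩
    rcases h with ⟨hr, h⟩ | ⟨hr, h⟩
    · have h' : asub l n = formulaCode c ψ' := by
        rw [h, fsub, if_neg]
        intro h3
        rw [fsub, if_pos h3] at h
        cases hψ' <;> simp [Term.bdEqual, Relations.boundedFormula, formulaCode] at h
      obtain ⟨ψ, hψ, h1, rfl⟩ := exists_of_asub_eq hc hl hψ' h'
      exact ⟨ψ, hψ, .inl ⟨(realize_ren _ _ _).1 hr, h1⟩⟩
    · rw [fsub] at h
      split_ifs at h with h3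
      · simp only [negCode, Nat.pair_eq_pair, true_and] at h
        obtain ⟨ψ, hψ, h1, rfl⟩ := exists_of_asub_eq hc hl hψ' h.1.symm
        refine ⟨ψ, hψ, .inr ⟨fun h => hr ((realize_ren _ _ _).2 h), ?_⟩⟩
        rw [h1, negCode, h.2, Nat.pair_unpair, ← h3, Nat.pair_unpair]
      · rw [asub] at h
        split_ifs at h <;> simp [negCode] at h
        exact absurd h (pair_ne_zero (by omega) _)
  · rintro ⟨ψ, hψ, h⟩
    refine ⟨ren a ψ, isAtomic_ren a hψ, ?_⟩
    rw [realize_ren]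
    rcases h with ⟨hr, rfl⟩ | ⟨hr, rfl⟩
    · exact .inl ⟨hr, by rw [fsub_formulaCode _ hψ, asub_formulaCode hl hψ]⟩
    · exact .inr ⟨hr, by rw [fsub_negCode, asub_formulaCode hl hψ]⟩

end

/-- Substitution computes the bits of a tuple of a structure from the diagram of the structure. -/
theorem fsub_mem_diagram_iff {L : FirstOrder.Language.{u, v}} [ComputableLanguage L]
    {S : NatStructure L} {k : ℕ} (a : Fin k → S.dom) {n : ℕ} :
    fsub (List.ofFn fun i => (a i : ℕ)) n ∈ S.diagram ↔ n ∈ bdiag L Fin.val a :=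
  fsub_mem_bdiag_iff (c := (Subtype.val : S.dom → ℕ)) (g := id) (a := a)
    Subtype.val_injective rfl

theorem bits_eq_map_fsub {L : FirstOrder.Language.{u, v}} [ComputableLanguage L]
    {S : NatStructure L} {d : ℕ → Bool} (hd : ∀ n, d n = true ↔ n ∈ S.diagram) (a : List S.dom) :
    bits L a = (List.range a.length).map fun n => d (fsub (a.map Subtype.val) n) := by
  have h : a.map Subtype.val = List.ofFn fun i => (a.get i : ℕ) := by
    conv_lhs => rw [← List.ofFn_get a, List.map_ofFn]
    rfl
  classical
  rw [bits, initialSegment, h]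
  refine List.map_congr_left fun n _ => ?_
  rw [Bool.eq_iff_iff, hd, decide_eq_true_iff, fsub_mem_diagram_iff]

end TC

/-! ### Copies with domain `ℕ` and truth-table operators -/

namespace TC

open FirstOrder FirstOrder.Language Encodable Denumerable

/-- The code of the formula stating that the variables `x` and `y` are equal. -/
def eqCode (x y : ℕ) : ℕ := Nat.pair 1 (Nat.pair (Nat.pair 0 (2 * x)) (Nat.pair 0 (2 * y)))

theorem primrec_eqCode : Primrec₂ eqCode :=
  Primrec₂.natPair.comp (.const 1) (Primrec₂.natPair.comp
    (Primrec₂.natPair.comp (.const 0) (Primrec.nat_double.comp .fst))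
    (Primrec₂.natPair.comp (.const 0) (Primrec.nat_double.comp .snd)))

section

variable {L : FirstOrder.Language.{u, v}}

/-- The copy of `M`, with domain `ℕ`, in which `n` names `f n`. -/
def copy {M : Type w} [L.Structure M] (f : ℕ ≃ M) : NatStructure L where
  dom := Set.univ
  str := (f.symm.trans (Equiv.Set.univ ℕ).symm).inducedStructure

/-- The naming of the elements of `M` is an isomorphism from the copy. -/
def copyEquiv {M : Type w} [L.Structure M] (f : ℕ ≃ M) : (copy (L := L) f).dom ≃[L] M :=
  letI : L.Structure (Set.univ : Set ℕ) :=
    (f.symm.trans (Equiv.Set.univ ℕ).symm).inducedStructure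
  (f.symm.trans (Equiv.Set.univ ℕ).symm).inducedStructureEquiv.symm

theorem copyEquiv_apply {M : Type w} [L.Structure M] (f : ℕ ≃ M) (x : (copy (L := L) f).dom) :
    copyEquiv f x = f x.1 := rfl

end

section

variable {L : FirstOrder.Language.{u, v}} [ComputableLanguage L]

theorem formulaCode_eq_var {α : Type} (c : α → ℕ) (x y : α) :
    formulaCode c ((Term.var (Sum.inl x)).bdEqual (Term.var (Sum.inl y)) : L.Formula α) =
      eqCode (c x) (c y) := rfl

theorem eqCode_mem_diagram_iff {S : NatStructure L} {x : ℕ} :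
    eqCode x x ∈ S.diagram ↔ x ∈ S.dom := by
  constructor
  · rintro ⟨φ, hφ, -, hc⟩
    by_contra hx
    -- A formula over `S.dom` with this code would be the equation `x = x` of the variable `x`.
    have h : ren Subtype.val φ = ((Term.var (Sum.inl x)).bdEqual (Term.var (Sum.inl x)) :
        L.Formula ℕ) := formulaCode_injective Function.injective_id <| by
      rw [formulaCode_ren, formulaCode_eq_var]
      exact hc
    rcases hφ with hφ | ⟨ψ, hψ, rfl⟩
    · cases hφ with
      | equal t s =>
        cases t with
        | var z =>
          rcases z with z | z
          · simp only [ren, Term.bdEqual, BoundedFormula.mapTermRel, Term.relabel,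
              BoundedFormula.equal.injEq, Term.var.injEq, Sum.map_inl, Sum.inl.injEq] at h
            exact hx (h.1 ▸ z.2)
          · exact z.elim0
        | func f ts => simp [ren, Term.bdEqual, BoundedFormula.mapTermRel, Term.relabel] at h
      | rel R ts =>
        simp [ren, Term.bdEqual, Relations.boundedFormula, BoundedFormula.mapTermRel] at h
    · cases h
  · exact fun hx => ⟨(Term.var (Sum.inl ⟨x, hx⟩)).bdEqual (Term.var (Sum.inl ⟨x, hx⟩)),
      .inl (.equal _ _), by simp [Formula.Realize, BoundedFormula.realize_bdEqual], rfl⟩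

theorem diagram_copy {M : Type w} [L.Structure M] (f : ℕ ≃ M) :
    (copy (L := L) f).diagram = bdiag L id f := by
  have h : (copy (L := L) f).diagram =
      bdiag L (id ∘ (Subtype.val : (copy (L := L) f).dom → ℕ)) (copyEquiv f ∘ id) :=
    (bdiag_equiv (copyEquiv (L := L) f) _ _).symm
  have h' : (copyEquiv (L := L) f ∘ id : _ → M) = f ∘ Subtype.val :=
    funext fun x => copyEquiv_apply f x
  rw [h, h']
  ext n
  exact mem_bdiag_comp_iff _ fun b _ => ⟨⟨b, trivial⟩, rfl⟩

end

theorem computable_list_map {α β σ : Type*} [Primcodable α] [Primcodable β] [Primcodable σ]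
    {f : α → List β} {g : α → β → σ} (hf : Computable f) (hg : Computable₂ g) :
    Computable fun a => (f a).map (g a) := by
  have h : Computable fun a => Nat.rec (motive := fun _ => List σ) []
      (fun n l => l ++ ((f a)[n]?.map (g a)).toList) (f a).length := by
    refine Computable.nat_rec (h := fun a p => p.2 ++ ((f a)[p.1]?.map (g a)).toList)
      (Computable.list_length.comp hf) (.const []) ?_
    refine Computable.list_append.comp (Computable.snd.comp .snd) (Primrec.optionToList.to_comp.comp
      (Computable.option_map (Computable.list_getElem?.comp (hf.comp .fst)
        (Computable.fst.comp .snd)) ?_))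
    exact hg.comp (Computable.fst.comp .fst) .snd
  refine h.of_eq fun a => ?_
  have key : ∀ n, Nat.rec (motive := fun _ => List σ) []
      (fun n l => l ++ ((f a)[n]?.map (g a)).toList) n = ((f a).take n).map (g a) := by
    intro n
    induction n with
    | zero => rfl
    | succ n ih =>
      simp only [ih]
      rw [List.take_add_one, List.map_append]
      cases (f a)[n]? <;> rfl
  rw [key, List.take_length]

/-- The operator that on input `x` applies a total computable function to `x` and the first `x + 1`
bits of the oracle. -/
def ttOperator (h : List Bool → ℕ → ℕ) (hh : Computable₂ h) : TuringOperator where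
  onString σ x := ((if x < σ.length then some (h (σ.take (x + 1)) x) else none : Option ℕ) : Part ℕ)
  partrec := by
    refine Computable.ofOption ?_
    have h1 : Computable fun p : List Bool × ℕ => decide (p.2 < p.1.length) :=
      (PrimrecPred.decide (p := fun p : List Bool × ℕ => p.2 < p.1.length)
        (Primrec.nat_lt.comp .snd (Primrec.list_length.comp .fst))).to_comp
    refine (Computable.cond h1 (Computable.option_some.comp (hh.comp
      (Primrec.list_take.to_comp.comp (Computable.succ.comp .snd) .fst) .snd))
      (.const none)).of_eq fun p => ?_
    by_cases hp : p.2 < p.1.length <;> simp [hp]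
  consistent σ τ x y z hστ hy hz := by
    simp only [Part.mem_coe, Option.mem_def] at hy hz
    split_ifs at hy hz with h1 h2
    obtain ⟨ρ, rfl⟩ := hστ
    simp only [Option.some.injEq] at hy hz
    rw [← hy, ← hz, List.take_append_of_le_length h1]

theorem ttOperator_computes (h : List Bool → ℕ → ℕ) (hh : Computable₂ h) (X : Set ℕ) (x : ℕ) :
    (ttOperator h hh).Computes X x (h (initialSegment X (x + 1)) x) := by
  refine ⟨x + 1, ?_⟩
  simp only [ttOperator, length_initialSegment, lt_add_iff_pos_right, zero_lt_one, if_true,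
    take_initialSegment le_rfl]
  exact Part.mem_some _

/-! ### Building a copy of one of two structures along a guess -/

section

variable {L : FirstOrder.Language.{u, v}} (P : Bool → NatStructure L)

/-- The list `l` consists of distinct elements of `P b`. -/
def IsTuple (b : Bool) (l : List ℕ) : Prop := l.Nodup ∧ ∀ x ∈ l, x ∈ (P b).dom

variable {P}

theorem IsTuple.exists_list {b : Bool} {l : List ℕ} (h : IsTuple P b l) :
    ∃ a : List (P b).dom, a.Nodup ∧ a.map Subtype.val = l :=
  ⟨l.attach.map fun x => ⟨x.1, h.2 _ x.2⟩,
    (List.nodup_attach.2 h.1).map fun x y hxy => by simpa [Subtype.ext_iff] using hxy, by simp⟩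

theorem isTuple_map {b : Bool} {a : List (P b).dom} (h : a.Nodup) :
    IsTuple P b (a.map Subtype.val) :=
  ⟨h.map Subtype.val_injective, fun x hx => by
    obtain ⟨y, -, rfl⟩ := List.mem_map.1 hx
    exact y.2⟩

end

theorem nodup_iff_map_idxOf (l : List ℕ) :
    l.Nodup ↔ (l.map fun x => l.idxOf x) = List.range l.length := by
  constructor
  · intro h
    refine List.ext_getElem (by simp) fun i h1 h2 => ?_
    simp only [List.getElem_map, List.getElem_range]
    exact h.idxOf_getElem i _
  · intro h
    exact List.Nodup.of_map _ (h ▸ List.nodup_range)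

section

variable {L : FirstOrder.Language.{u, v}} [ComputableLanguage L] {P : Bool → NatStructure L}
  (dec : Bool → ℕ → Bool)

/-- The bits of a tuple of `P b`, as computed from the decision procedure `dec b` for the diagram
of `P b`. -/
def natBits (b : Bool) (l : List ℕ) : List Bool :=
  (List.range l.length).map fun n => dec b (fsub l n)

/-- Decision procedure for `IsTuple`. -/
def isTupleB (b : Bool) (l : List ℕ) : Bool :=
  decide ((l.map fun x => l.idxOf x) = List.range l.length) &&
    decide ((l.map fun x => dec b (eqCode x x)) = l.map fun _ => true)

variable {dec}

theorem computable_natBits (hc : Computable₂ dec) : Computable₂ (natBits dec) :=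
  computable_list_map (f := fun p : Bool × List ℕ => List.range p.2.length)
    (g := fun p n => dec p.1 (fsub p.2 n))
    (Primrec.list_range.to_comp.comp (Computable.list_length.comp .snd))
    (hc.comp (Computable.fst.comp .fst) (primrec_fsub.to_comp.comp (Computable.snd.comp .fst) .snd))

theorem computable_isTupleB (hc : Computable₂ dec) : Computable₂ (isTupleB dec) := by
  have h1 : Primrec fun p : Bool × List ℕ => p.2.map fun x => p.2.idxOf x :=
    Primrec.list_map .snd (Primrec.list_idxOf.comp .snd (Primrec.snd.comp .fst))
  have h2 : Primrec fun p : Bool × List ℕ => p.2.map fun _ => true :=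
    Primrec.list_map .snd (.const true)
  have h3 : Computable fun p : Bool × List ℕ => p.2.map fun x => dec p.1 (eqCode x x) :=
    computable_list_map .snd (hc.comp (Computable.fst.comp .fst)
      (primrec_eqCode.to_comp.comp .snd .snd))
  exact Primrec.and.to_comp.comp
    ((Primrec.eq.decide.comp h1 (Primrec.list_range.comp (Primrec.list_length.comp .snd))).to_comp)
    (Primrec.eq.decide.to_comp.comp h3 h2.to_comp)

theorem isTupleB_iff (hd : ∀ b n, dec b n = true ↔ n ∈ (P b).diagram) {b : Bool} {l : List ℕ} :
    isTupleB dec b l = true ↔ IsTuple P b l := by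
  rw [isTupleB, Bool.and_eq_true, decide_eq_true_iff, decide_eq_true_iff, ← nodup_iff_map_idxOf,
    List.map_inj_left, IsTuple]
  simp only [hd, eqCode_mem_diagram_iff]

theorem natBits_map (hd : ∀ b n, dec b n = true ↔ n ∈ (P b).diagram) {b : Bool}
    (a : List (P b).dom) : natBits dec b (a.map Subtype.val) = bits L a := by
  rw [bits_eq_map_fsub (hd b), natBits, List.length_map]

/-- A tuple of `P b` can be moved computably to a tuple of `P m` with the same bits. -/
theorem exists_computable_move (hP : ∀ b b', LocallyEmbeds L (P b).dom (P b').dom)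
    (hc : Computable₂ dec) (hd : ∀ b n, dec b n = true ↔ n ∈ (P b).diagram) :
    ∃ move : Bool × Bool × List ℕ → List ℕ, Computable move ∧ ∀ m b l, IsTuple P b l →
      IsTuple P m (move (m, b, l)) ∧ natBits dec m (move (m, b, l)) = natBits dec b l := by
  -- Searching is total because inputs that are not tuples are accepted at once.
  have hm : ∀ q : Bool × Bool × List ℕ, ∃ n, (!isTupleB dec q.2.1 q.2.2 ||
      (isTupleB dec q.1 (ofNat (List ℕ) n) &&
        decide (natBits dec q.1 (ofNat (List ℕ) n) = natBits dec q.2.1 q.2.2))) = true := by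
    rintro ⟨m, b, l⟩
    by_cases h : isTupleB dec b l = true
    · obtain ⟨a, ha, rfl⟩ := ((isTupleB_iff hd).1 h).exists_list
      obtain ⟨a', ha', h'⟩ := hP b m a ha
      refine ⟨encode (a'.map Subtype.val), ?_⟩
      simp only [ofNat_encode, natBits_map hd, h', (isTupleB_iff hd).2 (isTuple_map ha')]
      simp
    · exact ⟨0, by simp [h]⟩
  refine ⟨fun q => ofNat (List ℕ) (Nat.find (hm q)),
    (Computable.ofNat _).comp (Computable.find (Computable.computablePred ?_) hm),
    fun m b l hl => ?_⟩
  · have c1 : Computable fun p : (Bool × Bool × List ℕ) × ℕ => p.1.2.1 :=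
      Computable.fst.comp (Computable.snd.comp .fst)
    have c2 : Computable fun p : (Bool × Bool × List ℕ) × ℕ => p.1.2.2 :=
      Computable.snd.comp (Computable.snd.comp .fst)
    have c3 : Computable fun p : (Bool × Bool × List ℕ) × ℕ => p.1.1 :=
      Computable.fst.comp .fst
    have c4 : Computable fun p : (Bool × Bool × List ℕ) × ℕ => ofNat (List ℕ) p.2 :=
      (Computable.ofNat _).comp .snd
    refine (Primrec.or.to_comp.comp (Primrec.not.to_comp.comp ((computable_isTupleB hc).comp c1 c2))
      (Primrec.and.to_comp.comp ((computable_isTupleB hc).comp c3 c4)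
        (Primrec.eq.decide.to_comp.comp ((computable_natBits hc).comp c3 c4)
          ((computable_natBits hc).comp c1 c2)))).of_eq fun p => ?_
    rw [Bool.decide_eq_true]
  · have h : ∀ l', (!isTupleB dec b l || (isTupleB dec m l' &&
        decide (natBits dec m l' = natBits dec b l))) = true →
        IsTuple P m l' ∧ natBits dec m l' = natBits dec b l := fun l' h => by
      simpa only [(isTupleB_iff hd).2 hl, Bool.not_true, Bool.false_or, Bool.and_eq_true,
        decide_eq_true_eq, isTupleB_iff hd] using h
    exact h _ (Nat.find_spec (hm (m, b, l)))

/-- The least element of `P b` outside a finite list is computable. -/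
theorem exists_computable_next [∀ b, Infinite (P b).dom] (hc : Computable₂ dec)
    (hd : ∀ b n, dec b n = true ↔ n ∈ (P b).diagram) :
    ∃ next : Bool → List ℕ → ℕ, Computable₂ next ∧ ∀ b l, next b l ∈ (P b).dom ∧
      next b l ∉ l ∧ ∀ x ∈ (P b).dom, x ∉ l → next b l ≤ x := by
  have hn : ∀ q : Bool × List ℕ, ∃ y, (dec q.1 (eqCode y y) && !decide (y ∈ q.2)) = true := by
    rintro ⟨b, l⟩
    obtain ⟨y, hy, hl⟩ :=
      (Set.infinite_coe_iff.1 (inferInstance : Infinite (P b).dom)).exists_notMem_finset l.toFinset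
    exact ⟨y, by simp [hd, eqCode_mem_diagram_iff, hy, List.mem_toFinset.not.1 hl]⟩
  refine ⟨fun b l => Nat.find (hn (b, l)),
    Computable.find (Computable.computablePred ?_) hn, fun b l => ?_⟩
  · have hmem : PrimrecPred fun p : List ℕ × ℕ => p.2 ∈ p.1 :=
      (PrimrecRel.exists_mem_list (R := fun x y : ℕ => x = y) Primrec.eq).of_eq (by simp)
    refine (Primrec.and.to_comp.comp (hc.comp (Computable.fst.comp .fst)
      (primrec_eqCode.to_comp.comp .snd .snd)) (Primrec.not.to_comp.comp
        (hmem.decide.to_comp.comp ((Computable.snd.comp .fst).pair .snd)))).of_eq fun p => ?_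
    rw [Bool.decide_eq_true]
  · have h := Nat.find_spec (hn (b, l))
    simp only [Bool.and_eq_true, hd, eqCode_mem_diagram_iff, Bool.not_eq_true',
      decide_eq_false_iff_not] at h
    exact ⟨h.1, h.2, fun x hx hl => Nat.find_min' (hn (b, l)) <| by
      simp [hd, eqCode_mem_diagram_iff, hx, hl]⟩

/-- Extending the tuple of a state `(b, l)` (a tuple `l` of `P b`) by one element, having first
moved it to `P m`, if necessary, without changing its bits. The new element is the least one
available, so that every element is used sooner or later. -/
theorem exists_computable_step [∀ b, Infinite (P b).dom]
    (hP : ∀ b b', LocallyEmbeds L (P b).dom (P b').dom)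
    (hc : Computable₂ dec) (hd : ∀ b n, dec b n = true ↔ n ∈ (P b).diagram) :
    ∃ step : Bool → Bool × List ℕ → List ℕ, Computable₂ step ∧
      ∀ m b l, IsTuple P b l → IsTuple P m (step m (b, l)) ∧
        natBits dec b l <+: natBits dec m (step m (b, l)) ∧
        ∃ l₀ y, step m (b, l) = l₀ ++ [y] ∧ l₀.length = l.length ∧ (m = b → l₀ = l) ∧
          ∀ x ∈ (P m).dom, x ∉ l₀ → y ≤ x := by
  obtain ⟨move, cmove, hmove⟩ := exists_computable_move hP hc hd
  obtain ⟨next, cnext, hnext⟩ := exists_computable_next hc hd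
  let base : Bool → Bool × List ℕ → List ℕ := fun m q => cond (decide (m = q.1)) q.2 (move (m, q))
  have cbase : Computable₂ base := Computable.cond
    (Primrec.eq.decide.to_comp.comp .fst (Computable.fst.comp .snd)) (Computable.snd.comp .snd)
    (cmove.comp (Computable.pair .fst .snd))
  refine ⟨fun m q => base m q ++ [next m (base m q)], Computable.list_concat.comp cbase
    (cnext.comp .fst cbase), fun m b l hl => ?_⟩
  have hbase : IsTuple P m (base m (b, l)) ∧ natBits dec m (base m (b, l)) = natBits dec b l ∧
      (m = b → base m (b, l) = l) := by
    by_cases hmb : m = b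
    · subst hmb
      simp [base, hl]
    · have e : base m (b, l) = move (m, b, l) := by simp [base, hmb]
      rw [e]
      exact ⟨(hmove m b l hl).1, (hmove m b l hl).2, fun h => absurd h hmb⟩
  beta_reduce
  generalize base m (b, l) = l₀ at hbase ⊢
  have ht : IsTuple P m (l₀ ++ [next m l₀]) := by
    refine ⟨List.nodup_append.2 ⟨hbase.1.1, by simp, ?_⟩, ?_⟩
    · intro x hx y hy
      rw [List.mem_singleton.1 hy]
      rintro rfl
      exact (hnext m l₀).2.1 hx
    · intro x hx
      rcases List.mem_append.1 hx with hx | hx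
      · exact hbase.1.2 x hx
      · rw [List.mem_singleton.1 hx]
        exact (hnext m l₀).1
  refine ⟨ht, ?_, _, _, rfl, ?_, hbase.2.2, (hnext m l₀).2.2⟩
  · obtain ⟨a, ha, h1⟩ := hbase.1.exists_list
    obtain ⟨a', ha', h2⟩ := ht.exists_list
    rw [← hbase.2.1, ← h2, ← h1, natBits_map hd, natBits_map hd]
    refine bits_prefix ?_
    rw [← List.prefix_map_iff_of_injective Subtype.val_injective, h1, h2]
    exact List.prefix_append _ _
  · simpa [natBits] using congrArg List.length hbase.2.1

end

end TC

namespace TC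

open FirstOrder FirstOrder.Language Encodable Denumerable

theorem Iso.symm {L : FirstOrder.Language.{u, v}} {M : Type w} {N : Type w'} [L.Structure M]
    [L.Structure N] (h : Iso L M N) : Iso L N M := h.map Language.Equiv.symm

theorem Iso.trans {L : FirstOrder.Language.{u, v}} {M : Type w} {N : Type w'} {K : Type u'}
    [L.Structure M] [L.Structure N] [L.Structure K] (h : Iso L M N) (h' : Iso L N K) : Iso L M K :=
  ⟨h'.some.comp h.some⟩

section

variable {L : FirstOrder.Language.{u, v}} [ComputableLanguage L] {P : Bool → NatStructure L}
  {dec : Bool → ℕ → Bool}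

/-- The states of the construction directed by the guesses `mode` at the prefixes of `σ`. -/
def stateAt (mode : List Bool → Bool) (step : Bool → Bool × List ℕ → List ℕ) (σ : List Bool)
    (s : ℕ) : Bool × List ℕ :=
  Nat.rec (true, []) (fun s p => (mode (σ.take s), step (mode (σ.take s)) p)) s

theorem computable_stateAt {mode : List Bool → Bool} (hmode : Computable mode)
    {step : Bool → Bool × List ℕ → List ℕ} (hstep : Computable₂ step) :
    Computable₂ (stateAt mode step) := by
  have h1 : Computable fun q : (List Bool × ℕ) × ℕ × Bool × List ℕ => mode (q.1.1.take q.2.1) :=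
    hmode.comp (Primrec.list_take.to_comp.comp (Computable.fst.comp .snd)
      (Computable.fst.comp .fst))
  exact Computable.nat_rec (f := fun p : List Bool × ℕ => p.2) (g := fun _ => (true, []))
    (h := fun p q => (mode (p.1.take q.1), step (mode (p.1.take q.1)) q.2)) .snd (.const _)
    (h1.pair (hstep.comp h1 (Computable.snd.comp .snd)))

/-- If the guesses settle on `m`, then the construction produces, by a truth-table operator, a copy
of `P m`: from then on the tuples grow into an enumeration of `P m`, and their bits never change. -/
theorem exists_copy_of_guesses {mode : List Bool → Bool} {step : Bool → Bool × List ℕ → List ℕ}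
    (hd : ∀ b n, dec b n = true ↔ n ∈ (P b).diagram) [∀ b, Infinite (P b).dom]
    (hstep : ∀ m b l, IsTuple P b l → IsTuple P m (step m (b, l)) ∧
        natBits dec b l <+: natBits dec m (step m (b, l)) ∧
        ∃ l₀ y, step m (b, l) = l₀ ++ [y] ∧ l₀.length = l.length ∧ (m = b → l₀ = l) ∧
          ∀ x ∈ (P m).dom, x ∉ l₀ → y ≤ x)
    {X : Set ℕ} {m : Bool} {s₀ : ℕ} (hX : ∀ s, s₀ ≤ s → mode (initialSegment X s) = m) :
    ∃ C : NatStructure L, Iso L C.dom (P m).dom ∧ ∀ x, x ∈ C.diagram ↔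
      (natBits dec (stateAt mode step (initialSegment X (x + 1)) (x + 1)).1
        (stateAt mode step (initialSegment X (x + 1)) (x + 1)).2)[x]? = some true := by
  -- The states, computed from the whole of `X`.
  let st : ℕ → Bool × List ℕ := fun s => Nat.rec (true, [])
    (fun s p => (mode (initialSegment X s), step (mode (initialSegment X s)) p)) s
  have hst : ∀ s, st (s + 1) =
      (mode (initialSegment X s), step (mode (initialSegment X s)) (st s)) := fun s => rfl
  have hst' : ∀ n s, s ≤ n → stateAt mode step (initialSegment X n) s = st s := by
    intro n s
    induction s with
    | zero => exact fun _ => rfl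
    | succ s ih =>
      intro h
      rw [hst, ← ih (by omega), ← take_initialSegment (X := X) (show s ≤ n by omega)]
      rfl
  have htup : ∀ s, IsTuple P (st s).1 (st s).2 ∧ (st s).2.length = s := by
    intro s
    induction s with
    | zero => exact ⟨⟨List.nodup_nil, by simp [st]⟩, rfl⟩
    | succ s ih =>
      obtain ⟨h1, -, l₀, y, h2, h3, -⟩ := hstep (mode (initialSegment X s)) _ _ ih.1
      rw [hst]
      refine ⟨h1, ?_⟩
      rw [show st s = ((st s).1, (st s).2) from rfl, h2, List.length_append, h3, ih.2]
      rfl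
  have hbits : ∀ s t, s ≤ t → natBits dec (st s).1 (st s).2 <+: natBits dec (st t).1 (st t).2 := by
    intro s t h
    induction h with
    | refl => exact List.prefix_rfl
    | step _ ih => exact ih.trans (hstep _ _ _ (htup _).1).2.1
  have hm : ∀ s, (st (s₀ + 1 + s)).1 = m := fun s => by
    rw [show s₀ + 1 + s = (s₀ + s) + 1 by omega, hst]
    exact hX _ (by omega)
  choose a hnd ha using fun s => IsTuple.exists_list (P := P) (b := m) (l := (st (s₀ + 1 + s)).2)
    (by have := (htup (s₀ + 1 + s)).1; rwa [hm] at this)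
  have hsucc : ∀ s, ∃ y, (st (s₀ + 1 + (s + 1))).2 = (st (s₀ + 1 + s)).2 ++ [y] ∧
      ∀ x ∈ (P m).dom, x ∉ (st (s₀ + 1 + s)).2 → y ≤ x := by
    intro s
    obtain ⟨-, -, l₀, y, h2, -, h4, h5⟩ := hstep m _ _ (htup (s₀ + 1 + s)).1
    obtain rfl := h4 (hm s).symm
    refine ⟨y, ?_, h5⟩
    rw [show s₀ + 1 + (s + 1) = (s₀ + 1 + s) + 1 by omega, hst, hX _ (by omega)]
    exact h2
  have hmem : ∀ x : (P m).dom, ∃ s, x ∈ a s := by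
    intro x
    by_contra hx
    push Not at hx
    have hx' : ∀ s, x.1 ∉ (st (s₀ + 1 + s)).2 := fun s h => by
      rw [← ha s] at h
      obtain ⟨z, hz, h⟩ := List.mem_map.1 h
      exact hx s (Subtype.ext h ▸ hz)
    -- All the elements added after stage `s₀ + 1` would be at most `x`, but they are distinct.
    choose y hy hyx using hsucc
    have hyle : ∀ s, y s ≤ x := fun s => hyx s x x.2 (hx' s)
    have hmemy : ∀ s t, s < t → y s ∈ (st (s₀ + 1 + t)).2 := by
      intro s t h
      induction h with
      | refl => rw [hy]; simp
      | step _ ih => rw [hy]; exact List.mem_append_left _ ih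
    have hne : ∀ s t, s < t → y s ≠ y t := by
      intro s t h e
      have h1 := (htup (s₀ + 1 + (t + 1))).1.1
      rw [hy, List.nodup_append] at h1
      exact h1.2.2 _ (hmemy s t h) _ (List.mem_singleton.2 rfl) e
    have hinj : Function.Injective y := fun s t e => by
      rcases lt_trichotomy s t with h | h | h
      · exact absurd e (hne s t h)
      · exact h
      · exact absurd e.symm (hne t s h)
    exact Set.infinite_range_of_injective hinj ((Set.finite_Iic (x : ℕ)).subset
      (Set.range_subset_iff.2 hyle))
  obtain ⟨f, hf, -⟩ := exists_equiv_of_chain a (fun s => by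
    obtain ⟨y, hy, -⟩ := hsucc s
    rw [← List.prefix_map_iff_of_injective Subtype.val_injective, ha, ha, hy]
    exact List.prefix_append _ _) hnd hmem
  refine ⟨copy f, ⟨copyEquiv f⟩, fun x => ?_⟩
  rw [diagram_copy, hst' _ _ le_rfl]
  -- At a stage after `s₀` and `x` the bits are those of the copy named by `f`.
  have hlen : (a x).length = s₀ + 1 + x := by
    rw [← (htup (s₀ + 1 + x)).2, ← ha x, List.length_map]
  have h1 : natBits dec (st (s₀ + 1 + x)).1 (st (s₀ + 1 + x)).2 =
      initialSegment (bdiag L id f) (s₀ + 1 + x) := by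
    rw [hm, ← ha x, natBits_map hd, bits_eq_initialSegment (hf x), hlen]
  have h2 := hbits (x + 1) (s₀ + 1 + x) (by omega)
  rw [h1] at h2
  have hx : x < (natBits dec (st (x + 1)).1 (st (x + 1)).2).length := by
    simp [natBits, (htup (x + 1)).2]
  have h3 := getElem?_initialSegment_eq_some (X := bdiag L id f) (n := s₀ + 1 + x) (i := x)
    (b := true)
  rw [List.prefix_iff_getElem?.1 h2 x hx, ← List.getElem?_eq_getElem hx] at h3
  rw [h3]
  simp

end

section

variable {L₀ : FirstOrder.Language.{u, v}} {L₁ : FirstOrder.Language.{u', v'}}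
  [ComputableLanguage L₀] [ComputableLanguage L₁] {A : Type w} {B : Type w'} [L₀.Structure A]
  [L₀.Structure B]

/-- If one can guess computably, with finitely many errors, which of `A` and `B` a structure is a
copy of, and `P true`, `P false` are decidable structures with the same finite substructures, then
`{A, B}` is reducible to `{P true, P false}`. -/
theorem tcReducible_of_guesses (hAB : ¬ Iso L₀ A B) {mode : List Bool → Bool}
    (hmode : Computable mode)
    (hA : ∀ S : NatStructure L₀, Iso L₀ S.dom A →
      ∃ s₀, ∀ s, s₀ ≤ s → mode (initialSegment S.diagram s) = true)
    (hB : ∀ S : NatStructure L₀, Iso L₀ S.dom B →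
      ∃ s₀, ∀ s, s₀ ≤ s → mode (initialSegment S.diagram s) = false)
    {P : Bool → NatStructure L₁} [∀ b, Infinite (P b).dom]
    (hPC : ∀ b, ComputablePred fun n => n ∈ (P b).diagram)
    (hP : ∀ b b', LocallyEmbeds L₁ (P b).dom (P b').dom)
    (hPI : ¬ Iso L₁ (P true).dom (P false).dom) :
    TCReducible (pairClass L₀ A B) (pairClass L₁ (P true).dom (P false).dom) := by
  classical
  let dec : Bool → ℕ → Bool := fun b n =>
    cond b (decide (n ∈ (P true).diagram)) (decide (n ∈ (P false).diagram))
  have hd : ∀ b n, dec b n = true ↔ n ∈ (P b).diagram := by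
    rintro (_ | _) n <;> simp [dec]
  have hc : Computable₂ dec := Computable.cond .fst ((hPC true).decide.comp .snd)
    ((hPC false).decide.comp .snd)
  obtain ⟨step, cstep, hstep⟩ := exists_computable_step hP hc hd
  let h : List Bool → ℕ → ℕ := fun σ x =>
    cond (decide ((natBits dec (stateAt mode step σ (x + 1)).1
      (stateAt mode step σ (x + 1)).2)[x]? = some true)) 1 0
  have hh : Computable₂ h := by
    have hs : Computable fun p : List Bool × ℕ => stateAt mode step p.1 (p.2 + 1) :=
      (computable_stateAt hmode cstep).comp .fst (Computable.succ.comp .snd)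
    exact Computable.cond (Primrec.eq.decide.to_comp.comp (Computable.list_getElem?.comp
      ((computable_natBits hc).comp (Computable.fst.comp hs) (Computable.snd.comp hs)) .snd)
      (.const _)) (.const 1) (.const 0)
  have main : ∀ (S : NatStructure L₀) (m : Bool),
      (∃ s₀, ∀ s, s₀ ≤ s → mode (initialSegment S.diagram s) = m) →
      ∃ C : NatStructure L₁, Iso L₁ C.dom (P m).dom ∧
        (ttOperator h hh).Maps S.diagram C.diagram := by
    rintro S m ⟨s₀, hs⟩
    obtain ⟨C, hC, hC'⟩ := exists_copy_of_guesses hd hstep hs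
    refine ⟨C, hC, fun x => ?_⟩
    have hx : h (initialSegment S.diagram (x + 1)) x = if x ∈ C.diagram then 1 else 0 := by
      simp only [h, ← hC', Bool.cond_decide]
    rw [← hx]
    exact ttOperator_computes h hh S.diagram x
  have hF : ∀ S : NatStructure L₀, ∃ C : NatStructure L₁, S ∈ pairClass L₀ A B →
      (ttOperator h hh).Maps S.diagram C.diagram ∧
      (Iso L₀ S.dom A → Iso L₁ C.dom (P true).dom) ∧
      (Iso L₀ S.dom B → Iso L₁ C.dom (P false).dom) := by
    intro S
    by_cases hSA : Iso L₀ S.dom A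
    · obtain ⟨C, h1, h2⟩ := main S true (hA S hSA)
      exact ⟨C, fun _ => ⟨h2, fun _ => h1, fun hSB => absurd (hSA.symm.trans hSB) hAB⟩⟩
    · by_cases hSB : Iso L₀ S.dom B
      · obtain ⟨C, h1, h2⟩ := main S false (hB S hSB)
        exact ⟨C, fun _ => ⟨h2, fun h => absurd h hSA, fun _ => h1⟩⟩
      · exact ⟨P true, fun hS => (hS.elim hSA hSB).elim⟩
  choose F hF using hF
  refine ⟨ttOperator h hh, F, fun S hS => ⟨hS.imp (hF S hS).2.1 (hF S hS).2.2, (hF S hS).1⟩, ?_⟩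
  intro S hS T hT
  obtain ⟨-, SA, SB⟩ := hF S hS
  obtain ⟨-, TA, TB⟩ := hF T hT
  rcases hS with hS | hS <;> rcases hT with hT | hT
  · exact iff_of_true (hS.trans hT.symm) ((SA hS).trans (TA hT).symm)
  · exact iff_of_false (fun h => hAB (hS.symm.trans (h.trans hT)))
      fun h => hPI ((SA hS).symm.trans (h.trans (TB hT)))
  · exact iff_of_false (fun h => hAB (hT.symm.trans (h.symm.trans hS)))
      fun h => hPI ((TA hT).symm.trans (h.symm.trans (SB hS)))
  · exact iff_of_true (hS.trans hT.symm) ((SB hS).trans (TB hT).symm)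

end

end TC

/-! ### Guessing between two structures separated by computable `Σ₂` sentences -/

namespace TC

open FirstOrder FirstOrder.Language Encodable Denumerable

theorem primrecPred_mem {α β : Type*} [Primcodable α] [Primcodable β] {f : α → β} {g : α → List β}
    (hf : Primrec f) (hg : Primrec g) : PrimrecPred fun a => f a ∈ g a := by
  classical
  exact ((PrimrecRel.exists_mem_list (R := fun x y : β => x = y) Primrec.eq).comp hg hf).of_eq
    (by simp)

/-- The recursion step of `evalQF`. -/
def evalStep (q : List ℕ × List ℕ) (prev : List (Option Bool)) : Option Bool :=
  if prev.length.unpair.1 = 0 then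
    if prev.length.unpair.2 = 0 then some false else none
  else if prev.length.unpair.1 = 3 then
    (prev.getD prev.length.unpair.2.unpair.1 none).bind fun x =>
      (prev.getD prev.length.unpair.2.unpair.2 none).map fun y => !x || y
  else if prev.length.unpair.1 ≤ 2 then
    if asub q.2 prev.length ∈ q.1 then some true
    else if negCode (asub q.2 prev.length) ∈ q.1 then some false else none
  else none

/-- The truth value of the quantifier-free formula with code `n` under the assignment of the entries
of `l` to its variables, as far as it follows from the truth of the basic sentences with codes in
`p`. -/
def evalQF (p l : List ℕ) (n : ℕ) : Option Bool := recVal (evalStep (p, l)) n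

theorem primrec_negCode : Primrec negCode :=
  Primrec₂.natPair.comp (.const 3) (Primrec₂.natPair.comp .id (.const 0))

theorem primrec_evalQF : Primrec₂ fun (q : List ℕ × List ℕ) n => evalQF q.1 q.2 n := by
  refine primrec_recVal (g := evalStep) ?_
  have hn : Primrec fun p : (List ℕ × List ℕ) × List (Option Bool) => p.2.length :=
    Primrec.list_length.comp .snd
  have h1 := Primrec.fst.comp (Primrec.unpair.comp hn)
  have h2 := Primrec.snd.comp (Primrec.unpair.comp hn)
  have ha : Primrec fun p : (List ℕ × List ℕ) × List (Option Bool) => asub p.1.2 p.2.length :=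
    primrec_asub.comp (Primrec.snd.comp .fst) hn
  refine Primrec.ite (Primrec.eq.comp h1 (.const 0)) (Primrec.ite (Primrec.eq.comp h2 (.const 0))
    (.const _) (.const _)) (Primrec.ite (Primrec.eq.comp h1 (.const 3)) ?_
    (Primrec.ite (Primrec.nat_le.comp h1 (.const 2))
    (Primrec.ite (primrecPred_mem ha (Primrec.fst.comp .fst)) (.const _)
    (Primrec.ite (primrecPred_mem (primrec_negCode.comp ha) (Primrec.fst.comp .fst)) (.const _)
    (.const _))) (.const _)))
  refine Primrec.option_bind ((Primrec.list_getD none).comp .snd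
    (Primrec.fst.comp (Primrec.unpair.comp h2))) (Primrec.option_map
    ((Primrec.list_getD none).comp (Primrec.snd.comp .fst)
      (Primrec.snd.comp (Primrec.unpair.comp (h2.comp .fst)))) ?_)
  exact Primrec.or.comp (Primrec.not.comp (Primrec.snd.comp .fst)) .snd

theorem evalQF_zero (p l : List ℕ) : evalQF p l 0 = some false := by
  simp [evalQF, recVal, evalStep, length_courseOfValues]

theorem evalQF_imp (p l : List ℕ) (a b : ℕ) : evalQF p l (Nat.pair 3 (Nat.pair a b)) =
    (evalQF p l a).bind fun x => (evalQF p l b).map fun y => !x || y := by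
  have ha : a < Nat.pair 3 (Nat.pair a b) :=
    (Nat.left_le_pair a b).trans_lt (lt_of_lt_of_le (by omega) (Nat.add_le_pair 3 _))
  have hb : b < Nat.pair 3 (Nat.pair a b) :=
    (Nat.right_le_pair a b).trans_lt (lt_of_lt_of_le (by omega) (Nat.add_le_pair 3 _))
  rw [evalQF, recVal, evalStep]
  simp only [length_courseOfValues, Nat.unpair_pair, getD_courseOfValues _ ha,
    getD_courseOfValues _ hb]
  rfl

theorem evalQF_atomic (p l : List ℕ) {t : ℕ} (ht : t = 1 ∨ t = 2) (r : ℕ) :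
    evalQF p l (Nat.pair t r) = if asub l (Nat.pair t r) ∈ p then some true
      else if negCode (asub l (Nat.pair t r)) ∈ p then some false else none := by
  rw [evalQF, recVal, evalStep]
  rcases ht with rfl | rfl <;> simp [length_courseOfValues]

theorem asub_ne_negCode (l : List ℕ) (n m : ℕ) : asub l n ≠ negCode m := by
  rw [asub]
  split_ifs
  · simp [negCode]
  · simp [negCode]
  · exact (pair_ne_zero (by omega) _).symm

section

variable {L : FirstOrder.Language.{u, v}} [ComputableLanguage L]

theorem exists_formulaCode_eq_pair {α : Type} (c : α → ℕ) {ψ : L.Formula α}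
    (hψ : BoundedFormula.IsAtomic ψ) : ∃ t r, (t = 1 ∨ t = 2) ∧ formulaCode c ψ = Nat.pair t r := by
  cases hψ
  · exact ⟨1, _, .inl rfl, rfl⟩
  · exact ⟨2, _, .inr rfl, rfl⟩

variable {S : NatStructure L} {k : ℕ} {a : Fin k → S.dom} {l : List ℕ}

theorem exists_of_evalQF_eq (hl : l = List.ofFn fun i => (a i : ℕ)) {p : List ℕ}
    (hp : ∀ c ∈ p, c ∈ S.diagram) {n : ℕ} {b : Bool} (h : evalQF p l n = some b) :
    ∃ θ : L.Formula (Fin k), BoundedFormula.IsQF θ ∧ formulaCode Fin.val θ = n ∧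
      (θ.Realize a ↔ b = true) := by
  induction n using Nat.strong_induction_on generalizing b with
  | _ n ih =>
  obtain ⟨t, r, rfl⟩ : ∃ t r, n = Nat.pair t r := ⟨_, _, (Nat.pair_unpair n).symm⟩
  by_cases h0 : t = 0
  · subst h0
    by_cases hr : r = 0
    · subst hr
      rw [show Nat.pair 0 0 = 0 from rfl, evalQF_zero] at h
      exact ⟨.falsum, .falsum, rfl, by
        rw [← Option.some.inj h]; exact iff_of_false id (by simp)⟩
    · simp [evalQF, recVal, evalStep, length_courseOfValues, hr] at h
  by_cases h3 : t = 3
  · subst h3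
    obtain ⟨x, y, rfl⟩ : ∃ x y, r = Nat.pair x y := ⟨_, _, (Nat.pair_unpair r).symm⟩
    rw [evalQF_imp, Option.bind_eq_some_iff] at h
    obtain ⟨b₁, h₁, h⟩ := h
    rw [Option.map_eq_some_iff] at h
    obtain ⟨b₂, h₂, rfl⟩ := h
    have hx : x < Nat.pair 3 (Nat.pair x y) :=
      (Nat.left_le_pair x y).trans_lt (lt_of_lt_of_le (by omega) (Nat.add_le_pair 3 _))
    have hy : y < Nat.pair 3 (Nat.pair x y) :=
      (Nat.right_le_pair x y).trans_lt (lt_of_lt_of_le (by omega) (Nat.add_le_pair 3 _))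
    obtain ⟨θ₁, q₁, c₁, r₁⟩ := ih x hx h₁
    obtain ⟨θ₂, q₂, c₂, r₂⟩ := ih y hy h₂
    refine ⟨θ₁.imp θ₂, q₁.imp q₂, by rw [formulaCode, c₁, c₂], ?_⟩
    rw [Formula.realize_imp, r₁, r₂]
    cases b₁ <;> cases b₂ <;> simp
  by_cases h12 : t = 1 ∨ t = 2
  · rw [evalQF_atomic _ _ h12] at h
    split_ifs at h with h1 h2
    · obtain ⟨ψ', hψ', ⟨hr, hc⟩ | ⟨-, hc⟩⟩ := mem_bdiag_iff.1 (hp _ h1)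
      · obtain ⟨ψ, hψ, hc', rfl⟩ := exists_of_asub_eq Subtype.val_injective hl hψ' hc.symm
        exact ⟨ψ, hψ.isQF, hc', iff_of_true ((realize_ren a ψ id).1 hr) (Option.some.inj h).symm⟩
      · exact absurd hc.symm (asub_ne_negCode _ _ _)
    · obtain ⟨ψ', hψ', ⟨-, hc⟩ | ⟨hr, hc⟩⟩ := mem_bdiag_iff.1 (hp _ h2)
      · exact absurd hc (formulaCode_ne_negCode _ hψ' _)
      · obtain ⟨ψ, hψ, hc', rfl⟩ := exists_of_asub_eq Subtype.val_injective hl hψ'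
          (negCode_injective hc).symm
        exact ⟨ψ, hψ.isQF, hc', iff_of_false (fun h => hr ((realize_ren a ψ id).2 h))
          (by rw [← Option.some.inj h]; simp)⟩
  · simp [evalQF, recVal, evalStep, length_courseOfValues, h0, h3, show ¬ t ≤ 2 by omega] at h

open Classical in
theorem exists_evalQF_eq (hl : l = List.ofFn fun i => (a i : ℕ)) {θ : L.Formula (Fin k)}
    (hθ : BoundedFormula.IsQF θ) : ∃ p₀ : List ℕ, (∀ c ∈ p₀, c ∈ S.diagram) ∧
      ∀ p, p₀ ⊆ p → (∀ c ∈ p, c ∈ S.diagram) →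
        evalQF p l (formulaCode Fin.val θ) = some (decide (θ.Realize a)) := by
  induction hθ with
  | falsum =>
    refine ⟨[], by simp, fun p _ _ => ?_⟩
    rw [formulaCode, show Nat.pair 0 0 = 0 from rfl, evalQF_zero]
    exact congrArg some (decide_eq_false (show ¬ Formula.Realize .falsum a from id)).symm
  | @of_isAtomic ψ h =>
    have hmem : asub l (formulaCode Fin.val ψ) ∈ S.diagram ↔ Formula.Realize ψ a := by
      rw [← fsub_formulaCode _ h, hl, fsub_mem_diagram_iff]
      refine ⟨?_, fun hr => ⟨ψ, .inl h, hr, rfl⟩⟩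
      rintro ⟨φ, -, hr, hc⟩
      exact formulaCode_injective Fin.val_injective hc ▸ hr
    obtain ⟨t, r, ht, hc⟩ := exists_formulaCode_eq_pair Fin.val h
    by_cases hr : Formula.Realize ψ a
    · refine ⟨[asub l (formulaCode Fin.val ψ)], by simpa using hmem.2 hr, fun p hp _ => ?_⟩
      have := hp (List.mem_singleton.2 rfl)
      rw [hc] at this
      rw [hc, evalQF_atomic _ _ ht, if_pos this, decide_eq_true hr]
    · refine ⟨[negCode (asub l (formulaCode Fin.val ψ))], ?_, fun p hp hpS => ?_⟩
      · simp only [List.mem_singleton, forall_eq]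
        refine mem_bdiag_iff.2 ⟨ren a ψ, isAtomic_ren a h, .inr ⟨?_, ?_⟩⟩
        · rwa [realize_ren]
        · rw [asub_formulaCode hl h]
      · have h1 := hp (List.mem_singleton.2 rfl)
        have h2 : asub l (formulaCode Fin.val ψ) ∉ p := fun h => hr (hmem.1 (hpS _ h))
        rw [hc] at h1 h2
        rw [hc, evalQF_atomic _ _ ht, if_neg h2, if_pos h1, decide_eq_false hr]
  | @imp φ₁ φ₂ _ _ ih₁ ih₂ =>
    obtain ⟨p₁, h₁, e₁⟩ := ih₁
    obtain ⟨p₂, h₂, e₂⟩ := ih₂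
    refine ⟨p₁ ++ p₂, fun c hc => (List.mem_append.1 hc).elim (h₁ c) (h₂ c), fun p hp hpS => ?_⟩
    have i₁ := e₁ p (fun c hc => hp (List.mem_append_left _ hc)) hpS
    have i₂ := e₂ p (fun c hc => hp (List.mem_append_right _ hc)) hpS
    rw [formulaCode, evalQF_imp, i₁, i₂]
    simp only [Option.bind_some, Option.map_some, Option.some.injEq]
    by_cases h : Formula.Realize φ₁ a <;> by_cases h' : Formula.Realize φ₂ a <;>
      simp [h, h', Formula.realize_imp]

end

theorem mem_W_iff {e n : ℕ} :
    n ∈ W e ↔ ∃ t, (Nat.Partrec.Code.evaln t (ofNat Nat.Partrec.Code e) n).isSome = true := by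
  change (Nat.Partrec.Code.eval _ n).Dom ↔ _
  simp only [Part.dom_iff_mem, Nat.Partrec.Code.evaln_complete, Option.isSome_iff_exists,
    Option.mem_def]
  exact exists_comm

/-- The certificate `(k, n, t, y, p)` refutes the `Π₁` formula with index `i` at `x`: at step `t`,
its conjunct `∀ y₁ … y_k, θ` with `θ` coded by `n` is known, and the sentences in `p` imply that `θ`
fails at `(x, y)`. -/
def Refutes (i : ℕ) (x : List ℕ) (c : ℕ × ℕ × ℕ × List ℕ × List ℕ) : Prop :=
  (Nat.Partrec.Code.evaln c.2.2.1 (ofNat Nat.Partrec.Code i) (Nat.pair c.1 c.2.1)).isSome = true ∧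
    c.2.2.2.1.length = c.1 ∧ (∀ z ∈ c.2.2.2.1, eqCode z z ∈ c.2.2.2.2) ∧
    evalQF c.2.2.2.2 (x ++ c.2.2.2.1) c.2.1 = some false

/-- The information `σ` on the diagram refutes that `j = (m, i, t, x)` witnesses the truth of the
`Σ₂` sentence with index `e`: at step `t` its disjunct `(m, i)` is not yet known, or `x` is not a
tuple of `m` elements, or the `Π₁` formula with index `i` is refuted at `x`. -/
def Refuted (e : ℕ) (σ : List Bool) (j : ℕ × ℕ × ℕ × List ℕ) : Prop :=
  ¬ (Nat.Partrec.Code.evaln j.2.2.1 (ofNat Nat.Partrec.Code e) (Nat.pair j.1 j.2.1)).isSome = true ∨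
    j.2.2.2.length ≠ j.1 ∨ (∃ z ∈ j.2.2.2, σ[eqCode z z]? = some false) ∨
    ∃ w ∈ List.range σ.length, Refutes j.2.1 j.2.2.2 (ofNat _ w) ∧
      ∀ c ∈ (ofNat (ℕ × ℕ × ℕ × List ℕ × List ℕ) w).2.2.2.2, σ[c]? = some true

theorem primrec_isSome_evaln {α : Type*} [Primcodable α] {t e n : α → ℕ} (ht : Primrec t)
    (he : Primrec e) (hn : Primrec n) : PrimrecPred fun a =>
      (Nat.Partrec.Code.evaln (t a) (ofNat Nat.Partrec.Code (e a)) (n a)).isSome = true :=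
  Primrec.eq.comp (Primrec.option_isSome.comp (Nat.Partrec.Code.primrec_evaln.comp
    ((ht.pair ((Primrec.ofNat _).comp he)).pair hn))) (.const true)

theorem primrecPred_refutes : PrimrecPred fun q : (ℕ × List ℕ) × ℕ × ℕ × ℕ × List ℕ × List ℕ =>
    Refutes q.1.1 q.1.2 q.2 := by
  have c1 : Primrec fun q : (ℕ × List ℕ) × ℕ × ℕ × ℕ × List ℕ × List ℕ => q.2.1 :=
    Primrec.fst.comp .snd
  have c2 : Primrec fun q : (ℕ × List ℕ) × ℕ × ℕ × ℕ × List ℕ × List ℕ => q.2.2.1 :=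
    Primrec.fst.comp (Primrec.snd.comp .snd)
  have c3 : Primrec fun q : (ℕ × List ℕ) × ℕ × ℕ × ℕ × List ℕ × List ℕ => q.2.2.2.1 :=
    Primrec.fst.comp (Primrec.snd.comp (Primrec.snd.comp .snd))
  have c4 : Primrec fun q : (ℕ × List ℕ) × ℕ × ℕ × ℕ × List ℕ × List ℕ => q.2.2.2.2.1 :=
    Primrec.fst.comp (Primrec.snd.comp (Primrec.snd.comp (Primrec.snd.comp .snd)))
  have c5 : Primrec fun q : (ℕ × List ℕ) × ℕ × ℕ × ℕ × List ℕ × List ℕ => q.2.2.2.2.2 :=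
    Primrec.snd.comp (Primrec.snd.comp (Primrec.snd.comp (Primrec.snd.comp .snd)))
  have h1 := primrec_isSome_evaln c3 (Primrec.fst.comp .fst) (Primrec₂.natPair.comp c1 c2)
  have h2 := Primrec.eq.comp (Primrec.list_length.comp c4) c1
  have h3 := (PrimrecRel.forall_mem_list (R := fun (z : ℕ) (p : List ℕ) => eqCode z z ∈ p)
      (primrecPred_mem (primrec_eqCode.comp .fst .fst) .snd)).comp c4 c5
  have h4 := Primrec.eq.comp (primrec_evalQF.comp (c5.pair (Primrec.list_append.comp
      (Primrec.snd.comp .fst) c4)) c2) (.const (some false))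
  exact (h1.and (h2.and (h3.and h4))).of_eq fun q => Iff.rfl

theorem primrecPred_refuted (e : ℕ) : PrimrecPred fun q : List Bool × ℕ × ℕ × ℕ × List ℕ =>
    Refuted e q.1 q.2 := by
  have c1 : Primrec fun q : List Bool × ℕ × ℕ × ℕ × List ℕ => q.2.1 := Primrec.fst.comp .snd
  have c2 : Primrec fun q : List Bool × ℕ × ℕ × ℕ × List ℕ => q.2.2.1 :=
    Primrec.fst.comp (Primrec.snd.comp .snd)
  have c3 : Primrec fun q : List Bool × ℕ × ℕ × ℕ × List ℕ => q.2.2.2.1 :=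
    Primrec.fst.comp (Primrec.snd.comp (Primrec.snd.comp .snd))
  have c4 : Primrec fun q : List Bool × ℕ × ℕ × ℕ × List ℕ => q.2.2.2.2 :=
    Primrec.snd.comp (Primrec.snd.comp (Primrec.snd.comp .snd))
  have h1 := (primrec_isSome_evaln c3 (.const e) (Primrec₂.natPair.comp c1 c2)).not
  have h2 := (Primrec.eq.comp (Primrec.list_length.comp c4) c1).not
  have h3 := (PrimrecRel.exists_mem_list
      (R := fun (z : ℕ) (σ : List Bool) => σ[eqCode z z]? = some false)
      (Primrec.eq.comp (Primrec.list_getElem?.comp .snd (primrec_eqCode.comp .fst .fst))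
        (.const _))).comp c4 .fst
  have h4 : PrimrecPred fun q : List Bool × ℕ × ℕ × ℕ × List ℕ => ∃ w ∈ List.range q.1.length,
      Refutes q.2.2.1 q.2.2.2.2 (ofNat _ w) ∧
      ∀ c ∈ (ofNat (ℕ × ℕ × ℕ × List ℕ × List ℕ) w).2.2.2.2, q.1[c]? = some true := by
    have hd : Primrec fun q : ℕ × List Bool × ℕ × ℕ × ℕ × List ℕ =>
        ofNat (ℕ × ℕ × ℕ × List ℕ × List ℕ) q.1 := (Primrec.ofNat _).comp .fst
    have hx : Primrec fun q : ℕ × List Bool × ℕ × ℕ × ℕ × List ℕ =>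
        ((q.2.2.2.1, q.2.2.2.2.2), ofNat (ℕ × ℕ × ℕ × List ℕ × List ℕ) q.1) :=
      (Primrec.pair (c2.comp .snd) (c4.comp .snd)).pair hd
    have hr : PrimrecPred fun q : ℕ × List Bool × ℕ × ℕ × ℕ × List ℕ =>
        Refutes q.2.2.2.1 q.2.2.2.2.2 (ofNat (ℕ × ℕ × ℕ × List ℕ × List ℕ) q.1) :=
      PrimrecPred.of_eq (primrecPred_refutes.comp hx) fun q => by dsimp only; exact Iff.rfl
    have hq : PrimrecPred fun q : ℕ × List Bool × ℕ × ℕ × ℕ × List ℕ =>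
        ∀ c ∈ (ofNat (ℕ × ℕ × ℕ × List ℕ × List ℕ) q.1).2.2.2.2, q.2.1[c]? = some true :=
      (PrimrecRel.forall_mem_list (R := fun (c : ℕ) (σ : List Bool) => σ[c]? = some true)
        (Primrec.eq.comp (Primrec.list_getElem?.comp .snd .fst) (.const _))).comp
        (Primrec.snd.comp (Primrec.snd.comp (Primrec.snd.comp (Primrec.snd.comp hd))))
        (Primrec.fst.comp .snd)
    have h5 := PrimrecPred.and hr hq
    exact (PrimrecRel.exists_mem_list (R := fun (w : ℕ) (q : List Bool × ℕ × ℕ × ℕ × List ℕ) =>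
      Refutes q.2.2.1 q.2.2.2.2 (ofNat (ℕ × ℕ × ℕ × List ℕ × List ℕ) w) ∧
      ∀ c ∈ (ofNat (ℕ × ℕ × ℕ × List ℕ × List ℕ) w).2.2.2.2, q.1[c]? = some true)
      h5).comp (Primrec.list_range.comp (Primrec.list_length.comp .fst)) .id
  exact (h1.or (h2.or (h3.or h4))).of_eq fun q => Iff.rfl

theorem Refuted.mono {e : ℕ} {X : Set ℕ} {s t : ℕ} (hst : s ≤ t) {j : ℕ × ℕ × ℕ × List ℕ}
    (h : Refuted e (initialSegment X s) j) : Refuted e (initialSegment X t) j := by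
  simp only [Refuted, getElem?_initialSegment_eq_some, length_initialSegment] at h ⊢
  refine h.imp id (Or.imp id (Or.imp ?_ ?_))
  · rintro ⟨z, hz, h1, h2⟩
    exact ⟨z, hz, h1.trans_le hst, h2⟩
  · rintro ⟨w, hw, h1, h2⟩
    exact ⟨w, List.mem_range.2 ((List.mem_range.1 hw).trans_le hst), h1, fun c hc =>
      ⟨(h2 c hc).1.trans_le hst, (h2 c hc).2⟩⟩

section

variable {L : FirstOrder.Language.{u, v}} [ComputableLanguage L]

theorem exists_not_refuted {S : NatStructure L} {e : ℕ} (h : RealizeSigma2 L S.dom e) :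
    ∃ j, ∀ s, ¬ Refuted e (initialSegment S.diagram s) j := by
  obtain ⟨m, i, hW, x, hx⟩ := h
  obtain ⟨t, ht⟩ := mem_W_iff.1 hW
  refine ⟨(m, i, t, List.ofFn fun i => (x i : ℕ)), fun s hR => ?_⟩
  rcases hR with hR | hR | ⟨z, hz, hR⟩ | ⟨w, -, hR, hp⟩
  · exact hR ht
  · exact hR (by simp)
  · obtain ⟨i, rfl⟩ := List.mem_ofFn.1 hz
    have := (getElem?_initialSegment_eq_some.1 hR).2
    simp [eqCode_mem_diagram_iff] at this
  · generalize (ofNat (ℕ × ℕ × ℕ × List ℕ × List ℕ) w) = c at hR hp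
    obtain ⟨k, n, t, y, p⟩ := c
    obtain ⟨hW, hk, hy, hev⟩ := hR
    dsimp only at hW hk hy hev hp
    subst hk
    have hp' : ∀ c ∈ p, c ∈ S.diagram := fun c hc => by
      simpa using (getElem?_initialSegment_eq_some.1 (hp c hc)).2
    have hy' : ∀ i : Fin y.length, y.get i ∈ S.dom := fun i =>
      eqCode_mem_diagram_iff.1 (hp' _ (hy _ (y.get_mem i)))
    obtain ⟨θ, hθ, rfl, hr⟩ := exists_of_evalQF_eq (S := S)
      (a := Fin.append x fun i => (⟨y.get i, hy' i⟩ : S.dom)) (by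
        have : (fun i => ((Fin.append x fun i => (⟨y.get i, hy' i⟩ : S.dom)) i : ℕ)) =
            Fin.append (fun i => (x i : ℕ)) y.get := by
          funext i
          refine Fin.addCases (fun i => ?_) (fun i => ?_) i <;> simp
        rw [this, List.ofFn_fin_append, List.ofFn_get]) hp' hev
    exact absurd (hr.1 (hx _ θ hθ (mem_W_iff.2 ⟨t, hW⟩) _)) (by simp)

theorem realizeSigma2_of_not_refuted {S : NatStructure L} {e : ℕ} {j : ℕ × ℕ × ℕ × List ℕ}
    (h : ∀ s, ¬ Refuted e (initialSegment S.diagram s) j) : RealizeSigma2 L S.dom e := by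
  classical
  obtain ⟨m, i, t, x⟩ := j
  simp only [Refuted, not_or, not_not, not_exists, not_and] at h
  obtain ⟨h1, rfl, -⟩ := h 0
  have hx : ∀ i : Fin x.length, x.get i ∈ S.dom := fun i => by
    by_contra hi
    refine (h (eqCode (x.get i) (x.get i) + 1)).2.2.1 _ (x.get_mem i) ?_
    rw [getElem?_initialSegment_eq_some, eqCode_mem_diagram_iff]
    exact ⟨Nat.lt_succ_self _, iff_of_false hi (by simp)⟩
  refine ⟨x.length, i, mem_W_iff.2 ⟨t, h1⟩, fun i => ⟨x.get i, hx i⟩, fun k θ hθ hW y => ?_⟩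
  by_contra hr
  obtain ⟨t', ht'⟩ := mem_W_iff.1 hW
  set a : Fin (x.length + k) → S.dom := Fin.append (fun i => ⟨x.get i, hx i⟩) y with ha
  have hl : x ++ (List.ofFn fun i => (y i : ℕ)) = List.ofFn fun i => (a i : ℕ) := by
    have : (fun i => (a i : ℕ)) = Fin.append x.get (fun i => (y i : ℕ)) := by
      funext i
      refine Fin.addCases (fun i => ?_) (fun i => ?_) i <;> simp [ha]
    rw [this, List.ofFn_fin_append, List.ofFn_get]
  obtain ⟨p₀, hp₀, hev⟩ := exists_evalQF_eq hl hθ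
  let p := p₀ ++ List.ofFn fun i => eqCode (y i) (y i)
  have hp : ∀ c ∈ p, c ∈ S.diagram := by
    intro c hc
    rcases List.mem_append.1 hc with hc | hc
    · exact hp₀ c hc
    · obtain ⟨i, rfl⟩ := List.mem_ofFn.1 hc
      exact eqCode_mem_diagram_iff.2 (y i).2
  have hev := hev p (List.subset_append_left _ _) hp
  rw [decide_eq_false hr] at hev
  -- The certificate lists enough true sentences to evaluate `θ`, including `y i = y i`.
  let w := encode (k, formulaCode (Fin.val : Fin (x.length + k) → ℕ) θ, t',
    List.ofFn (fun i => (y i : ℕ)), p)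
  refine (h (w + p.sum + 1)).2.2.2 w (List.mem_range.2 ?_) ?_ ?_
  · rw [length_initialSegment]; omega
  · simp only [w, ofNat_encode]
    refine ⟨ht', by simp, fun z hz => ?_, hev⟩
    obtain ⟨i, rfl⟩ := List.mem_ofFn.1 hz
    exact List.mem_append_right _ (List.mem_ofFn.2 ⟨i, rfl⟩)
  · simp only [w, ofNat_encode]
    intro c hc
    rw [getElem?_initialSegment_eq_some]
    have := List.single_le_sum (l := p) (by simp) c hc
    exact ⟨by omega, iff_of_true (hp c hc) rfl⟩

theorem realizePi1_comp {M : Type w} {N : Type w'} [L.Structure M] [L.Structure N] (f : M ≃[L] N)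
    {m i : ℕ} {x : Fin m → M} (h : RealizePi1 L M i x) : RealizePi1 L N i (f ∘ x) := by
  intro k θ hθ hW y
  have := h k θ hθ hW (f.symm ∘ y)
  rw [← StrongHomClass.realize_formula f] at this
  convert this using 1
  funext i
  refine Fin.addCases (fun i => ?_) (fun i => ?_) i <;> simp

theorem realizeSigma2_of_iso {M : Type w} {N : Type w'} [L.Structure M] [L.Structure N]
    (f : Iso L M N) {e : ℕ} (h : RealizeSigma2 L M e) : RealizeSigma2 L N e := by
  obtain ⟨f⟩ := f
  obtain ⟨m, i, hW, x, hx⟩ := h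
  exact ⟨m, i, hW, f ∘ x, realizePi1_comp f hx⟩

theorem realizeSigma2_congr {M : Type w} {N : Type w'} [L.Structure M] [L.Structure N]
    (f : Iso L M N) {e : ℕ} : RealizeSigma2 L M e ↔ RealizeSigma2 L N e :=
  ⟨realizeSigma2_of_iso f, realizeSigma2_of_iso f.symm⟩

/-- If `e₀` is true and `e₁` is false in `S`, then eventually some witness for `e₀` is unrefuted
while all earlier candidates for `e₁` are refuted; and it is the other way round if `e₁` is true and
`e₀` is false. -/
theorem eventually_guess {S : NatStructure L} {e₀ e₁ : ℕ} (h₀ : RealizeSigma2 L S.dom e₀)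
    (h₁ : ¬ RealizeSigma2 L S.dom e₁) : ∃ s₀ j, ∀ s, s₀ ≤ s → j < s + 1 ∧
      ¬ Refuted e₀ (initialSegment S.diagram s) (ofNat _ j) ∧
      ∀ j' ≤ j, Refuted e₁ (initialSegment S.diagram s) (ofNat _ j') := by
  obtain ⟨j, hj⟩ := exists_not_refuted h₀
  have : ∀ j', ∃ s, Refuted e₁ (initialSegment S.diagram s) (ofNat _ j') := fun j' => by
    by_contra h
    push Not at h
    exact h₁ (realizeSigma2_of_not_refuted h)
  choose t ht using this
  refine ⟨max (encode j) ((Finset.range (encode j + 1)).sup t), encode j, fun s hs => ⟨?_, ?_, ?_⟩⟩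
  · have := (le_max_left _ _).trans hs; omega
  · rw [ofNat_encode]; exact hj s
  · exact fun j' hj' => (ht j').mono ((Finset.le_sup (f := t) (Finset.mem_range.2 (by omega))).trans
      ((le_max_right _ _).trans hs))

/-- Two structures with incomparable computable `Σ₂` theories can be told apart in the limit. -/
theorem exists_computable_guess {A : Type w} {B : Type w'} [L.Structure A] [L.Structure B]
    (h₀ : (sigma2Th L A \ sigma2Th L B).Nonempty) (h₁ : (sigma2Th L B \ sigma2Th L A).Nonempty) :
    ∃ mode : List Bool → Bool, Computable mode ∧
      (∀ S : NatStructure L, Iso L S.dom A →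
        ∃ s₀, ∀ s, s₀ ≤ s → mode (initialSegment S.diagram s) = true) ∧
      ∀ S : NatStructure L, Iso L S.dom B →
        ∃ s₀, ∀ s, s₀ ≤ s → mode (initialSegment S.diagram s) = false := by
  classical
  obtain ⟨e₀, hA₀, hB₀⟩ := h₀
  obtain ⟨e₁, hB₁, hA₁⟩ := h₁
  have hR : ∀ e, PrimrecRel fun (j : ℕ) (σ : List Bool) => Refuted e σ (ofNat _ j) := fun e =>
    (primrecPred_refuted e).comp (f := fun q : ℕ × List Bool => (q.2, ofNat _ q.1))
      (Primrec.snd.pair ((Primrec.ofNat _).comp .fst))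
  have hp : PrimrecPred fun σ : List Bool => ∃ j ∈ List.range (σ.length + 1),
      ¬ Refuted e₀ σ (ofNat _ j) ∧ ∀ j' ∈ List.range j, Refuted e₁ σ (ofNat _ j') :=
    (PrimrecRel.exists_mem_list (R := fun (j : ℕ) (σ : List Bool) =>
      ¬ Refuted e₀ σ (ofNat _ j) ∧ ∀ j' ∈ List.range j, Refuted e₁ σ (ofNat _ j'))
      ((hR e₀).not.and ((hR e₁).forall_mem_list.comp (Primrec.list_range.comp .fst) .snd))).comp
      (Primrec.list_range.comp (Primrec.succ.comp Primrec.list_length)) .id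
  refine ⟨_, hp.decide.to_comp, fun S hS => ?_, fun S hS => ?_⟩
  · obtain ⟨s₀, j, h⟩ := eventually_guess ((realizeSigma2_congr hS).2 hA₀)
      (fun h => hA₁ ((realizeSigma2_congr hS).1 h))
    refine ⟨s₀, fun s hs => decide_eq_true ⟨j, ?_, (h s hs).2.1, fun j' hj' =>
      (h s hs).2.2 j' (List.mem_range.1 hj').le⟩⟩
    rw [length_initialSegment]
    exact List.mem_range.2 (h s hs).1
  · obtain ⟨s₀, j, h⟩ := eventually_guess ((realizeSigma2_congr hS).2 hB₁)
      (fun h => hB₀ ((realizeSigma2_congr hS).1 h))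
    refine ⟨s₀, fun s hs => decide_eq_false ?_⟩
    rintro ⟨j', -, h1, h2⟩
    rcases le_or_gt j' j with hle | hlt
    · exact h1 ((h s hs).2.2 j' hle)
    · exact (h s hs).2.1 (h2 j (List.mem_range.2 hlt))

end

end TC

/-! ### The formula saying that a tuple has given bits -/

namespace TC

open FirstOrder FirstOrder.Language Encodable Denumerable

section

variable (L : FirstOrder.Language.{u, v})

/-- The formula stating that the variables `i` and `j` are equal. -/
def eqFormula {α : Type} (i j : α) : L.Formula α :=
  (Term.var (Sum.inl i)).bdEqual (Term.var (Sum.inl j))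

/-- Either a formula or its negation. -/
def signed {α : Type} (b : Bool) (φ : L.Formula α) : L.Formula α := cond b φ φ.not

variable {L} {M : Type w} [L.Structure M]

theorem isQF_signed {α : Type} {b : Bool} {φ : L.Formula α} (h : BoundedFormula.IsQF φ) :
    BoundedFormula.IsQF (signed L b φ) := by
  cases b
  · exact h.not
  · exact h

theorem realize_signed {α : Type} {b : Bool} {φ : L.Formula α} {c : α → M} :
    (signed L b φ).Realize c ↔ (φ.Realize c ↔ b = true) := by
  cases b <;> simp [signed, Formula.realize_not]

theorem realize_eqFormula {α : Type} {i j : α} {c : α → M} :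
    (eqFormula L i j).Realize c ↔ c i = c j := by
  simp [eqFormula, Formula.Realize, BoundedFormula.realize_bdEqual]

theorem SameExistential.symm {N : Type w'} [L.Structure N] (h : SameExistential L M N) :
    SameExistential L N M :=
  fun φ hφ => (h φ hφ).symm

theorem isExistential_exs {α : Type*} {n : ℕ} {φ : L.BoundedFormula α n}
    (h : φ.IsExistential) : BoundedFormula.IsExistential φ.exs := by
  induction n with
  | zero => exact h
  | succ n ih => exact ih h.ex

theorem realize_relabel_inr {k : ℕ} {θ : L.Formula (Fin k)} (xs : Fin k → M) {e : Empty → M} :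
    BoundedFormula.Realize θ (Sum.elim e (xs ∘ Fin.castAdd 0) ∘ Sum.inr) (xs ∘ Fin.natAdd k) ↔
      θ.Realize xs :=
  iff_of_eq (congrArg₂ (BoundedFormula.Realize θ) rfl (Subsingleton.elim _ _))

end

section

variable (L : FirstOrder.Language.{u, v}) [ComputableLanguage L]

/-- The number `n` is the code of a basic formula. -/
def IsBasicCode (n : ℕ) : Prop := ∃ φ : L.Formula ℕ, IsBasic φ ∧ formulaCode id φ = n

variable {L} {M : Type w} [L.Structure M] {N : Type w'} [L.Structure N]

theorem isBasicCode_iff {K n : ℕ} (h : n < K) :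
    IsBasicCode L n ↔ ∃ φ : L.Formula (Fin K), IsBasic φ ∧ formulaCode Fin.val φ = n := by
  constructor
  · rintro ⟨φ, h1 | ⟨ψ, h1, rfl⟩, rfl⟩
    · obtain ⟨φ', h2, rfl⟩ := exists_isAtomic_ren (p := (Fin.val : Fin K → ℕ)) h1
        fun b hb => ⟨⟨b, lt_of_le_of_lt hb h⟩, rfl⟩
      exact ⟨φ', .inl h2, by rw [formulaCode_ren]; rfl⟩
    · rw [formulaCode_not] at h
      obtain ⟨φ', h2, rfl⟩ := exists_isAtomic_ren (p := (Fin.val : Fin K → ℕ)) h1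
        fun b hb => ⟨⟨b, lt_of_le_of_lt (le_trans hb (le_negCode _)) h⟩, rfl⟩
      exact ⟨φ'.not, .inr ⟨φ', h2, rfl⟩, by
        rw [formulaCode_not, formulaCode_not, formulaCode_ren]; rfl⟩
  · rintro ⟨φ, h1 | ⟨ψ, h1, rfl⟩, rfl⟩
    · exact ⟨ren Fin.val φ, .inl (isAtomic_ren _ h1), by rw [formulaCode_ren]; rfl⟩
    · exact ⟨(ren Fin.val ψ).not, .inr ⟨_, isAtomic_ren _ h1, rfl⟩, by
        rw [formulaCode_not, formulaCode_not, formulaCode_ren]; rfl⟩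

variable (L)

open Classical in
/-- The basic formula with code `n` in the variables `0, …, K - 1`, or `⊥` if there is none. -/
noncomputable def basicFormula (K n : ℕ) : L.Formula (Fin K) :=
  if h : ∃ φ : L.Formula (Fin K), IsBasic φ ∧ formulaCode Fin.val φ = n then h.choose else .falsum

/-- Formulas that jointly say that the variables `0, …, K - 1` are distinct and that their bits are
those of `τ`. -/
noncomputable def typeList (K : ℕ) (τ : List Bool) : List (L.Formula (Fin K)) :=
  ((List.range K).map fun n => signed L (τ.getD n false) (basicFormula L K n)) ++
    (List.finRange K).flatMap fun i => (List.finRange K).map fun j =>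
      signed L (decide (i.val = j.val)) (eqFormula L i j)

/-- The formula saying that the variables `0, …, K - 1` are not distinct or that their bits are not
those of `τ`. -/
noncomputable def notTypeFormula (K : ℕ) (τ : List Bool) : L.Formula (Fin K) :=
  (typeList L K τ).foldr BoundedFormula.imp .falsum

variable {L}

theorem isQF_basicFormula (K n : ℕ) : BoundedFormula.IsQF (basicFormula L K n) := by
  rw [basicFormula]
  split_ifs with h
  · rcases h.choose_spec.1 with h' | ⟨ψ, h', e⟩
    · exact h'.isQF
    · rw [e]; exact h'.isQF.not
  · exact .falsum

theorem realize_basicFormula {K n : ℕ} (c : Fin K → M) :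
    (basicFormula L K n).Realize c ↔ n ∈ bdiag L Fin.val c := by
  rw [basicFormula]
  split_ifs with h
  · have hs := h.choose_spec
    refine ⟨fun hr => ⟨_, hs.1, hr, hs.2⟩, ?_⟩
    rintro ⟨φ, -, hr, hc⟩
    rwa [← formulaCode_injective Fin.val_injective (hc.trans hs.2.symm)]
  · exact iff_of_false id fun ⟨φ, h1, _, h2⟩ => h ⟨φ, h1, h2⟩

open Classical in
theorem formulaCode_basicFormula {K n : ℕ} (h : n < K) :
    formulaCode Fin.val (basicFormula L K n) = if IsBasicCode L n then n else 0 := by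
  rw [basicFormula]
  by_cases h' : IsBasicCode L n
  · rw [if_pos h', dif_pos ((isBasicCode_iff h).1 h')]
    exact ((isBasicCode_iff h).1 h').choose_spec.2
  · rw [if_neg h', dif_neg fun hh => h' ((isBasicCode_iff h).2 hh)]
    rfl

theorem formulaCode_signed {α : Type} (v : α → ℕ) (b : Bool) (φ : L.Formula α) :
    formulaCode v (signed L b φ) = cond b (formulaCode v φ) (negCode (formulaCode v φ)) := by
  cases b
  · exact formulaCode_not _ _
  · rfl

theorem isQF_notTypeFormula (K : ℕ) (τ : List Bool) :
    BoundedFormula.IsQF (notTypeFormula L K τ) := by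
  have h : ∀ φ ∈ typeList L K τ, BoundedFormula.IsQF φ := by
    intro φ hφ
    simp only [typeList, List.mem_append, List.mem_map, List.mem_flatMap] at hφ
    rcases hφ with ⟨n, -, rfl⟩ | ⟨i, -, j, -, rfl⟩
    · exact isQF_signed (isQF_basicFormula _ _)
    · exact isQF_signed (BoundedFormula.IsAtomic.equal _ _).isQF
  rw [notTypeFormula]
  generalize typeList L K τ = l at h
  induction l with
  | nil => exact .falsum
  | cons φ l ih =>
    exact (h φ (by simp)).imp (ih fun ψ hψ => h ψ (List.mem_cons_of_mem _ hψ))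

theorem realize_notTypeFormula {K : ℕ} {τ : List Bool} (hτ : τ.length = K) (c : Fin K → M) :
    (notTypeFormula L K τ).Realize c ↔
      ¬ (Function.Injective c ∧ initialSegment (bdiag L Fin.val c) K = τ) := by
  classical
  have h1 : (notTypeFormula L K τ).Realize c ↔ ¬ ∀ φ ∈ typeList L K τ, φ.Realize c := by
    rw [notTypeFormula]
    induction typeList L K τ with
    | nil => exact iff_of_false id (by simp)
    | cons φ l ih =>
      rw [List.foldr_cons, List.forall_mem_cons, not_and, ← ih]
      exact Iff.rfl
  rw [h1, not_iff_not]
  rw [typeList, List.forall_mem_append, List.forall_mem_map, and_comm]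
  simp only [List.mem_range, realize_signed, realize_basicFormula]
  refine and_congr ?_ ?_
  · simp only [List.mem_flatMap, List.mem_finRange, List.mem_map, true_and]
    constructor
    · intro h i j hij
      have := h _ ⟨i, j, rfl⟩
      rw [realize_signed, realize_eqFormula] at this
      exact Fin.ext (of_decide_eq_true (this.1 hij))
    · rintro h _ ⟨i, j, rfl⟩
      rw [realize_signed, realize_eqFormula, h.eq_iff, decide_eq_true_iff, Fin.ext_iff]
  · subst hτ
    constructor
    · intro h
      refine List.ext_getElem (length_initialSegment _ _) fun i h1 h2 => ?_
      have := h i h2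
      rw [List.getD_eq_getElem _ _ h2] at this
      simp only [initialSegment, List.getElem_map, List.getElem_range, this, Bool.decide_eq_true]
    · intro h n hn
      have := (getElem?_initialSegment_eq_some (X := bdiag L Fin.val c) (n := τ.length) (i := n)
        (b := τ[n])).1 (by rw [h]; exact List.getElem?_eq_getElem hn)
      rw [List.getD_eq_getElem _ _ hn]
      exact this.2

/-- The code of `notTypeFormula`, relative to a decision procedure for codes of basic formulas. -/
def notTypeCode (wf : ℕ → Bool) (τ : List Bool) : ℕ :=
  (((List.range τ.length).map fun n => cond (τ.getD n false) (cond (wf n) n 0)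
    (negCode (cond (wf n) n 0))) ++
    (List.range τ.length).flatMap fun i => (List.range τ.length).map fun j =>
      cond (decide (i = j)) (eqCode i j) (negCode (eqCode i j))).foldr
    (fun n acc => Nat.pair 3 (Nat.pair n acc)) 0

theorem formulaCode_notTypeFormula {wf : ℕ → Bool} (hwf : ∀ n, wf n = true ↔ IsBasicCode L n)
    {K : ℕ} {τ : List Bool} (hτ : τ.length = K) :
    formulaCode Fin.val (notTypeFormula L K τ) = notTypeCode wf τ := by
  classical
  have h1 : formulaCode Fin.val (notTypeFormula L K τ) =
      ((typeList L K τ).map (formulaCode Fin.val)).foldr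
        (fun n acc => Nat.pair 3 (Nat.pair n acc)) 0 := by
    rw [notTypeFormula]
    induction typeList L K τ with
    | nil => rfl
    | cons φ l ih =>
      rw [List.foldr_cons, List.map_cons, List.foldr_cons, ← ih]
      rfl
  rw [h1, notTypeCode, typeList, List.map_append, List.map_map]
  subst hτ
  congr 2
  · refine List.map_congr_left fun n hn => ?_
    rw [Function.comp_apply, formulaCode_signed, formulaCode_basicFormula (List.mem_range.1 hn)]
    by_cases h : IsBasicCode L n
    · rw [(hwf n).2 h, if_pos h]; rfl
    · rw [Bool.eq_false_iff.2 fun h' => h ((hwf n).1 h'), if_neg h]; rfl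
  · rw [List.map_flatMap, ← List.map_coe_finRange_eq_range, List.flatMap_map]
    refine List.flatMap_congr fun i _ => ?_
    rw [List.map_map, List.map_map]
    refine List.map_congr_left fun j _ => ?_
    rw [Function.comp_apply, formulaCode_signed]
    rfl

theorem computable_notTypeCode {wf : ℕ → Bool} (hwf : Computable wf) :
    Computable (notTypeCode wf) := by
  have h1 : Computable fun τ : List Bool => (List.range τ.length).map fun n =>
      cond (τ.getD n false) (cond (wf n) n 0) (negCode (cond (wf n) n 0)) := by
    have hw : Computable fun p : List Bool × ℕ => cond (wf p.2) p.2 0 :=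
      Computable.cond (hwf.comp .snd) .snd (.const 0)
    exact computable_list_map (Primrec.list_range.comp Primrec.list_length).to_comp
      (Computable.cond (Primrec.list_getD false).to_comp hw (primrec_negCode.to_comp.comp hw))
  have h2 : Primrec fun τ : List Bool => (List.range τ.length).flatMap fun i =>
      (List.range τ.length).map fun j =>
        cond (decide (i = j)) (eqCode i j) (negCode (eqCode i j)) := by
    have hr : Primrec fun τ : List Bool => List.range τ.length :=
      Primrec.list_range.comp Primrec.list_length
    have hi : Primrec fun p : (List Bool × ℕ) × ℕ => p.1.2 := Primrec.snd.comp .fst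
    have hc : Primrec fun p : (List Bool × ℕ) × ℕ => eqCode p.1.2 p.2 :=
      primrec_eqCode.comp hi .snd
    exact Primrec.list_flatMap hr (Primrec.list_map (hr.comp .fst)
      (Primrec.cond (Primrec.eq.decide.comp hi .snd) hc (primrec_negCode.comp hc)))
  have h3 : Primrec fun l : List ℕ => l.foldr (fun n acc => Nat.pair 3 (Nat.pair n acc)) 0 :=
    Primrec.list_foldr .id (.const 0) (h := fun _ p => Nat.pair 3 (Nat.pair p.1 p.2))
      (Primrec₂.natPair.comp (.const 3) (Primrec₂.natPair.comp (Primrec.fst.comp .snd)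
        (Primrec.snd.comp .snd)))
  exact h3.to_comp.comp (Computable.list_append.comp h1 h2.to_comp)

theorem SameExistential.locallyEmbeds (h : SameExistential L M N) : LocallyEmbeds L M N := by
  intro a ha
  let θ := notTypeFormula L a.length (bits L a)
  let φ : L.Sentence := (BoundedFormula.relabel (Sum.inr : Fin a.length → Empty ⊕ Fin a.length)
    θ.not).exs
  have hφ : BoundedFormula.IsExistential φ :=
    isExistential_exs ((isQF_notTypeFormula _ _).not.relabel _).isExistential
  have hM : Sentence.Realize M φ := by
    refine BoundedFormula.realize_exs.2 ⟨a.get, ?_⟩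
    rw [BoundedFormula.realize_relabel, BoundedFormula.realize_not,
      realize_relabel_inr (θ := θ) a.get, realize_notTypeFormula (length_bits a)]
    exact fun h' => h' ⟨List.nodup_iff_injective_get.1 ha, rfl⟩
  obtain ⟨xs, hxs⟩ := BoundedFormula.realize_exs.1 ((h φ hφ).1 hM)
  rw [BoundedFormula.realize_relabel, BoundedFormula.realize_not, realize_relabel_inr (θ := θ) xs,
    realize_notTypeFormula (length_bits a), not_not] at hxs
  exact ⟨List.ofFn xs, List.nodup_ofFn.2 hxs.1, (bits_ofFn xs).trans hxs.2⟩

end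

end TC

/-! ### Computably enumerable predicates and indices -/

namespace TC

open Encodable Denumerable

section

variable {α β : Type*} [Primcodable α] [Primcodable β]

/-- A predicate is computably enumerable if and only if it is the projection of a computable one. -/
theorem rePred_iff_exists {p : α → Prop} :
    REPred p ↔ ∃ g : α → ℕ → Bool, Computable₂ g ∧ ∀ a, p a ↔ ∃ s, g a s = true := by
  constructor
  · intro h
    obtain ⟨c, hc⟩ := Nat.Partrec.Code.exists_code.1 h
    refine ⟨fun a s => (Nat.Partrec.Code.evaln s c (encode a)).isSome, ?_, fun a => ?_⟩
    · exact (Primrec.option_isSome.comp (Nat.Partrec.Code.primrec_evaln.comp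
        ((Primrec.snd.pair (.const c)).pair (Primrec.encode.comp .fst)))).to_comp
    · have h1 : p a ↔ (c.eval (encode a)).Dom := by
        rw [hc]
        simp [Part.dom_iff_mem]
      rw [h1]
      simp only [Part.dom_iff_mem, Nat.Partrec.Code.evaln_complete, Option.isSome_iff_exists,
        Option.mem_def]
      exact exists_comm
  · rintro ⟨g, hg, h⟩
    refine REPred.of_eq (Partrec.dom_re (Partrec.rfind (p := fun a s => Part.some (g a s))
      hg.partrec₂)) fun a => ?_
    refine Iff.trans (Nat.rfind_dom (p := fun s => Part.some (g a s))) ?_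
    rw [h]
    constructor
    · rintro ⟨n, hn, -⟩
      exact ⟨n, (Part.mem_some_iff.1 hn).symm⟩
    · rintro ⟨n, hn⟩
      exact ⟨n, by rw [hn]; exact Part.mem_some _, fun _ => trivial⟩

theorem rePred_and {p q : α → Prop} (hp : REPred p) (hq : REPred q) :
    REPred fun a => p a ∧ q a := by
  rw [rePred_iff_exists] at hp hq ⊢
  obtain ⟨g, hg, h⟩ := hp
  obtain ⟨g', hg', h'⟩ := hq
  refine ⟨fun a s => g a s.unpair.1 && g' a s.unpair.2, Primrec.and.to_comp.comp
    (hg.comp .fst (Computable.fst.comp (Computable.unpair.comp .snd)))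
    (hg'.comp .fst (Computable.snd.comp (Computable.unpair.comp .snd))), fun a => ?_⟩
  rw [h, h']
  constructor
  · rintro ⟨⟨s, hs⟩, t, ht⟩
    exact ⟨Nat.pair s t, by simp [hs, ht]⟩
  · rintro ⟨s, hs⟩
    rw [Bool.and_eq_true] at hs
    exact ⟨⟨_, hs.1⟩, _, hs.2⟩

theorem rePred_or {p q : α → Prop} (hp : REPred p) (hq : REPred q) :
    REPred fun a => p a ∨ q a := by
  rw [rePred_iff_exists] at hp hq ⊢
  obtain ⟨g, hg, h⟩ := hp
  obtain ⟨g', hg', h'⟩ := hq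
  refine ⟨fun a s => g a s || g' a s, Primrec.or.to_comp.comp hg hg', fun a => ?_⟩
  simp only [h, h', Bool.or_eq_true, exists_or]

theorem rePred_exists {p : α → β → Prop} (hp : REPred fun q : α × β => p q.1 q.2) :
    REPred fun a => ∃ b, p a b := by
  rw [rePred_iff_exists] at hp ⊢
  obtain ⟨g, hg, h⟩ := hp
  refine ⟨fun a s => ((decode (α := β) s.unpair.1).map fun b => g (a, b) s.unpair.2).getD false,
    ?_, fun a => ?_⟩
  · refine Computable.option_getD (Computable.option_map (Computable.decode.comp
      (Computable.fst.comp (Computable.unpair.comp .snd))) ?_) (.const false)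
    exact hg.comp ((Computable.fst.comp .fst).pair .snd)
      (Computable.snd.comp (Computable.unpair.comp (Computable.snd.comp .fst)))
  · constructor
    · rintro ⟨b, hb⟩
      obtain ⟨s, hs⟩ := (h (a, b)).1 hb
      exact ⟨Nat.pair (encode b) s, by simp [hs]⟩
    · rintro ⟨s, hs⟩
      rcases hb : decode (α := β) s.unpair.1 with _ | b
      · simp [hb] at hs
      · exact ⟨b, (h (a, b)).2 ⟨_, by simpa [hb] using hs⟩⟩

theorem rePred_comp {p : β → Prop} (hp : REPred p) {f : α → β} (hf : Computable f) :
    REPred fun a => p (f a) :=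
  Partrec.comp hp hf

/-- The `s`-`m`-`n` theorem for computably enumerable sets. -/
theorem exists_computable_index {p : α → ℕ → Prop} (hp : REPred fun q : α × ℕ => p q.1 q.2) :
    ∃ s : α → ℕ, Computable s ∧ ∀ a n, n ∈ W (s a) ↔ p a n := by
  have h := Partrec.bind (f := fun m : ℕ => (decode (α := α) m.unpair.1 : Part α))
    (g := fun m a => Part.map (fun _ => 0) (Part.assert (p a m.unpair.2) fun _ => Part.some ()))
    (Computable.ofOption (Computable.decode.comp (Computable.fst.comp Computable.unpair)))
    (Partrec.map (Partrec.comp hp (Computable.snd.pair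
      (Computable.snd.comp (Computable.unpair.comp .fst)))) (Computable.const 0).to₂)
  obtain ⟨c, hc⟩ := Nat.Partrec.Code.exists_code.1 (Partrec.nat_iff.1 h)
  refine ⟨fun a => encode (Nat.Partrec.Code.curry c (encode a)), Computable.encode.comp
    ((Nat.Partrec.Code.primrec₂_curry.comp (.const c) Primrec.encode).to_comp), fun a n => ?_⟩
  change (Nat.Partrec.Code.eval (ofNat _ _) n).Dom ↔ _
  rw [ofNat_encode, Nat.Partrec.Code.eval_curry, hc]
  simp [Part.dom_iff_mem]

theorem exists_index {p : ℕ → Prop} (hp : REPred p) : ∃ e, ∀ n, n ∈ W e ↔ p n := by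
  obtain ⟨s, -, hs⟩ := exists_computable_index (α := Unit) (p := fun _ n => p n)
    (rePred_comp hp Computable.snd)
  exact ⟨s (), hs ()⟩

theorem TuringOperator.rePred_mem (Φ : TuringOperator) (y : ℕ) :
    REPred fun q : List Bool × ℕ => y ∈ Φ.onString q.1 q.2 := by
  have h1 : Computable₂ fun (_ : List Bool × ℕ) (z : ℕ) =>
      (if z = y then some () else none : Option Unit) :=
    (Primrec.ite (Primrec.eq.comp .snd (.const y)) (.const _) (.const _)).to_comp
  refine REPred.of_eq (Partrec.dom_re (Partrec.bind (g := fun _ z =>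
    ((if z = y then some () else none : Option Unit) : Part Unit)) Φ.partrec
    (Computable.ofOption h1))) fun q => ?_
  rw [Part.dom_iff_mem]
  constructor
  · rintro ⟨u, hu⟩
    obtain ⟨z, hz, hu⟩ := Part.mem_bind_iff.1 hu
    by_cases h : z = y
    · exact h ▸ hz
    · simp [h] at hu
  · intro h
    exact ⟨(), Part.mem_bind_iff.2 ⟨y, h, by simp⟩⟩

/-- From a computable oracle, the inputs with a given output can be enumerated computably. -/
theorem TuringOperator.rePred_computes (Φ : TuringOperator) {X : Set ℕ}
    (hX : ComputablePred fun n => n ∈ X) (y : ℕ) : REPred fun x => Φ.Computes X x y := by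
  classical
  have h1 : Computable fun n => initialSegment X n := by
    have := computable_list_map (f := fun n : ℕ => List.range n)
      (g := fun _ i => decide (i ∈ X)) Primrec.list_range.to_comp (hX.decide.comp .snd)
    exact this.of_eq fun n => by simp [initialSegment]
  exact rePred_exists (Φ.rePred_mem y |> fun h => rePred_comp h
    ((h1.comp .snd).pair .fst))

end

end TC

/-! ### The orders `ω` and `ω*` -/

namespace TC

open FirstOrder FirstOrder.Language Encodable Denumerable

/-- The natural numbers, to be ordered as `ω` for `b = true` and as `ω*` for `b = false`. -/
@[nolint unusedArguments]
def Omega (_ : Bool) : Type := ℕ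

instance (b : Bool) : Countable (Omega b) := inferInstanceAs (Countable ℕ)

instance (b : Bool) : Infinite (Omega b) := inferInstanceAs (Infinite ℕ)

/-- The order of `Omega b`, as a relation between natural numbers. -/
def omegaLE (b : Bool) (x y : ℕ) : Prop := cond b (x ≤ y) (y ≤ x)

instance (b : Bool) : FirstOrder.Language.order.Structure (Omega b) where
  funMap := fun f => Empty.elim f
  RelMap := fun {_} R => match R with
    | .le => fun x => omegaLE b (x 0) (x 1)

/-- The formula `x ≤ y`. -/
def leFormula {α : Type} (x y : α) : FirstOrder.Language.order.Formula α :=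
  BoundedFormula.rel (l := 2) orderRel.le ![Term.var (Sum.inl x), Term.var (Sum.inl y)]

/-- The code of the formula `x ≤ y`. -/
def leCode (x y : ℕ) : ℕ :=
  Nat.pair 2 (Nat.pair 0 (encode [Nat.pair 0 (2 * x), Nat.pair 0 (2 * y)]))

theorem formulaCode_leFormula {α : Type} (c : α → ℕ) (x y : α) :
    formulaCode c (leFormula x y) = leCode (c x) (c y) := by
  simp only [leFormula, formulaCode, leCode, List.ofFn_succ, List.ofFn_zero]
  rfl

theorem formulaCode_eqFormula {L : FirstOrder.Language.{u, v}} [ComputableLanguage L] {α : Type}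
    (c : α → ℕ) (x y : α) : formulaCode c (eqFormula L x y) = eqCode (c x) (c y) := rfl

theorem primrec_leCode : Primrec₂ leCode := by
  have h {f : ℕ × ℕ → ℕ} (hf : Primrec f) : Primrec fun q => Nat.pair 0 (2 * f q) :=
    Primrec₂.natPair.comp (.const 0) (Primrec.nat_mul.comp (.const 2) hf)
  exact Primrec₂.natPair.comp (.const 2) (Primrec₂.natPair.comp (.const 0) (Primrec.encode.comp
    (Primrec.list_cons.comp (h .fst) (Primrec.list_cons.comp (h .snd) (.const [])))))

theorem leCode_inj {x y x' y' : ℕ} : leCode x y = leCode x' y' ↔ x = x' ∧ y = y' := by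
  simp [leCode]

theorem exists_eq_var {α : Type} (t : FirstOrder.Language.order.Term (α ⊕ Fin 0)) :
    ∃ x, t = Term.var (Sum.inl x) := by
  cases t with
  | var x =>
    rcases x with x | i
    · exact ⟨x, rfl⟩
    · exact i.elim0
  | func f => exact Empty.elim f

theorem isAtomic_order {α : Type} {ψ : FirstOrder.Language.order.Formula α}
    (h : BoundedFormula.IsAtomic ψ) : ∃ x y, ψ = eqFormula _ x y ∨ ψ = leFormula x y := by
  cases h with
  | equal t s =>
    obtain ⟨x, rfl⟩ := exists_eq_var t
    obtain ⟨y, rfl⟩ := exists_eq_var s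
    exact ⟨x, y, .inl rfl⟩
  | rel R ts =>
    cases R
    obtain ⟨x, hx⟩ := exists_eq_var (ts 0)
    obtain ⟨y, hy⟩ := exists_eq_var (ts 1)
    refine ⟨x, y, .inr ?_⟩
    have : ts = ![Term.var (Sum.inl x), Term.var (Sum.inl y)] := by
      funext i
      fin_cases i
      · exact hx
      · exact hy
    rw [this]
    rfl

section

variable {α : Type} {b : Bool}

/-- The identity of `ℕ` as a numbering of `Omega b`. -/
def omegaEquiv (b : Bool) : ℕ ≃ Omega b := Equiv.refl ℕ

theorem realize_leFormula {g : α → Omega b} {x y : α} :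
    (leFormula x y).Realize g ↔ omegaLE b (g x) (g y) := Iff.rfl

theorem mem_bdiag_omega_iff {c : α → ℕ} {g : α → Omega b} {n : ℕ} :
    n ∈ bdiag FirstOrder.Language.order c g ↔ ∃ x y,
      (g x = g y ∧ n = eqCode (c x) (c y)) ∨ (g x ≠ g y ∧ n = negCode (eqCode (c x) (c y))) ∨
      (omegaLE b (g x) (g y) ∧ n = leCode (c x) (c y)) ∨
      (¬ omegaLE b (g x) (g y) ∧ n = negCode (leCode (c x) (c y))) := by
  rw [mem_bdiag_iff]
  constructor
  · rintro ⟨ψ, hψ, h⟩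
    obtain ⟨x, y, rfl | rfl⟩ := isAtomic_order hψ
    · rw [realize_eqFormula, formulaCode_eqFormula] at h
      rcases h with ⟨h, h'⟩ | ⟨h, h'⟩
      · exact ⟨x, y, .inl ⟨h, h'.symm⟩⟩
      · exact ⟨x, y, .inr (.inl ⟨h, h'.symm⟩)⟩
    · rw [realize_leFormula, formulaCode_leFormula] at h
      rcases h with ⟨h, h'⟩ | ⟨h, h'⟩
      · exact ⟨x, y, .inr (.inr (.inl ⟨h, h'.symm⟩))⟩
      · exact ⟨x, y, .inr (.inr (.inr ⟨h, h'.symm⟩))⟩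
  · rintro ⟨x, y, h⟩
    have he : BoundedFormula.IsAtomic (eqFormula FirstOrder.Language.order x y) := .equal _ _
    have hl : BoundedFormula.IsAtomic (leFormula x y) := .rel _ _
    rcases h with ⟨h, rfl⟩ | ⟨h, rfl⟩ | ⟨h, rfl⟩ | ⟨h, rfl⟩
    · exact ⟨_, he, .inl ⟨realize_eqFormula.2 h, rfl⟩⟩
    · exact ⟨_, he, .inr ⟨fun h' => h (realize_eqFormula.1 h'), rfl⟩⟩
    · exact ⟨_, hl, .inl ⟨h, formulaCode_leFormula _ _ _⟩⟩
    · exact ⟨_, hl, .inr ⟨h, by rw [formulaCode_leFormula]⟩⟩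

theorem negCode_leCode_mem_bdiag_iff {c : α → ℕ} {g : α → Omega b} {p q : ℕ} :
    negCode (leCode p q) ∈ bdiag FirstOrder.Language.order c g ↔
      ∃ x y, c x = p ∧ c y = q ∧ ¬ omegaLE b (g x) (g y) := by
  rw [mem_bdiag_omega_iff]
  refine exists_congr fun x => exists_congr fun y => ?_
  have h1 (m : ℕ) : negCode m ≠ eqCode (c x) (c y) := by simp [negCode, eqCode]
  have h2 (m : ℕ) : negCode m ≠ leCode (c x) (c y) := by simp [negCode, leCode]
  have h3 : leCode p q ≠ eqCode (c x) (c y) := by simp [leCode, eqCode]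
  simp only [h1, h2, negCode_injective.eq_iff, h3, leCode_inj]
  tauto

end

/-- The formula `x ≤ y` or the formula `y ≤ x`, which in `Omega b` says that `x` is not larger than
`y` as a natural number. -/
def natLE {α : Type} (b : Bool) (x y : α) : FirstOrder.Language.order.Formula α :=
  cond b (leFormula x y) (leFormula y x)

/-- The code of `natLE b x y`. -/
def natLECode (b : Bool) (x y : ℕ) : ℕ := cond b (leCode x y) (leCode y x)

theorem formulaCode_natLE {α : Type} (b : Bool) (c : α → ℕ) (x y : α) :
    formulaCode c (natLE b x y) = natLECode b (c x) (c y) := by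
  cases b <;> exact formulaCode_leFormula _ _ _

theorem primrec_natLECode (b : Bool) : Primrec₂ (natLECode b) := by
  cases b
  · exact primrec_leCode.swap
  · exact primrec_leCode

/-- In the diagram of `Omega b'`, the formula `natLE b` stands for the order of `ℕ` if `b = b'`
and for its reverse otherwise. -/
theorem negCode_natLECode_mem_bdiag_iff {α : Type} {b b' : Bool} {c : α → ℕ} {g : α → Omega b'}
    {p q : ℕ} : negCode (natLECode b p q) ∈ bdiag FirstOrder.Language.order c g ↔
      ∃ x y, c x = p ∧ c y = q ∧ ¬ omegaLE (b == b') (g x) (g y) := by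
  rcases b with _ | _
  · have h : negCode (natLECode false p q) = negCode (leCode q p) := rfl
    rw [h, negCode_leCode_mem_bdiag_iff, exists_comm]
    refine exists_congr fun x => exists_congr fun y => ?_
    cases b' <;> exact and_left_comm
  · have h : negCode (natLECode true p q) = negCode (leCode p q) := rfl
    rw [h, negCode_leCode_mem_bdiag_iff]
    cases b' <;> exact Iff.rfl

/-- The copy of `Omega b` whose domain is the set of all natural numbers. -/
def omegaCopy (b : Bool) : NatStructure FirstOrder.Language.order :=
  copy (omegaEquiv b)

theorem iso_omegaCopy (b : Bool) :
    Iso FirstOrder.Language.order (omegaCopy b).dom (Omega b) := ⟨copyEquiv _⟩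

instance (b : Bool) : Infinite (omegaCopy b).dom := (iso_omegaCopy b).some.toEquiv.infinite_iff.2
  inferInstance

/-- The variables of a basic formula are bounded by its code, so that a bounded search decides the
diagram. -/
theorem computablePred_diagram_omegaCopy (b : Bool) :
    ComputablePred fun n => n ∈ (omegaCopy b).diagram := by
  let p : ℕ → ℕ × ℕ → Prop := fun n q =>
    (q.1 = q.2 ∧ n = eqCode q.1 q.2) ∨ (q.1 ≠ q.2 ∧ n = negCode (eqCode q.1 q.2)) ∨
      (omegaLE b q.1 q.2 ∧ n = leCode q.1 q.2) ∨
      (¬ omegaLE b q.1 q.2 ∧ n = negCode (leCode q.1 q.2))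
  have hle : PrimrecPred fun q : (ℕ × ℕ) × ℕ => omegaLE b q.1.1 q.1.2 := by
    cases b
    · exact Primrec.nat_le.comp (Primrec.snd.comp .fst) (Primrec.fst.comp .fst)
    · exact Primrec.nat_le.comp (Primrec.fst.comp .fst) (Primrec.snd.comp .fst)
  have he : Primrec fun q : (ℕ × ℕ) × ℕ => eqCode q.1.1 q.1.2 :=
    primrec_eqCode.comp (Primrec.fst.comp .fst) (Primrec.snd.comp .fst)
  have hl : Primrec fun q : (ℕ × ℕ) × ℕ => leCode q.1.1 q.1.2 :=
    primrec_leCode.comp (Primrec.fst.comp .fst) (Primrec.snd.comp .fst)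
  have hq : PrimrecPred fun q : (ℕ × ℕ) × ℕ => q.1.1 = q.1.2 :=
    Primrec.eq.comp (Primrec.fst.comp .fst) (Primrec.snd.comp .fst)
  have hp : PrimrecRel fun (q : ℕ × ℕ) (n : ℕ) => p n q :=
    (hq.and (Primrec.eq.comp .snd he)).or ((hq.not.and
      (Primrec.eq.comp .snd (primrec_negCode.comp he))).or ((hle.and (Primrec.eq.comp .snd hl)).or
        (hle.not.and (Primrec.eq.comp .snd (primrec_negCode.comp hl)))))
  have hb : Primrec fun n : ℕ => (List.range (n + 1)).product (List.range (n + 1)) := by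
    have hr : Primrec fun n : ℕ => List.range (n + 1) := Primrec.list_range.comp .succ
    exact Primrec.list_flatMap hr (Primrec.list_map (hr.comp .fst)
      ((Primrec.snd.comp .fst).pair .snd))
  refine ((hp.exists_mem_list.comp hb .id).of_eq fun n => ?_).computablePred
  rw [omegaCopy, diagram_copy, mem_bdiag_omega_iff]
  constructor
  · rintro ⟨q, -, h⟩
    exact ⟨q.1, q.2, h⟩
  · rintro ⟨x, y, h⟩
    refine ⟨(x, y), ?_, h⟩
    have h1 : ∀ r s, x ≤ Nat.pair r (Nat.pair (Nat.pair 0 (2 * x)) s) := fun r s =>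
      ((Nat.le_mul_of_pos_left x two_pos).trans (Nat.right_le_pair 0 _)).trans
        ((Nat.left_le_pair _ _).trans (Nat.right_le_pair _ _))
    have hxe : x ≤ eqCode x y ∧ y ≤ eqCode x y := by
      have := Nat.right_le_pair 1 (Nat.pair (Nat.pair 0 (2 * x)) (Nat.pair 0 (2 * y)))
      have h2 := Nat.left_le_pair (Nat.pair 0 (2 * x)) (Nat.pair 0 (2 * y))
      have h3 := Nat.right_le_pair (Nat.pair 0 (2 * x)) (Nat.pair 0 (2 * y))
      have h4 := Nat.right_le_pair 0 (2 * x)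
      have h5 := Nat.right_le_pair 0 (2 * y)
      rw [eqCode]
      omega
    have hxl : x ≤ leCode x y ∧ y ≤ leCode x y := by
      have h1 := lt_encode_of_mem (l := [Nat.pair 0 (2 * x), Nat.pair 0 (2 * y)])
        (List.mem_cons_self ..)
      have h2 := lt_encode_of_mem (l := [Nat.pair 0 (2 * x), Nat.pair 0 (2 * y)])
        (List.mem_cons_of_mem _ (List.mem_cons_self ..))
      have h3 := Nat.right_le_pair 0 (encode [Nat.pair 0 (2 * x), Nat.pair 0 (2 * y)])
      have h4 := Nat.right_le_pair 2
        (Nat.pair 0 (encode [Nat.pair 0 (2 * x), Nat.pair 0 (2 * y)]))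
      have h5 := Nat.right_le_pair 0 (2 * x)
      have h6 := Nat.right_le_pair 0 (2 * y)
      rw [leCode]
      omega
    have hn : x ≤ n ∧ y ≤ n := by
      have h1 := le_negCode (eqCode x y)
      have h2 := le_negCode (leCode x y)
      rcases h with ⟨-, rfl⟩ | ⟨-, rfl⟩ | ⟨-, rfl⟩ | ⟨-, rfl⟩ <;> simp only [id] <;> omega
    exact List.mem_product.2 ⟨List.mem_range.2 (by simp; omega), List.mem_range.2 (by simp; omega)⟩

theorem locallyEmbeds_refl {L : FirstOrder.Language.{u, v}} [ComputableLanguage L] {M : Type w}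
    [L.Structure M] : LocallyEmbeds L M M := fun a ha => ⟨a, ha, rfl⟩

theorem omegaLE_sub (b : Bool) {N x y : ℕ} (hx : x ≤ N) (hy : y ≤ N) :
    omegaLE (!b) (N - x) (N - y) ↔ omegaLE b x y := by
  cases b <;> simp only [omegaLE, Bool.not_true, Bool.not_false, cond_true, cond_false] <;> omega

/-- A finite tuple of `ω` is mirrored in `ω*` by subtracting its entries from a large number. -/
theorem locallyEmbeds_omega_not (b : Bool) :
    LocallyEmbeds FirstOrder.Language.order (Omega b) (Omega !b) := by
  intro a ha
  rcases eq_or_ne a [] with rfl | hne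
  · exact ⟨[], List.nodup_nil, rfl⟩
  obtain ⟨N, hN⟩ : ∃ N : ℕ, ∀ x : ℕ, List.Mem (α := ℕ) x a → x ≤ N :=
    ⟨List.sum (α := ℕ) a, fun x hx => List.le_sum_of_mem hx⟩
  obtain ⟨f, hfa, hf⟩ := exists_extends_mem hne
  let s : Omega b → Omega !b := fun x => N.sub x
  have hs' : ∀ x y : ℕ, x ≤ N → y ≤ N → N - x = N - y → x = y := by omega
  have hs : ∀ x ∈ a, ∀ y ∈ a, s x = s y → x = y := fun x hx y hy =>
    hs' x y (hN x hx) (hN y hy)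
  refine ⟨a.map s, ha.map_on hs, ?_⟩
  rw [bits_eq_initialSegment hf, bits_eq_initialSegment (f := s ∘ f) fun i hi => by
    rw [List.length_map] at hi
    rw [Function.comp_apply, hf i hi, List.getElem_map], List.length_map]
  congr 1
  ext n
  rw [mem_bdiag_omega_iff, mem_bdiag_omega_iff]
  refine exists_congr fun x => exists_congr fun y => ?_
  have h1 : (s ∘ f) x = (s ∘ f) y ↔ f x = f y :=
    ⟨hs _ (hfa x) _ (hfa y), fun h => congrArg s h⟩
  have h2 : omegaLE (!b) ((s ∘ f) x) ((s ∘ f) y) ↔ omegaLE b (f x) (f y) :=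
    omegaLE_sub b (hN _ (hfa x)) (hN _ (hfa y))
  rw [Ne, h1, h2]

theorem locallyEmbeds_omega (b b' : Bool) :
    LocallyEmbeds FirstOrder.Language.order (Omega b) (Omega b') := by
  rcases eq_or_ne b' b with rfl | h
  · exact locallyEmbeds_refl
  · obtain rfl : b' = !b := by cases b <;> cases b' <;> simp_all
    exact locallyEmbeds_omega_not b

theorem locallyEmbeds_omegaCopy (b b' : Bool) :
    LocallyEmbeds FirstOrder.Language.order (omegaCopy b).dom (omegaCopy b').dom :=
  (locallyEmbeds_omega b b').congr (iso_omegaCopy b).symm.some (iso_omegaCopy b').symm.some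

/-- In `Omega b`, some element is below all others in the sense of `natLE b`; in the reverse
order, none is. -/
theorem sigma2Th_omega (b : Bool) : (sigma2Th FirstOrder.Language.order (Omega b) \
    sigma2Th FirstOrder.Language.order (Omega !b)).Nonempty := by
  obtain ⟨i, hi⟩ := exists_index (p := fun n => n = Nat.pair 1 (natLECode b 0 1))
    (PrimrecPred.computablePred (Primrec.eq.comp .id (.const _))).to_re
  obtain ⟨e, he⟩ := exists_index (p := fun n => n = Nat.pair 1 i)
    (PrimrecPred.computablePred (Primrec.eq.comp .id (.const _))).to_re
  have key (b' : Bool) (x : Fin 1 → Omega b') :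
      RealizePi1 FirstOrder.Language.order (Omega b') i x ↔
        ∀ y : Omega b', omegaLE (b == b') (x 0) y := by
    have hr : ∀ y : Fin 1 → Omega b', (natLE b (0 : Fin 2) 1).Realize (Fin.append x y) ↔
        omegaLE (b == b') (x 0) (y 0) := by
      intro y
      cases b <;> cases b' <;> exact Iff.rfl
    constructor
    · intro h y
      refine (hr fun _ => y).1 (h 1 (natLE b (0 : Fin 2) 1) ?_ ?_ _)
      · cases b
        · exact (BoundedFormula.IsAtomic.rel _ _).isQF
        · exact (BoundedFormula.IsAtomic.rel _ _).isQF
      · rw [hi, formulaCode_natLE]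
        rfl
    · -- The only conjunct is the one coded by `i`, as formulas with the same code are equal.
      intro h k θ _ hθ y
      rw [hi, Nat.pair_eq_pair] at hθ
      obtain ⟨rfl, hθ⟩ := hθ
      obtain rfl : θ = natLE b (0 : Fin 2) 1 := formulaCode_injective Fin.val_injective (by
        rw [hθ, formulaCode_natLE]
        rfl)
      exact (hr y).2 (h _)
  refine ⟨e, ⟨1, i, (he _).2 rfl, fun _ => (omegaEquiv b 0), (key b _).2 fun y => ?_⟩, ?_⟩
  · rw [beq_self_eq_true]
    exact Nat.zero_le y
  · rintro ⟨m, i', hm, x, hx⟩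
    rw [he, Nat.pair_eq_pair] at hm
    obtain ⟨rfl, rfl⟩ := hm
    have h := (key _ x).1 hx (Nat.succ (x 0))
    rw [show (b == !b) = false by cases b <;> rfl] at h
    exact absurd h (Nat.not_succ_le_self (x 0))

theorem not_iso_omega (b : Bool) : ¬ Iso FirstOrder.Language.order (Omega b) (Omega !b) :=
  fun ⟨e⟩ => by
    obtain ⟨k, h, h'⟩ := sigma2Th_omega b
    exact h' (realizeSigma2_of_iso ⟨e⟩ h)

theorem pairClass_congr {L : FirstOrder.Language.{u, v}} {M N M' N' : Type*} [L.Structure M]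
    [L.Structure N] [L.Structure M'] [L.Structure N'] (h : Iso L M M') (h' : Iso L N N') :
    pairClass L M N = pairClass L M' N' := by
  ext S
  exact or_congr ⟨fun k => k.trans h, fun k => k.trans h.symm⟩
    ⟨fun k => k.trans h', fun k => k.trans h'.symm⟩

theorem omegaPair_eq :
    omegaPair = pairClass FirstOrder.Language.order (Omega true) (Omega false) := by
  let _ : FirstOrder.Language.order.Structure ℕ := FirstOrder.Language.orderStructure _
  let _ : FirstOrder.Language.order.Structure ℕᵒᵈ := FirstOrder.Language.orderStructure _
  refine pairClass_congr ⟨⟨Equiv.refl ℕ, fun f => Empty.elim f, fun R x => ?_⟩⟩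
    ⟨⟨(OrderDual.ofDual : ℕᵒᵈ ≃ ℕ), fun f => Empty.elim f, fun R x => ?_⟩⟩
  · cases R; exact Iff.rfl
  · cases R; exact Iff.rfl

section

variable {T : NatStructure FirstOrder.Language.order} {b : Bool}

/-- The diagram of a copy of `Omega b` mentions an element `x` without ever revealing some `y` that
refutes `natLE b x y`. -/
theorem exists_forall_of_iso (h : Iso FirstOrder.Language.order T.dom (Omega b)) :
    ∃ x, eqCode x x ∈ T.diagram ∧ ∀ y, negCode (natLECode b x y) ∉ T.diagram := by
  obtain ⟨e⟩ := h
  refine ⟨e.symm (omegaEquiv b 0), eqCode_mem_diagram_iff.2 (e.symm (omegaEquiv b 0)).2,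
    fun y hy => ?_⟩
  change _ ∈ bdiag _ Subtype.val (id : T.dom → T.dom) at hy
  rw [← bdiag_equiv e, negCode_natLECode_mem_bdiag_iff] at hy
  obtain ⟨p, q, hp, -, h⟩ := hy
  obtain rfl := Subtype.ext hp
  rw [beq_self_eq_true] at h
  refine h ?_
  change omegaLE true (e (e.symm (omegaEquiv b 0))) (e q)
  rw [FirstOrder.Language.Equiv.apply_symm_apply]
  exact Nat.zero_le _

/-- The diagram of a copy of the reverse of `Omega b` reveals, for every element `x` mentioned, some
`y` that refutes `natLE b x y`. -/
theorem forall_exists_of_iso (h : Iso FirstOrder.Language.order T.dom (Omega !b)) {x : ℕ}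
    (hx : eqCode x x ∈ T.diagram) : ∃ y, negCode (natLECode b x y) ∈ T.diagram := by
  obtain ⟨e⟩ := h
  rw [eqCode_mem_diagram_iff] at hx
  refine ⟨e.symm (omegaEquiv (!b) (Nat.succ (e ⟨x, hx⟩))), ?_⟩
  change _ ∈ bdiag _ Subtype.val (id : T.dom → T.dom)
  rw [← bdiag_equiv e, negCode_natLECode_mem_bdiag_iff]
  refine ⟨⟨x, hx⟩, _, rfl, rfl, ?_⟩
  rw [show (b == !b) = false by cases b <;> rfl]
  intro h
  change omegaLE false (e ⟨x, hx⟩) (e (e.symm _)) at h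
  rw [FirstOrder.Language.Equiv.apply_symm_apply] at h
  exact absurd h (Nat.not_succ_le_self _)

end

end TC

/-! ### Reductions between pairs of structures that can be told apart in the limit -/

namespace TC

open FirstOrder FirstOrder.Language

section

variable {L : FirstOrder.Language.{u, v}} [ComputableLanguage L]
  {A : Type w} {B : Type w'} [L.Structure A] [L.Structure B]

theorem tcReducible_omegaPair (hAB : ¬ Iso L A B)
    (h₀ : (sigma2Th L A \ sigma2Th L B).Nonempty) (h₁ : (sigma2Th L B \ sigma2Th L A).Nonempty) :
    TCReducible (pairClass L A B) omegaPair := by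
  obtain ⟨mode, hmode, hA, hB⟩ := exists_computable_guess h₀ h₁
  rw [omegaPair_eq, ← pairClass_congr (iso_omegaCopy true) (iso_omegaCopy false)]
  exact tcReducible_of_guesses hAB hmode hA hB computablePred_diagram_omegaCopy
    locallyEmbeds_omegaCopy fun h =>
      not_iso_omega true ((iso_omegaCopy true).symm.trans (h.trans (iso_omegaCopy false)))

theorem omegaPair_tcReducible [Infinite A] [Infinite B] (hAB : ¬ Iso L A B)
    (hA : ComputablyPresentable L A) (hB : ComputablyPresentable L B) (h : SameExistential L A B) :
    TCReducible omegaPair (pairClass L A B) := by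
  obtain ⟨S, hS, cS⟩ := hA
  obtain ⟨T, hT, cT⟩ := hB
  let P : Bool → NatStructure L := fun b => cond b S T
  have : ∀ b, Infinite (P b).dom := by
    rintro (_ | _)
    · exact hT.some.toEquiv.infinite_iff.2 inferInstance
    · exact hS.some.toEquiv.infinite_iff.2 inferInstance
  obtain ⟨mode, hmode, hm, hm'⟩ := exists_computable_guess (sigma2Th_omega true)
    (sigma2Th_omega false)
  rw [omegaPair_eq, ← pairClass_congr hS hT]
  refine tcReducible_of_guesses (P := P) (not_iso_omega true) hmode hm hm' ?_ ?_
    fun k => hAB (hS.symm.trans (k.trans hT))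
  · rintro (_ | _)
    · exact cT
    · exact cS
  · rintro (_ | _) (_ | _)
    · exact locallyEmbeds_refl
    · exact h.symm.locallyEmbeds.congr hT.symm.some hS.symm.some
    · exact h.locallyEmbeds.congr hS.symm.some hT.symm.some
    · exact locallyEmbeds_refl

end

end TC

/-! ### Structures computed by an operator from copies of a structure -/

namespace TC

open FirstOrder FirstOrder.Language

theorem iso_copy {L : FirstOrder.Language.{u, v}} {M : Type*} [L.Structure M] (f : ℕ ≃ M) :
    Iso L (copy (L := L) f).dom M := ⟨copyEquiv f⟩

theorem nonempty_equiv_nat (M : Type*) [Countable M] [Infinite M] : Nonempty (ℕ ≃ M) := by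
  obtain ⟨_⟩ := nonempty_denumerable M
  exact ⟨(Denumerable.eqv M).symm⟩

section

variable (Φ : TuringOperator)

/-- Some initial segment of `τ` suffices for the operator to halt with output `1` on input `c`.
Unlike the condition `1 ∈ Φ.onString τ c`, this is monotone in `τ`. -/
def TuringOperator.Accepts (τ : List Bool) (c : ℕ) : Prop := ∃ m, 1 ∈ Φ.onString (τ.take m) c

variable {Φ}

theorem TuringOperator.Accepts.mono {σ τ : List Bool} {c : ℕ} (h : Φ.Accepts σ c)
    (hστ : σ <+: τ) : Φ.Accepts τ c := by
  obtain ⟨m, hm⟩ := h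
  obtain ⟨ρ, rfl⟩ := hστ
  refine ⟨(σ.take m).length, ?_⟩
  rwa [List.take_append_of_le_length (List.length_take_le' _ _), List.length_take,
    ← List.take_take, List.take_length]

theorem TuringOperator.Computes.unique {X : Set ℕ} {x y z : ℕ} (hy : Φ.Computes X x y)
    (hz : Φ.Computes X x z) : y = z := by
  obtain ⟨m, hm⟩ := hy
  obtain ⟨n, hn⟩ := hz
  rcases le_total m n with h | h
  · exact Φ.consistent _ _ _ _ _ (initialSegment_prefix h) hm hn
  · exact (Φ.consistent _ _ _ _ _ (initialSegment_prefix h) hn hm).symm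

theorem TuringOperator.Maps.mem_iff {X Y : Set ℕ} (h : Φ.Maps X Y) {c : ℕ} :
    c ∈ Y ↔ Φ.Computes X c 1 := by
  constructor
  · intro hc
    have := h c
    rwa [if_pos hc] at this
  · intro h1
    by_contra hc
    have := h c
    rw [if_neg hc] at this
    exact zero_ne_one (this.unique h1)

theorem TuringOperator.Maps.notMem_iff {X Y : Set ℕ} (h : Φ.Maps X Y) {c : ℕ} :
    c ∉ Y ↔ Φ.Computes X c 0 := by
  constructor
  · intro hc
    have := h c
    rwa [if_neg hc] at this
  · intro h0 hc
    have := h c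
    rw [if_pos hc] at this
    exact zero_ne_one (h0.unique this)

theorem TuringOperator.Maps.mem_iff_exists_accepts {X Y : Set ℕ} (h : Φ.Maps X Y) {c : ℕ} :
    c ∈ Y ↔ ∃ m, Φ.Accepts (initialSegment X m) c := by
  rw [h.mem_iff]
  constructor
  · rintro ⟨m, hm⟩
    exact ⟨m, m, by rwa [take_initialSegment le_rfl]⟩
  · rintro ⟨m, k, hk⟩
    rcases le_total k m with hkm | hkm
    · exact ⟨k, by rwa [take_initialSegment hkm] at hk⟩
    · refine ⟨m, ?_⟩
      rwa [List.take_of_length_le ((length_initialSegment X m).trans_le hkm)] at hk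

theorem TuringOperator.Maps.computablePred {X Y : Set ℕ} (h : Φ.Maps X Y)
    (hX : ComputablePred fun n => n ∈ X) : ComputablePred fun n => n ∈ Y :=
  ComputablePred.computable_iff_re_compl_re'.2
    ⟨(Φ.rePred_computes hX 1).of_eq fun _ => h.mem_iff.symm,
      (Φ.rePred_computes hX 0).of_eq fun _ => h.notMem_iff.symm⟩

variable (Φ)

theorem TuringOperator.rePred_accepts :
    REPred fun q : List Bool × ℕ => Φ.Accepts q.1 q.2 :=
  rePred_exists (p := fun (q : List Bool × ℕ) m => 1 ∈ Φ.onString (q.1.take m) q.2)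
    (rePred_comp (Φ.rePred_mem 1) ((Primrec.list_take.comp .snd (Primrec.fst.comp .fst)).pair
      (Primrec.snd.comp .fst)).to_comp)

end

section

variable {L₀ : FirstOrder.Language.{u, v}} {L₁ : FirstOrder.Language.{u', v'}}
  [ComputableLanguage L₀] [ComputableLanguage L₁]

/-- The operator maps every copy of `M` to a copy of `N`. -/
def TuringOperator.MapsCopies (Φ : TuringOperator) (L₀ : FirstOrder.Language.{u, v})
    (L₁ : FirstOrder.Language.{u', v'}) [ComputableLanguage L₀] [ComputableLanguage L₁]
    (M : Type*) (N : Type*) [L₀.Structure M] [L₁.Structure N] : Prop :=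
  ∀ S : NatStructure L₀, Iso L₀ S.dom M →
    ∃ T : NatStructure L₁, Iso L₁ T.dom N ∧ Φ.Maps S.diagram T.diagram

/-- A reduction between two pairs of structures matches the isomorphism types of the pairs. -/
theorem TCReducible.exists_mapsCopies {A B C D : Type*} [L₀.Structure A] [L₀.Structure B]
    [L₁.Structure C] [L₁.Structure D] [Countable A] [Infinite A] [Countable B] [Infinite B]
    (h : TCReducible (pairClass L₀ A B) (pairClass L₁ C D)) (hAB : ¬ Iso L₀ A B) :
    ∃ Φ : TuringOperator, (Φ.MapsCopies L₀ L₁ A C ∧ Φ.MapsCopies L₀ L₁ B D) ∨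
      (Φ.MapsCopies L₀ L₁ A D ∧ Φ.MapsCopies L₀ L₁ B C) := by
  obtain ⟨Φ, F, hF, hi⟩ := h
  obtain ⟨f⟩ := nonempty_equiv_nat A
  obtain ⟨g⟩ := nonempty_equiv_nat B
  let S : NatStructure L₀ := copy f
  let T : NatStructure L₀ := copy g
  have hS : Iso L₀ S.dom A := iso_copy f
  have hT : Iso L₀ T.dom B := iso_copy g
  have hST : ¬ Iso L₁ (F S).dom (F T).dom := fun h =>
    hAB (hS.symm.trans (((hi S (.inl hS) T (.inr hT)).2 h).trans hT))
  have hA : ∀ S', Iso L₀ S'.dom A → Iso L₁ (F S').dom (F S).dom ∧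
      Φ.Maps S'.diagram (F S').diagram :=
    fun S' hS' => ⟨(hi S' (.inl hS') S (.inl hS)).1 (hS'.trans hS.symm), (hF S' (.inl hS')).2⟩
  have hB : ∀ S', Iso L₀ S'.dom B → Iso L₁ (F S').dom (F T).dom ∧
      Φ.Maps S'.diagram (F S').diagram :=
    fun S' hS' => ⟨(hi S' (.inr hS') T (.inr hT)).1 (hS'.trans hT.symm), (hF S' (.inr hS')).2⟩
  refine ⟨Φ, ?_⟩
  rcases (hF S (.inl hS)).1 with h | h <;> rcases (hF T (.inr hT)).1 with h' | h'
  · exact absurd (h.trans h'.symm) hST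
  · exact .inl ⟨fun S' hS' => ⟨F S', (hA S' hS').1.trans h, (hA S' hS').2⟩,
      fun S' hS' => ⟨F S', (hB S' hS').1.trans h', (hB S' hS').2⟩⟩
  · exact .inr ⟨fun S' hS' => ⟨F S', (hA S' hS').1.trans h, (hA S' hS').2⟩,
      fun S' hS' => ⟨F S', (hB S' hS').1.trans h', (hB S' hS').2⟩⟩
  · exact absurd (h.trans h'.symm) hST

theorem TuringOperator.MapsCopies.computablyPresentable {Φ : TuringOperator} {b : Bool}
    {A : Type*} [L₁.Structure A] (h : Φ.MapsCopies FirstOrder.Language.order L₁ (Omega b) A) :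
    ComputablyPresentable L₁ A := by
  obtain ⟨T, hT, hm⟩ := h _ (iso_omegaCopy b)
  exact ⟨T, hT, hm.computablePred (computablePred_diagram_omegaCopy b)⟩

end

/-! ### Existential sentences and finite parts of the atomic diagram -/

section

variable {L : FirstOrder.Language.{u, v}}

/-- A finite list of basic facts about named elements decides a quantifier-free formula. -/
theorem exists_basic_of_isQF {D : Type w} {N : Type w'} [L.Structure D] [L.Structure N]
    {α : Type u'} {n : ℕ} {φ : L.BoundedFormula α n} (h : φ.IsQF) (v : α → D) (xs : Fin n → D) :
    ∃ F : List (L.Formula D), (∀ ψ ∈ F, IsBasic ψ ∧ ψ.Realize (id : D → D)) ∧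
      ∀ g : D → N, (∀ ψ ∈ F, ψ.Realize g) → (φ.Realize (g ∘ v) (g ∘ xs) ↔ φ.Realize v xs) := by
  have atomic : ∀ (φ : L.BoundedFormula α n) (ψ : L.Formula D), BoundedFormula.IsAtomic ψ →
      (ψ.Realize (id : D → D) ↔ φ.Realize v xs) →
      (∀ g : D → N, ψ.Realize g ↔ φ.Realize (g ∘ v) (g ∘ xs)) →
      ∃ F : List (L.Formula D), (∀ ψ ∈ F, IsBasic ψ ∧ ψ.Realize (id : D → D)) ∧
        ∀ g : D → N, (∀ ψ ∈ F, ψ.Realize g) → (φ.Realize (g ∘ v) (g ∘ xs) ↔ φ.Realize v xs) := by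
    intro φ ψ hψ hD hN
    by_cases hv : ψ.Realize (id : D → D)
    · refine ⟨[ψ], by simpa using ⟨.inl hψ, hv⟩, fun g hg => ?_⟩
      exact iff_of_true ((hN g).1 (hg ψ (by simp))) ((hD).1 hv)
    · refine ⟨[ψ.not], by simpa using ⟨.inr ⟨ψ, hψ, rfl⟩, hv⟩, fun g hg => ?_⟩
      exact iff_of_false (fun h' => (hg ψ.not (by simp)) ((hN g).2 h'))
        fun h' => hv ((hD).2 h')
  let σ : α ⊕ Fin n → D ⊕ Fin 0 := Sum.inl ∘ Sum.elim v xs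
  have hσD : (Sum.elim id (default : Fin 0 → D)) ∘ σ = Sum.elim v xs := by
    funext i
    rcases i with i | i <;> rfl
  have hσN (g : D → N) : (Sum.elim g (default : Fin 0 → N)) ∘ σ = Sum.elim (g ∘ v) (g ∘ xs) := by
    funext i
    rcases i with i | i <;> rfl
  induction h with
  | falsum => exact ⟨[], by simp, fun g _ => Iff.rfl⟩
  | of_isAtomic h =>
    cases h with
    | equal t s =>
      refine atomic _ ((t.relabel σ).bdEqual (s.relabel σ)) (.equal _ _) ?_ fun g => ?_
      · simp only [Formula.Realize, BoundedFormula.realize_bdEqual, Term.realize_relabel, hσD]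
      · simp only [Formula.Realize, BoundedFormula.realize_bdEqual, Term.realize_relabel, hσN]
    | rel R ts =>
      refine atomic _ (R.boundedFormula fun i => (ts i).relabel σ) (.rel _ _) ?_ fun g => ?_
      · simp only [Formula.Realize, BoundedFormula.realize_rel, Term.realize_relabel, hσD]
      · simp only [Formula.Realize, BoundedFormula.realize_rel, Term.realize_relabel, hσN]
  | imp _ _ ih₁ ih₂ =>
    obtain ⟨F, hF, h⟩ := ih₁
    obtain ⟨F', hF', h'⟩ := ih₂
    refine ⟨F ++ F', List.forall_mem_append.2 ⟨hF, hF'⟩, fun g hg => ?_⟩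
    rw [List.forall_mem_append] at hg
    rw [BoundedFormula.realize_imp, BoundedFormula.realize_imp, h g hg.1, h' g hg.2]

/-- The truth of an existential formula is due to finitely many basic facts about named elements. -/
theorem exists_basic_of_isExistential {D : Type w} {N : Type w'} [L.Structure D] [L.Structure N]
    {α : Type u'} {n : ℕ} {φ : L.BoundedFormula α n} (h : φ.IsExistential) (v : α → D)
    (xs : Fin n → D)     (hr : φ.Realize v xs) :
    ∃ F : List (L.Formula D), (∀ ψ ∈ F, IsBasic ψ ∧ ψ.Realize (id : D → D)) ∧
      ∀ g : D → N, (∀ ψ ∈ F, ψ.Realize g) → φ.Realize (g ∘ v) (g ∘ xs) := by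
  induction h with
  | of_isQF h =>
    obtain ⟨F, hF, h⟩ := exists_basic_of_isQF (N := N) h v xs
    exact ⟨F, hF, fun g hg => (h g hg).2 hr⟩
  | ex _ ih =>
    obtain ⟨a, ha⟩ := BoundedFormula.realize_ex.1 hr
    obtain ⟨F, hF, h⟩ := ih _ ha
    refine ⟨F, hF, fun g hg => BoundedFormula.realize_ex.2 ⟨g a, ?_⟩⟩
    have := h g hg
    rwa [Fin.comp_snoc] at this

end

section

variable {L₀ : FirstOrder.Language.{u, v}} {L₁ : FirstOrder.Language.{u', v'}}
  [ComputableLanguage L₀] [ComputableLanguage L₁]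

/-- An operator uses only finitely much of its oracle to reveal the truth of an existential
sentence, and every finite part of a copy of `M` is also part of a copy of `N`. -/
theorem TuringOperator.MapsCopies.realize_of_isExistential {Φ : TuringOperator} {M N A B : Type*}
    [L₀.Structure M] [L₀.Structure N] [L₁.Structure A] [L₁.Structure B] [Countable M] [Infinite M]
    [Countable N] [Infinite N] [Infinite B] (hM : Φ.MapsCopies L₀ L₁ M A)
    (hN : Φ.MapsCopies L₀ L₁ N B) (hMN : LocallyEmbeds L₀ M N) {φ : L₁.Sentence}
    (hφ : BoundedFormula.IsExistential φ) (hA : A ⊨ φ) : B ⊨ φ := by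
  classical
  obtain ⟨f⟩ := nonempty_equiv_nat M
  obtain ⟨T, ⟨i⟩, hT⟩ := hM _ (iso_copy f)
  rw [diagram_copy] at hT
  have hrT : T.dom ⊨ φ := (StrongHomClass.realize_sentence i φ).2 hA
  -- Transfer a finite part of the oracle to a copy of `N`.
  have key : ∀ m, ∃ f' : ℕ ≃ N,
      initialSegment (bdiag L₀ id f') m = initialSegment (bdiag L₀ id f) m := by
    intro m
    let a : List M := List.ofFn fun i : Fin m => f i
    have ha : a.Nodup := List.nodup_ofFn.2 (f.injective.comp Fin.val_injective)
    obtain ⟨b, hb, hab⟩ := hMN a ha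
    obtain ⟨f', hf'⟩ := exists_equiv_extends b hb
    have hl : b.length = a.length := by rw [← length_bits (L := L₀), hab, length_bits]
    have hm : a.length = m := List.length_ofFn
    refine ⟨f', ?_⟩
    rw [bits_eq_initialSegment hf', bits_eq_initialSegment (f := f) (fun i hi => by simp [a]), hl,
      hm] at hab
    exact hab
  -- A copy of `B` whose diagram contains a given finite part of the diagram of `T`.
  have key' : ∀ l : List ℕ, (∀ c ∈ l, c ∈ T.diagram) →
      ∃ T' : NatStructure L₁, Iso L₁ T'.dom B ∧ ∀ c ∈ l, c ∈ T'.diagram := by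
    intro l hl
    obtain ⟨m, hm⟩ : ∃ m, ∀ c ∈ l, Φ.Accepts (initialSegment (bdiag L₀ id f) m) c := by
      induction l with
      | nil => exact ⟨0, by simp⟩
      | cons c l ih =>
        obtain ⟨m, hm⟩ := ih fun c' hc' => hl c' (List.mem_cons_of_mem _ hc')
        obtain ⟨m', hm'⟩ := hT.mem_iff_exists_accepts.1 (hl c List.mem_cons_self)
        exact ⟨max m m', List.forall_mem_cons.2
          ⟨hm'.mono (initialSegment_prefix (le_max_right _ _)), fun c' hc' =>
            (hm c' hc').mono (initialSegment_prefix (le_max_left _ _))⟩⟩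
    obtain ⟨f', hf'⟩ := key m
    obtain ⟨T', hi', hT'⟩ := hN _ (iso_copy f')
    rw [diagram_copy] at hT'
    exact ⟨T', hi', fun c hc => hT'.mem_iff_exists_accepts.2 ⟨m, hf' ▸ hm c hc⟩⟩
  obtain ⟨F, hF, hFB⟩ := exists_basic_of_isExistential (N := B) hφ default default hrT
  obtain ⟨T', ⟨j⟩, hT'⟩ := key' (F.map (formulaCode Subtype.val)) fun c hc => by
    obtain ⟨ψ, hψ, rfl⟩ := List.mem_map.1 hc
    exact ⟨ψ, (hF ψ hψ).1, (hF ψ hψ).2, rfl⟩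
  let k : ℕ → B := fun x => if h : x ∈ T'.dom then j ⟨x, h⟩ else Classical.arbitrary B
  have hk : k ∘ (Subtype.val : T'.dom → ℕ) = j := funext fun x => dif_pos x.2
  have := hFB (k ∘ Subtype.val) fun ψ hψ => by
    refine realize_comp_of_mem_bdiag (d := (Subtype.val : T'.dom → ℕ)) k ?_
    rw [hk, ← Function.comp_id j, bdiag_equiv]
    exact hT' _ (List.mem_map_of_mem hψ)
  rwa [Subsingleton.elim (_ ∘ _) default, Subsingleton.elim (_ ∘ _) default] at this

end

end TC

/-! ### Pulling a `Σ₂` property back along an operator -/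

namespace TC

open FirstOrder FirstOrder.Language

section

theorem rePred_eq {α β : Type*} [Primcodable α] [Primcodable β] [DecidableEq β] {f g : α → β}
    (hf : Computable f) (hg : Computable g) : REPred fun a => f a = g a :=
  ComputablePred.to_re ⟨fun _ => inferInstance, Primrec.eq.decide.to_comp.comp hf hg⟩

theorem rePred_prefix {α : Type*} [Primcodable α] {f g : α → List Bool} (hf : Computable f)
    (hg : Computable g) : REPred fun a => f a <+: g a :=
  (rePred_eq hf (Primrec.list_take.to_comp.comp (Primrec.list_length.to_comp.comp hf) hg)).of_eq
    fun _ => List.prefix_iff_eq_take.symm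

variable (L : FirstOrder.Language.{u, v}) [ComputableLanguage L]

/-- The number `n` is the code of an atomic formula. -/
def IsAtomicCode (n : ℕ) : Prop :=
  ∃ φ : L.Formula ℕ, BoundedFormula.IsAtomic φ ∧ formulaCode id φ = n

variable {L}

theorem isBasicCode_iff_isAtomicCode {n : ℕ} : IsBasicCode L n ↔
    IsAtomicCode L n ∨ (n = negCode n.unpair.2.unpair.1 ∧ IsAtomicCode L n.unpair.2.unpair.1) := by
  constructor
  · rintro ⟨φ, h | ⟨ψ, h, rfl⟩, rfl⟩
    · exact .inl ⟨φ, h, rfl⟩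
    · refine .inr ?_
      rw [formulaCode_not]
      simp only [negCode, Nat.unpair_pair]
      exact ⟨trivial, ψ, h, rfl⟩
  · rintro (⟨φ, h, rfl⟩ | ⟨h', φ, h, hc⟩)
    · exact ⟨φ, .inl h, rfl⟩
    · exact ⟨φ.not, .inr ⟨φ, h, rfl⟩, by rw [formulaCode_not, hc, ← h']⟩

/-- A tuple of `n + 1` parameters interprets all variables of an atomic formula with code `n`. -/
theorem isAtomicCode_iff {M : Type w} [L.Structure M] {n : ℕ} (r : Fin (n + 1) → M) :
    IsAtomicCode L n ↔ n ≠ negCode n.unpair.2.unpair.1 ∧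
      (n ∈ bdiag L Fin.val r ∨ negCode n ∈ bdiag L Fin.val r) := by
  constructor
  · rintro ⟨φ, h, rfl⟩
    refine ⟨formulaCode_ne_negCode _ h _, ?_⟩
    obtain ⟨φ', h', hφ⟩ := exists_isAtomic_ren
      (p := (Fin.val : Fin (formulaCode id φ + 1) → ℕ)) h
        fun b hb => ⟨⟨b, Nat.lt_succ_of_le hb⟩, rfl⟩
    have hc : formulaCode Fin.val φ' = formulaCode id φ := by
      conv_rhs => rw [← hφ, formulaCode_ren]
      rfl
    by_cases hr : Formula.Realize φ' r
    · exact .inl (mem_bdiag_iff.2 ⟨φ', h', .inl ⟨hr, hc⟩⟩)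
    · exact .inr (mem_bdiag_iff.2 ⟨φ', h', .inr ⟨hr, by rw [hc]⟩⟩)
  · rintro ⟨hn, h⟩
    have key : ∃ φ' : L.Formula (Fin (n + 1)), BoundedFormula.IsAtomic φ' ∧
        formulaCode Fin.val φ' = n := by
      rcases h with h | h <;> obtain ⟨ψ, hψ, ⟨-, hc⟩ | ⟨-, hc⟩⟩ := mem_bdiag_iff.1 h
      · exact ⟨ψ, hψ, hc⟩
      · refine absurd ?_ hn
        rw [← hc]
        simp [negCode]
      · exact absurd hc (formulaCode_ne_negCode _ hψ _)
      · exact ⟨ψ, hψ, negCode_injective hc⟩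
    obtain ⟨φ', h', hc⟩ := key
    exact ⟨ren Fin.val φ', isAtomic_ren _ h', by rw [formulaCode_ren]; exact hc⟩

/-- If some structure has a computable copy, then the codes of basic formulas can be recognised:
ask whether the formula or its negation is true in the copy. -/
theorem ComputablyPresentable.exists_computable_isBasicCode {M : Type w} [L.Structure M]
    [Nonempty M] (h : ComputablyPresentable L M) :
    ∃ wf : ℕ → Bool, Computable wf ∧ ∀ n, wf n = true ↔ IsBasicCode L n := by
  classical
  obtain ⟨S, ⟨i⟩, hS⟩ := h
  let a : S.dom := i.symm (Classical.arbitrary M)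
  let p : ℕ → ℕ := fun n => n.unpair.2.unpair.1
  let isAt : ℕ → Bool := fun n => !(decide (n = negCode (p n))) &&
    (decide (fsub (List.replicate (n + 1) (a : ℕ)) n ∈ S.diagram) ||
      decide (fsub (List.replicate (n + 1) (a : ℕ)) (negCode n) ∈ S.diagram))
  have hp : Primrec p := Primrec.fst.comp (Primrec.unpair.comp (Primrec.snd.comp Primrec.unpair))
  have hr : Primrec fun n : ℕ => List.replicate (n + 1) (a : ℕ) :=
    (Primrec.list_map (Primrec.list_range.comp .succ) (.const (a : ℕ))).of_eq fun n => by simp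
  have hat : Computable isAt := Primrec.and.to_comp.comp
    (Primrec.not.comp (Primrec.eq.decide.comp .id (primrec_negCode.comp hp))).to_comp
    (Primrec.or.to_comp.comp (hS.decide.comp (primrec_fsub.comp hr .id).to_comp)
      (hS.decide.comp (primrec_fsub.comp hr primrec_negCode).to_comp))
  have hisAt (n : ℕ) : isAt n = true ↔ IsAtomicCode L n := by
    rw [isAtomicCode_iff (fun _ : Fin (n + 1) => a), ← fsub_mem_diagram_iff, ← fsub_mem_diagram_iff,
      List.ofFn_const]
    simp [isAt, p]
  refine ⟨fun n => isAt n || (decide (n = negCode (p n)) && isAt (p n)), ?_, fun n => ?_⟩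
  · exact Primrec.or.to_comp.comp hat (Primrec.and.to_comp.comp
      (Primrec.eq.decide.comp .id (primrec_negCode.comp hp)).to_comp (hat.comp hp.to_comp))
  · rw [isBasicCode_iff_isAtomicCode]
    simp only [Bool.or_eq_true, Bool.and_eq_true, decide_eq_true_eq, hisAt, p]

variable {M : Type w} {N : Type w'} [L.Structure M] [L.Structure N]

/-- A generic enumeration of `M` meets `Q x` whenever it meets `P x`, unless some tuple with bits in
`P x` has no extension with bits in `Q x`. Hence there is such a tuple if every enumeration meets
some `P x` without meeting `Q x`. -/
theorem exists_tuple_of_equiv [Countable M] [Infinite M] {P Q : ℕ → List Bool → Prop}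
    (hP : ∀ x σ τ, σ <+: τ → P x σ → P x τ) (hQ : ∀ x σ τ, σ <+: τ → Q x σ → Q x τ)
    (hM : ∀ f : ℕ ≃ M, ∃ x, (∃ m, P x (initialSegment (bdiag L id f) m)) ∧
      ∀ m, ¬ Q x (initialSegment (bdiag L id f) m)) :
    ∃ (x : ℕ) (l : List M), l.Nodup ∧ P x (bits L l) ∧
      ∀ d : List M, l <+: d → d.Nodup → ¬ Q x (bits L d) := by
  classical
  by_contra! hno
  let ext : ℕ → List M → List M := fun s l =>
    if h : ∃ d, l <+: d ∧ d.Nodup ∧ Q s.unpair.1 (bits L d) then h.choose else l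
  obtain ⟨f, l, -, hf, hl, hel, hnd, hlen⟩ := exists_equiv_of_steps [] List.nodup_nil ext
    fun s l hnd => by
      by_cases h : ∃ d, l <+: d ∧ d.Nodup ∧ Q s.unpair.1 (bits L d)
      · simp only [ext, dif_pos h]
        exact ⟨h.choose_spec.1, h.choose_spec.2.1⟩
      · simp only [ext, dif_neg h]
        exact ⟨List.prefix_rfl, hnd⟩
  obtain ⟨x, ⟨m, hm⟩, hx⟩ := hM f
  -- The requirement for `x` is treated at the stages `Nat.pair x s₀`, one of which comes after
  -- `P x` has been met.
  obtain ⟨s₀, hs₀⟩ := hlen m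
  have hmono : ∀ {s t}, s ≤ t → l s <+: l t := fun h => by
    induction h with
    | refl => exact List.prefix_rfl
    | step _ ih => exact ih.trans (hl _)
  let s := Nat.pair x s₀
  have hs : m ≤ (l s).length := hs₀.trans (hmono (Nat.right_le_pair x s₀)).length_le
  have hPs : P x (bits L (l s)) := by
    rw [bits_eq_initialSegment (hf s)]
    exact hP _ _ _ (initialSegment_prefix hs) hm
  obtain ⟨d, hd, hdn, hdQ⟩ := hno x (l s) (hnd s) hPs
  have hex : ∃ d, l s <+: d ∧ d.Nodup ∧ Q s.unpair.1 (bits L d) :=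
    ⟨d, hd, hdn, by rwa [Nat.unpair_pair]⟩
  have hQs : Q x (bits L (ext s (l s))) := by
    simp only [ext, dif_pos hex]
    have hux : s.unpair.1 = x := by simp [s]
    exact hux ▸ hex.choose_spec.2.2
  have := hQ _ _ _ (bits_prefix (hel s)) hQs
  rw [bits_eq_initialSegment (hf (s + 1)) ] at this
  exact hx _ this

/-- Indices of the computable `Σ₂` sentence saying that, for some `x` and some `σ` with `P x σ`,
there is an injective tuple with bits `σ` that has no injective extension with bits in `Q x`. The
last disjunct of the description of `W (i q)` is the conjunct stating that the tuple itself is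
injective and has bits `σ`. -/
theorem exists_indices {wf : ℕ → Bool} (hwf : Computable wf) {P Q : ℕ → List Bool → Prop}
    (hPr : REPred fun q : ℕ × List Bool => P q.1 q.2)
    (hQr : REPred fun q : ℕ × List Bool => Q q.1 q.2) :
    ∃ (i : ℕ × List Bool → ℕ) (e : ℕ), (∀ (q : ℕ × List Bool) n, n ∈ W (i q) ↔
      (∃ τ, (q.2 <+: τ ∧ n = Nat.pair (τ.length - q.2.length) (notTypeCode wf τ)) ∧ Q q.1 τ) ∨
        n = Nat.pair 0 (negCode (notTypeCode wf q.2))) ∧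
      ∀ n, n ∈ W e ↔ ∃ q : ℕ × List Bool, P q.1 q.2 ∧ n = Nat.pair q.2.length (i q) := by
  have hnt := computable_notTypeCode hwf
  have hl : Computable (List.length : List Bool → ℕ) := Primrec.list_length.to_comp
  have h1 : REPred fun q : ((ℕ × List Bool) × ℕ) × List Bool => q.1.1.2 <+: q.2 :=
    rePred_prefix (Computable.snd.comp (Computable.fst.comp .fst)) .snd
  have h2 : REPred fun q : ((ℕ × List Bool) × ℕ) × List Bool =>
      q.1.2 = Nat.pair (q.2.length - q.1.1.2.length) (notTypeCode wf q.2) := by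
    have c1 : Computable fun q : ((ℕ × List Bool) × ℕ) × List Bool =>
        q.2.length - q.1.1.2.length :=
      Primrec.nat_sub.to_comp.comp (hl.comp .snd)
        (hl.comp (Computable.snd.comp (Computable.fst.comp .fst)))
    exact rePred_eq (Computable.snd.comp .fst)
      (Primrec₂.natPair.to_comp.comp c1 (hnt.comp .snd))
  have h3 : REPred fun q : ((ℕ × List Bool) × ℕ) × List Bool => Q q.1.1.1 q.2 :=
    rePred_comp hQr (f := fun q : ((ℕ × List Bool) × ℕ) × List Bool => (q.1.1.1, q.2))
      ((Computable.fst.comp (Computable.fst.comp .fst)).pair .snd)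
  have h4 : REPred fun q : (ℕ × List Bool) × ℕ =>
      q.2 = Nat.pair 0 (negCode (notTypeCode wf q.1.2)) := by
    have c1 : Computable fun q : (ℕ × List Bool) × ℕ => negCode (notTypeCode wf q.1.2) :=
      primrec_negCode.to_comp.comp (hnt.comp (Computable.snd.comp .fst))
    exact rePred_eq .snd (Primrec₂.natPair.to_comp.comp (.const 0) c1)
  have h5 := rePred_or (rePred_exists (p := fun (q : (ℕ × List Bool) × ℕ) τ =>
    (q.1.2 <+: τ ∧ q.2 = Nat.pair (τ.length - q.1.2.length) (notTypeCode wf τ)) ∧ Q q.1.1 τ)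
    (rePred_and (rePred_and h1 h2) h3)) h4
  obtain ⟨i, hi, hiW⟩ := exists_computable_index (α := ℕ × List Bool) (p := fun q n =>
      (∃ τ, (q.2 <+: τ ∧ n = Nat.pair (τ.length - q.2.length) (notTypeCode wf τ)) ∧ Q q.1 τ) ∨
        n = Nat.pair 0 (negCode (notTypeCode wf q.2))) h5
  have h6 : REPred fun p : ℕ × ℕ × List Bool => P p.2.1 p.2.2 :=
    rePred_comp hPr (f := Prod.snd) .snd
  have h7 : REPred fun p : ℕ × ℕ × List Bool => p.1 = Nat.pair p.2.2.length (i p.2) :=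
    rePred_eq .fst (Primrec₂.natPair.to_comp.comp (hl.comp (Computable.snd.comp .snd))
      (hi.comp .snd))
  obtain ⟨e, he⟩ := exists_index (rePred_exists (p := fun n (q : ℕ × List Bool) =>
    P q.1 q.2 ∧ n = Nat.pair q.2.length (i q)) (rePred_and h6 h7))
  exact ⟨i, e, hiW, he⟩

/-- Suppose that the enumerations of `M` and of `N` are told apart by the condition that some `x`
satisfies `P x` on some initial segment of the diagram and `Q x` on none. Then the statement that
some tuple has bits in `P x` and no extension with bits in `Q x` is a computable `Σ₂` sentence that
is true in `M` and false in `N`. -/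
theorem exists_mem_sigma2Th_diff [Countable M] [Infinite M] [Countable N] [Infinite N]
    {wf : ℕ → Bool} (hwf : Computable wf) (hwf' : ∀ n, wf n = true ↔ IsBasicCode L n)
    {P Q : ℕ → List Bool → Prop} (hPr : REPred fun q : ℕ × List Bool => P q.1 q.2)
    (hQr : REPred fun q : ℕ × List Bool => Q q.1 q.2)
    (hP : ∀ x σ τ, σ <+: τ → P x σ → P x τ) (hQ : ∀ x σ τ, σ <+: τ → Q x σ → Q x τ)
    (hM : ∀ f : ℕ ≃ M, ∃ x, (∃ m, P x (initialSegment (bdiag L id f) m)) ∧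
      ∀ m, ¬ Q x (initialSegment (bdiag L id f) m))
    (hN : ∀ (f : ℕ ≃ N) x, (∃ m, P x (initialSegment (bdiag L id f) m)) →
      ∃ m, Q x (initialSegment (bdiag L id f) m)) :
    (sigma2Th L M \ sigma2Th L N).Nonempty := by
  obtain ⟨i, e, hiW, he⟩ := exists_indices hwf hPr hQr
  refine ⟨e, ?_, ?_⟩
  · obtain ⟨x, l, hl, hPl, hQl⟩ := exists_tuple_of_equiv hP hQ hM
    refine ⟨l.length, i (x, bits L l), (he _).2 ⟨(x, bits L l), hPl, by rw [length_bits]⟩, l.get,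
      fun k θ _ hθ y => ?_⟩
    rw [hiW] at hθ
    rcases hθ with ⟨τ, ⟨hτ, hc⟩, hQτ⟩ | hc
    · rw [Nat.pair_eq_pair, length_bits] at hc
      have hle := hτ.length_le
      rw [length_bits] at hle
      have hlen : τ.length = l.length + k := by omega
      obtain rfl : θ = notTypeFormula L (l.length + k) τ :=
        formulaCode_injective Fin.val_injective
          (hc.2.trans (formulaCode_notTypeFormula hwf' hlen).symm)
      rw [realize_notTypeFormula hlen]
      rintro ⟨hinj, hbits⟩
      refine hQl (List.ofFn (Fin.append l.get y)) ?_ (List.nodup_ofFn.2 hinj) ?_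
      · rw [List.ofFn_fin_append, List.ofFn_get]
        exact List.prefix_append _ _
      · rwa [bits_ofFn, hbits]
    · rw [Nat.pair_eq_pair] at hc
      obtain ⟨rfl, hc⟩ := hc
      obtain rfl : θ = (notTypeFormula L (l.length + 0) (bits L l)).not :=
        formulaCode_injective Fin.val_injective (by
          rw [hc, formulaCode_not,
            formulaCode_notTypeFormula hwf' (K := l.length + 0) (length_bits l)])
      rw [Formula.realize_not, realize_notTypeFormula (K := l.length + 0) (length_bits l), not_not]
      have hy : Fin.append l.get y = l.get := by
        funext j
        exact Fin.append_left l.get y j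
      rw [hy]
      exact ⟨List.nodup_iff_injective_get.1 hl, rfl⟩
  · rintro ⟨m, i', hm, c, hc⟩
    obtain ⟨⟨x, σ⟩, hPσ, h⟩ := (he _).1 hm
    obtain ⟨rfl, rfl⟩ := Nat.pair_eq_pair.1 h
    have h1 : Function.Injective c ∧ initialSegment (bdiag L Fin.val c) σ.length = σ := by
      have := hc 0 (notTypeFormula L (σ.length + 0) σ).not (isQF_notTypeFormula _ _).not
        ((hiW _ _).2 (.inr (by
          rw [formulaCode_not, formulaCode_notTypeFormula hwf' (K := σ.length + 0) rfl])))
        Fin.elim0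
      rw [Formula.realize_not, realize_notTypeFormula (K := σ.length + 0) rfl, not_not] at this
      have hy : Fin.append c (Fin.elim0 : Fin 0 → N) = c := by
        funext j
        exact Fin.append_left c _ j
      rwa [hy] at this
    -- Extend the tuple to an enumeration of `N`, which meets `P x` and hence `Q x`; the part that
    -- shows this refutes one of the conjuncts.
    obtain ⟨f, hf⟩ := exists_equiv_extends (List.ofFn c) (List.nodup_ofFn.2 h1.1)
    have hfc : ∀ j : Fin σ.length, f j = c j := fun j => by
      rw [hf j (by simp)]
      simp
    have hσ : initialSegment (bdiag L id f) σ.length = σ :=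
      (initialSegment_eq_iff.2 fun n hn => (mem_bdiag_fin_iff hfc hn).symm).trans h1.2
    obtain ⟨m', hm'⟩ := hN f x ⟨_, hσ.symm ▸ hPσ⟩
    let K := max m' σ.length
    have hK : σ.length + (K - σ.length) = K := Nat.add_sub_of_le (le_max_right _ _)
    let τ := initialSegment (bdiag L id f) K
    have hτ : τ.length = σ.length + (K - σ.length) := by rw [hK]; exact length_initialSegment _ _
    have hστ : σ <+: τ := by
      conv_lhs => rw [← hσ]
      exact initialSegment_prefix (le_max_right _ _)
    have h2 := hc (K - σ.length) (notTypeFormula L _ τ) (isQF_notTypeFormula _ _)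
      ((hiW _ _).2 (.inl ⟨τ, ⟨hστ, by rw [formulaCode_notTypeFormula hwf' hτ,
        length_initialSegment] ⟩, hQ _ _ _ (initialSegment_prefix (le_max_left _ _)) hm'⟩))
      fun j => f (σ.length + j)
    rw [realize_notTypeFormula hτ] at h2
    have happ : ∀ j : Fin (σ.length + (K - σ.length)),
        f j = Fin.append c (fun j => f (σ.length + j)) j := by
      refine Fin.addCases (fun j => ?_) fun j => ?_
      · rw [Fin.append_left, ← hfc]; rfl
      · rw [Fin.append_right]; rfl
    refine h2 ⟨fun j j' hj => ?_, ?_⟩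
    · rw [← happ, ← happ] at hj
      exact Fin.val_injective (f.injective hj)
    · have hτ' : τ = initialSegment (bdiag L id f) (σ.length + (K - σ.length)) := by rw [hK]
      rw [hτ']
      exact initialSegment_eq_iff.2 fun n hn => mem_bdiag_fin_iff happ hn

/-- If an operator maps copies of `M` to copies of one of the orders `ω`, `ω*` and copies of `N` to
copies of the other, then the property of having a least or, respectively, a greatest element pulls
back to a computable `Σ₂` sentence. -/
theorem TuringOperator.MapsCopies.sigma2Th_diff_nonempty [Countable M] [Infinite M] [Countable N]
    [Infinite N] {Φ : TuringOperator} {b : Bool} (hM : Φ.MapsCopies L FirstOrder.Language.order M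
      (Omega b)) (hN : Φ.MapsCopies L FirstOrder.Language.order N (Omega !b))
    (h : ComputablyPresentable L M) : (sigma2Th L M \ sigma2Th L N).Nonempty := by
  obtain ⟨wf, hwf, hwf'⟩ := h.exists_computable_isBasicCode
  refine exists_mem_sigma2Th_diff hwf hwf' (P := fun x τ => Φ.Accepts τ (eqCode x x))
    (Q := fun x τ => ∃ y, Φ.Accepts τ (negCode (natLECode b x y))) ?_ ?_
    (fun x σ τ hστ h => h.mono hστ) (fun x σ τ hστ ⟨y, h⟩ => ⟨y, h.mono hστ⟩)
    (fun f => ?_) fun f x hx => ?_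
  · exact rePred_comp Φ.rePred_accepts
      (Computable.snd.pair (primrec_eqCode.comp .fst .fst).to_comp)
  · exact rePred_exists (rePred_comp Φ.rePred_accepts ((Computable.snd.comp .fst).pair
      (primrec_negCode.comp ((primrec_natLECode b).comp (Primrec.fst.comp .fst) .snd)).to_comp))
  · obtain ⟨T, hT, hm⟩ := hM _ (iso_copy f)
    rw [diagram_copy] at hm
    obtain ⟨x, hx, hy⟩ := exists_forall_of_iso hT
    exact ⟨x, hm.mem_iff_exists_accepts.1 hx, fun m ⟨y, hm'⟩ =>
      hy y (hm.mem_iff_exists_accepts.2 ⟨m, hm'⟩)⟩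
  · obtain ⟨T, hT, hm⟩ := hN _ (iso_copy f)
    rw [diagram_copy] at hm
    obtain ⟨y, hy⟩ := forall_exists_of_iso hT (hm.mem_iff_exists_accepts.2 hx)
    obtain ⟨m, hm'⟩ := hm.mem_iff_exists_accepts.1 hy
    exact ⟨m, y, hm'⟩

end

end TC

/-! ### The equivalence -/

theorem mainTheorem2 (L : FirstOrder.Language.{u, v}) [TC.ComputableLanguage L]
    (A : Type w) (B : Type w') [L.Structure A] [L.Structure B]
    [Countable A] [Countable B] [Infinite A] [Infinite B] (hAB : ¬ TC.Iso L A B) :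
    TC.TCEquivalent (TC.pairClass L A B) TC.omegaPair ↔
      (TC.ComputablyPresentable L A ∧ TC.ComputablyPresentable L B) ∧
      TC.SameExistential L A B ∧
      (TC.sigma2Th L A \ TC.sigma2Th L B).Nonempty ∧
      (TC.sigma2Th L B \ TC.sigma2Th L A).Nonempty := by
  open TC in
  constructor
  · rintro ⟨h₀, h₁⟩
    rw [omegaPair_eq] at h₀ h₁
    obtain ⟨Ψ, hΨ⟩ := h₁.exists_mapsCopies (not_iso_omega true)
    have hc : ComputablyPresentable L A ∧ ComputablyPresentable L B := by
      rcases hΨ with ⟨h, h'⟩ | ⟨h, h'⟩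
      · exact ⟨h.computablyPresentable, h'.computablyPresentable⟩
      · exact ⟨h'.computablyPresentable, h.computablyPresentable⟩
    refine ⟨hc, fun φ hφ => ?_, ?_⟩
    · rcases hΨ with ⟨h, h'⟩ | ⟨h, h'⟩
      · exact ⟨h.realize_of_isExistential h' (locallyEmbeds_omega _ _) hφ,
          h'.realize_of_isExistential h (locallyEmbeds_omega _ _) hφ⟩
      · exact ⟨h'.realize_of_isExistential h (locallyEmbeds_omega _ _) hφ,
          h.realize_of_isExistential h' (locallyEmbeds_omega _ _) hφ⟩
    · obtain ⟨Φ, ⟨h, h'⟩ | ⟨h, h'⟩⟩ := h₀.exists_mapsCopies hAB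
      · exact ⟨h.sigma2Th_diff_nonempty h' hc.1, h'.sigma2Th_diff_nonempty h hc.2⟩
      · exact ⟨h.sigma2Th_diff_nonempty h' hc.1, h'.sigma2Th_diff_nonempty h hc.2⟩
  · rintro ⟨⟨hA, hB⟩, hE, h₀, h₁⟩
    exact ⟨tcReducible_omegaPair hAB h₀ h₁, omegaPair_tcReducible hAB hA hB hE⟩
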